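/- **Setting.** Let $\mathcal M\subset\mathbb R^D$ be a compact $C^\infty$ (embedded, boundaryless) submanifold of dimension $d$, with Riemannian volume $V_{\mathcal M}$ (the $d$-dimensional Hausdorff measure on $\mathcal M$, normalised to agree with Lebesgue measure on $\mathbb R^d$). Its reach is the supremum of all $r>0$ such that every $z\in\mathbb R^D$ with $\operatorname{dist}(z,\mathcal M)<r$ has a unique nearest point in $\mathcal M$. $B_r(x)$ denotes an open ball and $v_d$ the Lebesgue measure of the unit ball of $\mathbb R^d$. A set $S$ is *$(c_0,r_0)$-regular* with respect to a measure $\upsilon$ if $\upsilon(S\cap B_r(x))\ge c_0\,\upsilon(B_r(x))$ for all $x\in S$, $r\in(0,r_0)$. A measure $\mu$ is *$(c_0,r_0,\nu_{\min},\nu_{\max})$-regular* with respect to $\upsilon$ if $\operatorname{supp}\mu$ is $(c_0,r_0)$-regular with respect to $\upsilon$ and $\mu\ll\upsilon$ with a density $\nu$ satisfying $\nu_{\min}\le\nu(x)\le\nu_{\max}$ for all $x\in\operatorname{supp}\mu$. Let $\mathbb P$ be a probability distribution of $(X,Y)\in\mathbb R^D\times\{0,1\}^A$, with covariate marginal $\mu$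 and reward functions $f^a(x)=\mathbb E[Y^a\mid X=x]$, $a\in[A]$. Put $\Delta_a(x)=\max_b f^b(x)-f^a(x)$, and let $\Delta(x)$ be the least of the positive numbers among $\Delta_1(x),\dots,\Delta_A(x)$, with $\Delta(x)=0$ if there are none. The *margin condition* with constants $\delta_\alpha,C_\alpha,\alpha$ says that $\mu(\{x:0<\Delta(x)<\delta\})\le C_\alpha\delta^\alpha$ for all $\delta\in(0,\delta_\alpha)$. Samples $(X_t,Y_t)$, $t=1,2,\dots$, are drawn i.i.d. from $\mathbb P$. A *policy* $\pi$ chooses in round $t$ an arm $\pi_t(X_t)\in[A]$ as a measurable function of $X_t$, of the earlier observations $(X_s,\pi_s(X_s),Y_s^{\pi_s(X_s)})_{s<t}$ and, possibly, of a random seed independent of the samples. Its regret is $R_n(\pi)=\sum_{t=1}^n\bigl(Y_t^{\pi_*(X_t)}-Y_t^{\pi_t(X_t)}\bigr)$, where $\pi_*$ is measurable with $\pi_*(x)\in\arg\max_a f^a(x)$ for all $x$ (the expected regret does not depend on the choice of $\pi_*$). **Theorem.** There is a universal constant $Z>0$ and, for all $d\in\mathbb N$ and $\tau>0$, there are constants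 $C_0,R_0,V_-,V_+>0$ depending only on $(d,\tau)$, such that for all $c_0\in(0,C_0)$, $r_0\in(0,R_0)$, $\nu_{\min}\in(0,V_-)$, $\nu_{\max}\in(V_+,\infty)$, $\delta_\alpha\in(0,Z)$, $\alpha\in(0,d)$, $C_\alpha>0$ and $\lambda>0$ there is a constant $C>0$, depending only on $(d,\tau)$, $(c_0,r_0,\nu_{\min},\nu_{\max})$, $(\alpha,\delta_\alpha,C_\alpha)$ and $\lambda$, for which the following holds. For every $D$, every compact $C^\infty$ submanifold $\mathcal M\subset\mathbb R^D$ of dimension $d$ and reach $\tau$, every $A\ge2$, every policy $\pi$ and every $n\in\mathbb N$ there is a distribution $\mathbb P$ on $\mathbb R^D\times\{0,1\}^A$ such that 1. the marginal $\mu$ of $X$ is $(c_0,r_0,\nu_{\min},\nu_{\max})$-regular with respect to $V_{\mathcal M}$, and consequently satisfies the dimension assumption $\mu(B_r(x))\ge \nu_{\min}c_0v_d2^{-d}\,r^d$ for all $x\in\operatorname{supp}\mu$ and $r\in(0,\min\{\tau/4,r_0\})$; 2. the reward functions $f^a$ are $\lambda$-Lipschitz; 3. $\mathbb P$ satisfies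 the margin condition with constants $\delta_\alpha,C_\alpha,\alpha$; 4. $\displaystyle \mathbb E[R_n(\pi)]\ \ge\ C\cdot n^{\,1-\frac{\alpha+1}{d+2}}.$ (In particular $\mathbb E[R_n(\pi)]\ge C\,n^{1-\frac{\alpha+1}{d+1}}$.) -/

import Mathlib

open scoped ContDiff ENNReal

noncomputable section

namespace ManifoldBandit

open MeasureTheory Metric

/-! ### Submanifolds of Euclidean space, reach, regular measures -/

/-- `ℝ^D` with its Euclidean norm. -/
abbrev Euc (D : ℕ) : Type := EuclideanSpace ℝ (Fin D)

/-- `M` is a (boundaryless, embedded) `C^∞` submanifold of `ℝ^D` of dimension `d`: around each of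
its points there is a smooth slice chart, that is a `C^∞` diffeomorphism between open sets of `ℝ^D`
which carries `M` to the coordinate subspace on which the last `D - d` coordinates vanish. -/
def IsSmoothSubmanifold (d D : ℕ) (M : Set (Euc D)) : Prop :=
  d ≤ D ∧ ∀ p ∈ M, ∃ Φ : OpenPartialHomeomorph (Euc D) (Euc D),
    p ∈ Φ.source ∧ ContDiffOn ℝ ∞ Φ Φ.source ∧ ContDiffOn ℝ ∞ Φ.symm Φ.target ∧
      ∀ x ∈ Φ.source, (x ∈ M ↔ ∀ i : Fin D, d ≤ (i : ℕ) → Φ x i = 0)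

/-- The reach of `M`: the supremum (in `[0, ∞]`) of all `r > 0` such that every point at distance
less than `r` from `M` has a unique nearest point in `M`. -/
def reach {D : ℕ} (M : Set (Euc D)) : ℝ≥0∞ :=
  ⨆ r ∈ {r : ℝ | 0 < r ∧ ∀ z : Euc D, infDist z M < r → ∃! p, p ∈ M ∧ dist z p = infDist z M},
    ENNReal.ofReal r

/-- The Riemannian volume of a `d`-dimensional submanifold `M` of `ℝ^D` (with the metric induced by
`ℝ^D`), as a measure on `ℝ^D` carried by `M`: the `d`-dimensional Hausdorff measure, normalised so
as to be Lebesgue measure on `ℝ^d`, restricted to `M`. -/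
def manifoldVolume (d : ℕ) {D : ℕ} (M : Set (Euc D)) : Measure (Euc D) :=
  (Measure.euclideanHausdorffMeasure d : Measure (Euc D)).restrict M

/-- `(c₀, r₀)`-regular sets with respect to `υ`. -/
def IsRegularSet {X : Type*} [PseudoMetricSpace X] [MeasurableSpace X] (υ : Measure X)
    (c₀ r₀ : ℝ) (S : Set X) : Prop :=
  ∀ x ∈ S, ∀ r : ℝ, 0 < r → r < r₀ → ENNReal.ofReal c₀ * υ (ball x r) ≤ υ (S ∩ ball x r)

/-- `(c₀, r₀, νmin, νmax)`-regular measures with respect to `υ`; the existence of the density `ν`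
contains absolute continuity. -/
def IsRegularMeasure {X : Type*} [PseudoMetricSpace X] [MeasurableSpace X] (υ : Measure X)
    (c₀ r₀ νmin νmax : ℝ) (μ : Measure X) : Prop :=
  IsRegularSet υ c₀ r₀ μ.support ∧
    ∃ ν : X → ℝ≥0∞, Measurable ν ∧ μ = υ.withDensity ν ∧
      ∀ x ∈ μ.support, ENNReal.ofReal νmin ≤ ν x ∧ ν x ≤ ENNReal.ofReal νmax

/-- The dimension assumption with radius `R`, dimension `d` and constant `Cd`. -/
def DimensionAssumption {X : Type*} [PseudoMetricSpace X] [MeasurableSpace X] (μ : Measure X)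
    (R : ℝ) (d : ℕ) (Cd : ℝ≥0∞) : Prop :=
  ∀ x ∈ μ.support, ∀ r : ℝ, 0 < r → r < R → Cd * ENNReal.ofReal (r ^ d) ≤ μ (ball x r)

/-! ### Bandits with covariates -/

/-- A pair `(X, Y)` of a covariate and a vector of binary rewards, one for each arm. -/
abbrev Sample (D A : ℕ) : Type := Euc D × (Fin A → Fin 2)

/-- The reward `Y^a`, as a real number. -/
def reward {D A : ℕ} (z : Sample D A) (a : Fin A) : ℝ := ((z.2 a : ℕ) : ℝ)

/-- The marginal distribution of the covariate. -/
def marginal {D A : ℕ} (P : Measure (Sample D A)) : Measure (Euc D) := P.map Prod.fst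

/-- `f` is the family of reward functions of `P`: `f a x = E[Y^a | X = x]`. -/
def IsRewardFunction {D A : ℕ} (P : Measure (Sample D A)) (f : Fin A → Euc D → ℝ) : Prop :=
  ∀ a, condExp (MeasurableSpace.comap Prod.fst inferInstance) P (fun z => reward z a)
    =ᵐ[P] fun z => f a z.1

/-- The reward functions are `lam`-Lipschitz. -/
def LipschitzAssumption {D A : ℕ} (f : Fin A → Euc D → ℝ) (lam : ℝ) : Prop :=
  ∀ a x y, |f a x - f a y| ≤ lam * dist x y

/-- The sub-optimality `Δ_a(x) = max_b f^b(x) - f^a(x)` of the arm `a` at `x`. -/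
def subopt {D A : ℕ} (f : Fin A → Euc D → ℝ) (a : Fin A) (x : Euc D) : ℝ :=
  (⨆ b, f b x) - f a x

/-- The margin `Δ(x)`: the least positive sub-optimality at `x`, and `0` if all arms are optimal
(`sInf ∅ = 0`). -/
def margin {D A : ℕ} (f : Fin A → Euc D → ℝ) (x : Euc D) : ℝ :=
  sInf {t : ℝ | 0 < t ∧ ∃ a, subopt f a x = t}

/-- The margin condition with constants `δα`, `Cα`, `α`. -/
def MarginAssumption {D A : ℕ} (μ : Measure (Euc D)) (f : Fin A → Euc D → ℝ)
    (δα Cα α : ℝ) : Prop :=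
  ∀ δ : ℝ, 0 < δ → δ < δα →
    μ {x | 0 < margin f x ∧ margin f x < δ} ≤ ENNReal.ofReal (Cα * δ ^ α)

/-- What the player observes in one round: the covariate, the arm played, the reward of that arm. -/
abbrev Observation (D A : ℕ) : Type := Euc D × Fin A × Fin 2

/-- A bandit policy: in round `t` (rounds are numbered from `0`) the arm is chosen from the
observations of the `t` earlier rounds, the current covariate and a random seed in `S`
(deterministic policies are those with a one-point `S`). -/
structure Policy (S : Type) [MeasurableSpace S] (D A : ℕ) where
  act : (t : ℕ) → S → (Fin t → Observation D A) → Euc D → Fin A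
  measurable_act : ∀ t, Measurable
    fun q : S × (Fin t → Observation D A) × Euc D => act t q.1 q.2.1 q.2.2

namespace Policy

variable {S : Type} [MeasurableSpace S] {D A : ℕ}

/-- The observations made in the first `t` rounds when `π` is run with seed `s` on the data `z`. -/
def history (π : Policy S D A) (s : S) (z : ℕ → Sample D A) : (t : ℕ) → Fin t → Observation D A
  | 0 => Fin.elim0
  | t + 1 =>
    let a := π.act t s (history π s z t) (z t).1
    Fin.snoc (α := fun _ => Observation D A) (history π s z t) ((z t).1, a, (z t).2 a)

/-- The arm played in round `t`. -/
def arm (π : Policy S D A) (s : S) (z : ℕ → Sample D A) (t : ℕ) : Fin A :=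
  π.act t s (π.history s z t) (z t).1

/-- The regret after `n` rounds relative to the oracle `o`. -/
def regret (π : Policy S D A) (o : Euc D → Fin A) (n : ℕ) (s : S) (z : ℕ → Sample D A) : ℝ :=
  ∑ t ∈ Finset.range n, (reward (z t) (o (z t).1) - reward (z t) (π.arm s z t))

/-- The expected regret after `n` rounds, the samples being i.i.d. with law `P` and independent of
the seed, which has law `ρ`. -/
def expectedRegret (π : Policy S D A) (ρ : Measure S) (P : Measure (Sample D A))
    (o : Euc D → Fin A) (n : ℕ) : ℝ :=
  ∫ q : S × (ℕ → Sample D A), π.regret o n q.1 q.2 ∂(ρ.prod (Measure.infinitePi fun _ : ℕ => P))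

end Policy

/-- `o` is an oracle policy: it plays at every `x` an arm of maximal expected reward. (The expected
regret does not depend on which oracle is taken.) -/
def IsOracle {D A : ℕ} (f : Fin A → Euc D → ℝ) (o : Euc D → Fin A) : Prop :=
  Measurable o ∧ ∀ x a, f a x ≤ f (o x) x

end ManifoldBandit

end

/-!
The policy is defeated by a family of distributions that differ only in the sign of a small
perturbation of one reward function on many small cells of `M`.

*Geometry.* The reach is used only through the fact that no point of `M` enters an open ball of
radius `τ` tangent to `M` (`le_dist_of_nearest`). It implies Federer's inequality: `y - q` is
tangent to `M` at `q` up to an error of length at most `‖y - q‖ ^ 2 / (2 * τ)`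
(`IsTangentSpace.norm_sub_starProjection_le`). At small scales this inequality bounds the angle
between the tangent spaces at two points by a multiple of their distance over `τ`; the smallness of
the scale depends on `M`, but passing to near-midpoints propagates the bound to the scale `τ`
(`angleLE_of_dist_lt`). So `M` is, near a given point, a bi-Lipschitz graph over a ball of the
tangent space whose radius depends only on `τ` (`exists_chart`). The grid of mesh `h` on a cube of
the fixed side `N h` in the tangent space, with each of its `N ^ d` cubes shrunk by half, is carried
to `M` by this chart. Shrinking separates the cells while their union keeps a fixed proportion of
every ball of radius below `N h` centred on it (`exists_isCellSystem`). The covariate is uniform on this union, so the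
constants in the regularity assumption depend on `d` and `τ` only.

*Statistics.* On `m` active cells the mean reward of the arm `a₀` is `1 / 2 ± ε`, elsewhere on the
cells it is `1 / 2`, and all other arms have mean reward `1 / 2`. Cells are at distance `h / 2` from
each other, so `ε = lam * h / 4` makes this function `lam`-Lipschitz on the union of the cells, and
it is extended to the whole space. As a covariate falls into a given cell with probability of order
`N ^ (-d)`, the sign on the cell cannot be detected from `n` samples as long as
`n * ε ^ 2 * N ^ (-d)` is small. This is proved for full observation of the rewards of all arms,
directly from the product densities (`two_point`), and a policy, which observes less, is a function
of these data. Averaging over all choices of signs, in every round the policy plays the wrong arm on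
every active cell with probability at least `1 / 8` (`sum_error_ge`), so for some choice of signs
its regret is at least of order `n * ε * m * N ^ (-d)` (`exists_expectedRegret_ge`).

*Calibration.* The margin is `ε` on the active cells and vanishes almost everywhere else, so that
the margin condition asks for `m * N ^ (-d)` to be at most of order `ε ^ α`. With `N` of order
`n ^ (1 / (d + 2))` and `m` as large as the margin condition allows, which is at least one cell
because `α < d`, the regret is of order `n * ε ^ (1 + α)`, where `ε` is of order
`n ^ (-1 / (d + 2))` (`exists_mesh`).
-/

namespace ManifoldBandit

open Filter Topology Set MeasureTheory Metric

/-! ### Tangent spaces of a compact smooth submanifold -/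

/-- A `C²` map is approximated by its derivative with a quadratic error, uniformly in the base
point near a given point. -/
theorem exists_quadratic_approx {E F : Type*} [NormedAddCommGroup E] [NormedSpace ℝ E]
    [NormedAddCommGroup F] [NormedSpace ℝ F] {g : E → F} {a₀ : E} (hg : ContDiffAt ℝ 2 g a₀) :
    ∃ r > 0, ∃ K > 0, ∀ a ∈ ball a₀ r, ∀ b ∈ ball a₀ r,
      ‖g b - g a - fderiv ℝ g a (b - a)‖ ≤ K * ‖b - a‖ ^ 2 := by
  have h1 : ContDiffAt ℝ 1 (fderiv ℝ g) a₀ := hg.fderiv_right (by norm_num)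
  obtain ⟨K, t, ht, hK⟩ := h1.exists_lipschitzOnWith
  have hd : ∀ᶠ a in 𝓝 a₀, DifferentiableAt ℝ g a :=
    (hg.eventually (by simp)).mono fun a ha => ha.differentiableAt (by norm_num)
  obtain ⟨r, hr, hball⟩ := Metric.mem_nhds_iff.1 (Filter.inter_mem ht hd)
  refine ⟨r, hr, K + 1, by positivity, fun a ha b hb => ?_⟩
  have hseg : segment ℝ a b ⊆ ball a₀ r := (convex_ball a₀ r).segment_subset ha hb
  have := (convex_segment a b).norm_image_sub_le_of_norm_hasFDerivWithin_le' (𝕜 := ℝ) (f := g)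
    (f' := fderiv ℝ g) (φ := fderiv ℝ g a) (C := K * ‖b - a‖)
    (fun x hx => ((hball (hseg hx)).2.hasFDerivAt).hasFDerivWithinAt)
    (fun x hx => by
      have h2 := hK.dist_le_mul x (hball (hseg hx)).1 a (hball ha).1
      rw [dist_eq_norm] at h2
      refine h2.trans ?_
      gcongr
      obtain ⟨u, v, hu, hv, huv, rfl⟩ := hx
      rw [dist_eq_norm]
      have : u • a + v • b - a = v • (b - a) := by
        have : u = 1 - v := by linarith
        rw [this]; module
      rw [this, norm_smul, Real.norm_of_nonneg hv]
      nlinarith [norm_nonneg (b - a)])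
    (left_mem_segment ℝ a b) (right_mem_segment ℝ a b)
  refine this.trans ?_
  nlinarith [norm_nonneg (b - a), sq_nonneg ‖b - a‖]

/-- The coordinate subspace of `ℝ^D` on which all but the first `d` coordinates vanish. -/
def coordSubspace (d D : ℕ) : Submodule ℝ (Euc D) where
  carrier := {v | ∀ i : Fin D, d ≤ (i : ℕ) → v i = 0}
  add_mem' := fun ha hb i hi => by simp [ha i hi, hb i hi]
  zero_mem' := fun i _ => by simp
  smul_mem' := fun c x hx i hi => by simp [hx i hi]

theorem finrank_coordSubspace {d D : ℕ} (h : d ≤ D) :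
    Module.finrank ℝ (coordSubspace d D) = d := by
  let e : (Fin d → ℝ) ≃ₗ[ℝ] coordSubspace d D :=
    { toFun := fun v => ⟨WithLp.toLp 2 fun i => if hi : (i : ℕ) < d then v ⟨i, hi⟩ else 0,
        fun i hi => by simp [not_lt.2 hi]⟩
      invFun := fun x j => x.1 (Fin.castLE h j)
      map_add' := fun v w => by
        ext i
        by_cases hi : (i : ℕ) < d <;> simp [hi]
      map_smul' := fun c v => by
        ext i
        by_cases hi : (i : ℕ) < d <;> simp [hi]
      left_inv := fun v => by ext j; simp
      right_inv := fun x => by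
        ext i
        by_cases hi : (i : ℕ) < d
        · simp [hi]
        · simp [hi, x.2 i (not_lt.1 hi)] }
  rw [← e.finrank_eq]; simp

/-- `T` is the `d`-dimensional tangent space of `M` at `q`, in quantitative form: within the
distance `ρ`, points of `M` are at quadratic distance from `q + T` and points of `q + T` are at
quadratic distance from `M`, both with the constant `K`. -/
def IsTangentSpace {D : ℕ} (M : Set (Euc D)) (d : ℕ) (ρ K : ℝ) (q : Euc D)
    (T : Submodule ℝ (Euc D)) : Prop :=
  Module.finrank ℝ T = d ∧
    (∀ y ∈ M, dist y q < ρ → ∃ w ∈ T, ‖y - q - w‖ ≤ K * ‖y - q‖ ^ 2) ∧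
    ∀ w ∈ T, ‖w‖ < ρ → ∃ y ∈ M, ‖y - q - w‖ ≤ K * ‖w‖ ^ 2

theorem IsTangentSpace.mono {D : ℕ} {M : Set (Euc D)} {d : ℕ} {ρ ρ' K K' : ℝ} {q : Euc D}
    {T : Submodule ℝ (Euc D)} (h : IsTangentSpace M d ρ K q T) (hρ : ρ' ≤ ρ) (hK : K ≤ K') :
    IsTangentSpace M d ρ' K' q T := by
  refine ⟨h.1, fun y hy hyq => ?_, fun w hw hwρ => ?_⟩
  · obtain ⟨w, hw, h1⟩ := h.2.1 y hy (hyq.trans_le hρ)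
    exact ⟨w, hw, h1.trans (by gcongr)⟩
  · obtain ⟨y, hy, h1⟩ := h.2.2 w hw (hwρ.trans_le hρ)
    exact ⟨y, hy, h1.trans (by gcongr)⟩

/-- The tangent space is the image of the coordinate subspace under the derivative of the inverse of
a slice chart; the second-order errors are uniform near `p`. -/
theorem IsSmoothSubmanifold.exists_isTangentSpace_near {d D : ℕ} {M : Set (Euc D)}
    (hM : IsSmoothSubmanifold d D M) {p : Euc D} (hp : p ∈ M) :
    ∃ ρ > 0, ∃ K > 0, ∀ q ∈ M, dist q p < ρ → ∃ T, IsTangentSpace M d ρ K q T := by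
  obtain ⟨hdD, hM⟩ := hM
  obtain ⟨Φ, hpΦ, hΦ, hΨ, hslice⟩ := hM p hp
  set g := Φ.symm with hgdef
  have hΦp : Φ p ∈ Φ.target := Φ.map_source hpΦ
  have hgA : ContDiffAt ℝ ∞ g (Φ p) := hΨ.contDiffAt (Φ.open_target.mem_nhds hΦp)
  have hΦA : ContDiffAt ℝ ∞ Φ p := hΦ.contDiffAt (Φ.open_source.mem_nhds hpΦ)
  obtain ⟨r, hr, K, hK, hquad⟩ := exists_quadratic_approx (hgA.of_le
    (WithTop.coe_le_coe.2 le_top : ((2 : ℕ∞) : WithTop ℕ∞) ≤ ((⊤ : ℕ∞) : WithTop ℕ∞)))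
  -- a radius on which `Φ` is Lipschitz
  obtain ⟨L, t, ht, hL⟩ := (hΦA.of_le
    (WithTop.coe_le_coe.2 le_top : ((1 : ℕ∞) : WithTop ℕ∞) ≤ ((⊤ : ℕ∞) : WithTop ℕ∞))).exists_lipschitzOnWith
  have hcont : ContinuousAt Φ p := hΦA.continuousAt
  have hnear : ∀ᶠ x in 𝓝 p, x ∈ t ∧ x ∈ Φ.source ∧ Φ x ∈ ball (Φ p) (r / 2) :=
    ((eventually_mem_set.2 ht)).and ((Φ.open_source.eventually_mem hpΦ).and
      (hcont.eventually (ball_mem_nhds _ (by positivity))))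
  obtain ⟨s, hs, hball⟩ := Metric.eventually_nhds_iff_ball.1 hnear
  have htgt : ∀ᶠ a in 𝓝 (Φ p), a ∈ Φ.target := Φ.open_target.eventually_mem hΦp
  obtain ⟨r', hr', hballT⟩ := Metric.eventually_nhds_iff_ball.1 htgt
  -- shrink once more so that `Φ q` lies well inside the target
  have hnear2 : ∀ᶠ x in 𝓝 p, Φ x ∈ ball (Φ p) (r' / 2) :=
    hcont.eventually (ball_mem_nhds _ (by positivity))
  obtain ⟨s', hs', hball'⟩ := Metric.eventually_nhds_iff_ball.1 hnear2
  set L1 : ℝ := L + 1 with hL1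
  have hL1pos : 0 < L1 := by positivity
  refine ⟨min (min (s / 2) s') (min (r / 2 / L1) (r' / 2 / L1)), by positivity,
    K * L1 ^ 2, by positivity, fun q hq hqp => ?_⟩
  have hqs : q ∈ ball p s := by
    rw [mem_ball]; refine hqp.trans_le ((min_le_left _ _).trans ((min_le_left _ _).trans ?_))
    linarith
  have hqs' : q ∈ ball p s' :=
    mem_ball.2 (hqp.trans_le ((min_le_left _ _).trans (min_le_right _ _)))
  obtain ⟨hqt, hqΦ, hqr⟩ := hball q hqs
  have hqr' := hball' q hqs'
  have hgΦ : g (Φ q) = q := Φ.left_inv hqΦ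
  have hΦqT : Φ q ∈ Φ.target := Φ.map_source hqΦ
  have hdg : DifferentiableAt ℝ g (Φ q) :=
    (hΨ.contDiffAt (Φ.open_target.mem_nhds hΦqT)).differentiableAt (by simp)
  have hdΦ : DifferentiableAt ℝ Φ q :=
    (hΦ.contDiffAt (Φ.open_source.mem_nhds hqΦ)).differentiableAt (by simp)
  -- the two derivatives are inverse to each other
  have hinv : ∀ e, fderiv ℝ Φ q (fderiv ℝ g (Φ q) e) = e := by
    intro e
    have hdΦ' : HasFDerivAt Φ (fderiv ℝ Φ q) (g (Φ q)) := by
      rw [hgΦ]; exact hdΦ.hasFDerivAt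
    have h1 := hdΦ'.comp (Φ q) hdg.hasFDerivAt
    have h2 : HasFDerivAt (Φ ∘ g) (ContinuousLinearMap.id ℝ (Euc D)) (Φ q) := by
      refine (hasFDerivAt_id (Φ q)).congr_of_eventuallyEq ?_
      filter_upwards [Φ.open_target.mem_nhds hΦqT] with a ha
      exact Φ.right_inv ha
    have h3 := h1.unique h2
    exact DFunLike.congr_fun h3 e
  have hnormΦ : ‖fderiv ℝ Φ q‖ ≤ L1 := by
    have : ‖fderiv ℝ Φ q‖ ≤ L := norm_fderiv_le_of_lipschitzOn ℝ (by
      have : ball p s ∈ 𝓝 q := isOpen_ball.mem_nhds hqs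
      exact Filter.mem_of_superset this fun x hx => (hball x hx).1) hL
    linarith
  have hmemL : ∀ x ∈ Φ.source, x ∈ M → Φ x ∈ coordSubspace d D :=
    fun x hx hxM => (hslice x hx).1 hxM
  have hinj : Function.Injective (fderiv ℝ g (Φ q)) :=
    Function.LeftInverse.injective hinv
  refine ⟨(coordSubspace d D).map (fderiv ℝ g (Φ q) : Euc D →ₗ[ℝ] Euc D), ?_, ?_, ?_⟩
  · rw [← (Submodule.equivMapOfInjective _ hinj _).finrank_eq, finrank_coordSubspace hdD]
  · intro y hy hyq
    have hys : y ∈ ball p s := by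
      rw [mem_ball]
      have h1 : dist y q < s / 2 := hyq.trans_le ((min_le_left _ _).trans (min_le_left _ _))
      have h2 : dist q p < s / 2 := hqp.trans_le ((min_le_left _ _).trans (min_le_left _ _))
      linarith [dist_triangle y q p]
    obtain ⟨hyt, hyΦ, hyr⟩ := hball y hys
    refine ⟨fderiv ℝ g (Φ q) (Φ y - Φ q), ⟨Φ y - Φ q,
      Submodule.sub_mem _ (hmemL y hyΦ hy) (hmemL q hqΦ hq), rfl⟩, ?_⟩
    have h1 := hquad (Φ q) (ball_subset_ball (by linarith) hqr) (Φ y)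
      (ball_subset_ball (by linarith) hyr)
    rw [hgΦ, show g (Φ y) = y from Φ.left_inv hyΦ] at h1
    refine h1.trans ?_
    have h2 : ‖Φ y - Φ q‖ ≤ L1 * ‖y - q‖ := by
      have := hL.dist_le_mul y hyt q hqt
      rw [dist_eq_norm, dist_eq_norm] at this
      refine this.trans ?_
      gcongr
      simp [hL1]
    calc K * ‖Φ y - Φ q‖ ^ 2 ≤ K * (L1 * ‖y - q‖) ^ 2 := by gcongr
      _ = K * L1 ^ 2 * ‖y - q‖ ^ 2 := by ring
  · rintro w ⟨e, he, rfl⟩ hw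
    simp only [ContinuousLinearMap.coe_coe] at hw ⊢
    set w := fderiv ℝ g (Φ q) e with hwdef
    have hew : ‖e‖ ≤ L1 * ‖w‖ := by
      have : e = fderiv ℝ Φ q w := (hinv e).symm
      rw [this]
      exact (ContinuousLinearMap.le_opNorm _ _).trans (by gcongr)
    have hw1 : ‖w‖ < r / 2 / L1 := hw.trans_le ((min_le_right _ _).trans (min_le_left _ _))
    have hw2 : ‖w‖ < r' / 2 / L1 := hw.trans_le ((min_le_right _ _).trans (min_le_right _ _))
    rw [lt_div_iff₀ hL1pos] at hw1 hw2
    have he1 : Φ q + e ∈ ball (Φ p) r := by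
      rw [mem_ball]
      have : dist (Φ q + e) (Φ q) = ‖e‖ := by simp [dist_eq_norm]
      have h3 := mem_ball.1 hqr
      linarith [dist_triangle (Φ q + e) (Φ q) (Φ p)]
    have he2 : Φ q + e ∈ ball (Φ p) r' := by
      rw [mem_ball]
      have : dist (Φ q + e) (Φ q) = ‖e‖ := by simp [dist_eq_norm]
      have h3 := mem_ball.1 hqr'
      linarith [dist_triangle (Φ q + e) (Φ q) (Φ p)]
    have heT := hballT _ he2
    refine ⟨g (Φ q + e), ?_, ?_⟩
    · rw [hslice _ (Φ.map_target heT), show Φ (g (Φ q + e)) = Φ q + e from Φ.right_inv heT]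
      exact Submodule.add_mem (coordSubspace d D) (hmemL q hqΦ hq) he
    · have h1 := hquad (Φ q) (ball_subset_ball (by linarith) hqr) (Φ q + e) he1
      rw [hgΦ, add_sub_cancel_left] at h1
      refine h1.trans ?_
      calc K * ‖e‖ ^ 2 ≤ K * (L1 * ‖w‖) ^ 2 := by gcongr
        _ = K * L1 ^ 2 * ‖w‖ ^ 2 := by ring

/-- By compactness, `ρ` and `K` can be chosen for all points of `M` at once. They are not controlled
by the reach, and later estimates must not depend on them. -/
theorem IsSmoothSubmanifold.exists_isTangentSpace {d D : ℕ} {M : Set (Euc D)}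
    (hM : IsSmoothSubmanifold d D M) (hc : IsCompact M) :
    ∃ ρ > 0, ∃ K > 0, ∀ q ∈ M, ∃ T, IsTangentSpace M d ρ K q T := by
  suffices ∃ ρ > 0, ∃ K > 0, ∀ q ∈ M, q ∈ M → ∃ T, IsTangentSpace M d ρ K q T by
    obtain ⟨ρ, hρ, K, hK, h⟩ := this
    exact ⟨ρ, hρ, K, hK, fun q hq => h q hq hq⟩
  refine hc.induction_on (p := fun s => ∃ ρ > 0, ∃ K > 0, ∀ q ∈ s, q ∈ M →
    ∃ T, IsTangentSpace M d ρ K q T) ⟨1, one_pos, 1, one_pos, by simp⟩ ?_ ?_ ?_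
  · rintro s t hst ⟨ρ, hρ, K, hK, h⟩
    exact ⟨ρ, hρ, K, hK, fun q hq => h q (hst hq)⟩
  · rintro s t ⟨ρ, hρ, K, hK, h⟩ ⟨ρ', hρ', K', hK', h'⟩
    refine ⟨min ρ ρ', by positivity, max K K', by positivity, fun q hq hqM => ?_⟩
    rcases hq with hq | hq
    · obtain ⟨T, hT⟩ := h q hq hqM
      exact ⟨T, hT.mono (min_le_left _ _) (le_max_left _ _)⟩
    · obtain ⟨T, hT⟩ := h' q hq hqM
      exact ⟨T, hT.mono (min_le_right _ _) (le_max_right _ _)⟩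
  · intro p hp
    obtain ⟨ρ, hρ, K, hK, h⟩ := hM.exists_isTangentSpace_near hp
    exact ⟨ball p ρ, mem_nhdsWithin_of_mem_nhds (ball_mem_nhds p hρ), ρ, hρ, K, hK,
      fun q hq hqM => h q hqM hq⟩

/-! ### Consequences of the reach -/

/-- Every point at distance less than the reach has a unique nearest point. -/
theorem existsUnique_nearest_of_reach {D : ℕ} {M : Set (Euc D)} {τ : ℝ}
    (hτ : reach M = ENNReal.ofReal τ) {z : Euc D} (hz : infDist z M < τ) :
    ∃! p, p ∈ M ∧ dist z p = infDist z M := by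
  have hτpos : 0 < τ := infDist_nonneg.trans_lt hz
  have h : ENNReal.ofReal (infDist z M) < reach M := by
    rw [hτ]; exact (ENNReal.ofReal_lt_ofReal_iff hτpos).2 hz
  simp only [reach, lt_iSup_iff] at h
  obtain ⟨r, ⟨hr, hr'⟩, hlt⟩ := h
  exact hr' z ((ENNReal.ofReal_lt_ofReal_iff hr).1 hlt)

/-- Moving away from the nearest point increases the distance to `M` at unit rate, to first
order: this only uses that the nearest point is unique. -/
theorem infDist_growth_local {D : ℕ} {M : Set (Euc D)} (hM : IsCompact M) {z p : Euc D}
    (hp : p ∈ M) (hzp : dist z p = infDist z M) (hpos : 0 < infDist z M)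
    (huniq : ∀ q ∈ M, dist z q = infDist z M → q = p) {η : ℝ} (hη : 0 < η) (hη1 : η < 1) :
    ∃ ε₀ > 0, ∀ ε, 0 < ε → ε < ε₀ →
      infDist z M + (1 - η) * ε ≤ infDist (z + (ε / infDist z M) • (z - p)) M := by
  set δ := infDist z M with hδ
  set u : Euc D := (1 / δ) • (z - p) with hu
  have hnu : ‖u‖ = 1 := by
    rw [hu, norm_smul, ← dist_eq_norm, hzp, Real.norm_of_nonneg (by positivity)]
    field_simp
  have hzpu : inner ℝ u (z - p) = δ := by
    rw [hu, real_inner_smul_left, real_inner_self_eq_norm_sq, ← dist_eq_norm, hzp]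
    field_simp
  set B := M ∩ {q | inner ℝ u (z - q) ≤ (1 - η) * δ} with hB
  have hBc : IsCompact B := hM.inter_right (isClosed_le (by fun_prop) (by fun_prop))
  -- points of `M` in a direction different from `p` are farther away by a definite amount
  obtain ⟨c, hc, hcB⟩ : ∃ c > 0, ∀ q ∈ B, δ + c ≤ dist z q := by
    rcases B.eq_empty_or_nonempty with h | h
    · exact ⟨1, one_pos, by simp [h]⟩
    · obtain ⟨q₀, hq₀, hmin⟩ := hBc.exists_isMinOn h
        (f := fun q => dist z q) (by fun_prop)
      have hlt : δ < dist z q₀ := by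
        refine lt_of_le_of_ne (infDist_le_dist_of_mem hq₀.1) fun heq => ?_
        have h1 := huniq q₀ hq₀.1 heq.symm
        have h2 : inner ℝ u (z - q₀) ≤ (1 - η) * δ := hq₀.2
        rw [h1, hzpu] at h2
        nlinarith
      exact ⟨dist z q₀ - δ, by linarith, fun q hq => by
        have : dist z q₀ ≤ dist z q := hmin hq
        linarith⟩
  refine ⟨c / 2, by positivity, fun ε hε hεc => ?_⟩
  have hmove : z + (ε / δ) • (z - p) = z + ε • u := by
    rw [hu, smul_smul]; congr 2; ring
  rw [hmove]
  obtain ⟨q, hq, hqd⟩ := hM.exists_infDist_eq_dist ⟨p, hp⟩ (z + ε • u)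
  have hle : infDist (z + ε • u) M ≤ δ + ε := by
    have := infDist_le_infDist_add_dist (s := M) (x := z + ε • u) (y := z)
    simpa [dist_eq_norm, norm_smul, hnu, abs_of_pos hε] using this
  have hqB : (1 - η) * δ < inner ℝ u (z - q) := by
    by_contra hcon
    have h1 := hcB q ⟨hq, not_lt.1 hcon⟩
    have h2 := dist_triangle z (z + ε • u) q
    have h3 : dist z (z + ε • u) = ε := by
      simp [dist_eq_norm, norm_smul, hnu, abs_of_pos hε]
    linarith
  have hzq : δ ≤ ‖z - q‖ := by rw [← dist_eq_norm]; exact infDist_le_dist_of_mem hq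
  have hsq : ‖z + ε • u - q‖ ^ 2 = ‖z - q‖ ^ 2 + 2 * ε * inner ℝ u (z - q) + ε ^ 2 := by
    have : z + ε • u - q = (z - q) + ε • u := by abel
    rw [this, norm_add_sq_real, real_inner_smul_right, norm_smul, hnu, Real.norm_of_nonneg hε.le,
      real_inner_comm]
    ring
  rw [hqd, dist_eq_norm]
  refine le_of_sq_le_sq ?_ (norm_nonneg _)
  rw [hsq]
  have h4 : δ ^ 2 ≤ ‖z - q‖ ^ 2 := by gcongr
  nlinarith [mul_pos hε hε, mul_lt_mul_of_pos_left hqB hε, mul_pos hη hε, mul_pos (mul_pos hε hε) hη]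

/-- Along the segment leaving `M` through a point `z` with nearest point `p`, the point `p` remains
nearest up to the distance `τ`: no point of `M` enters the open ball of radius `τ` that touches `M`
at `p` in the direction of `z`. -/
theorem le_dist_of_nearest {D : ℕ} {M : Set (Euc D)} (hM : IsCompact M) {τ : ℝ}
    (hτ : reach M = ENNReal.ofReal τ) {p u : Euc D} (hp : p ∈ M) (hu : ‖u‖ = 1) {t : ℝ}
    (ht : 0 < t) (htτ : t < τ) (hpt : infDist (p + t • u) M = t) {y : Euc D} (hy : y ∈ M) :
    τ ≤ dist (p + τ • u) y := by
  set z := p + t • u with hz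
  have hne : M.Nonempty := ⟨p, hp⟩
  have hzp : dist z p = t := by simp [hz, dist_eq_norm, norm_smul, hu, abs_of_pos ht]
  set b := τ - t with hb
  have hb0 : 0 ≤ b := by linarith
  -- the distance to `M` takes a value of at least `t + (1 - η) s` within distance `s` of `z`
  have key : ∀ η : ℝ, 0 < η → η < 1 → ∃ w ∈ closedBall z b, t + (1 - η) * b ≤ infDist w M := by
    intro η hη hη1
    set A : Set ℝ := {s | ∃ w ∈ closedBall z s, t + (1 - η) * s ≤ infDist w M} with hA
    have hclosed : IsClosed (A ∩ Icc 0 b) := by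
      set Q : Set (ℝ × Euc D) := (Icc 0 b ×ˢ closedBall z b) ∩
        {x | dist x.2 z ≤ x.1 ∧ t + (1 - η) * x.1 ≤ infDist x.2 M} with hQ
      have hQc : IsCompact Q := by
        refine (isCompact_Icc.prod (isCompact_closedBall z b)).inter_right ?_
        have h1 : IsClosed {x : ℝ × Euc D | dist x.2 z ≤ x.1} :=
          isClosed_le (by fun_prop) (by fun_prop)
        have h2 : IsClosed {x : ℝ × Euc D | t + (1 - η) * x.1 ≤ infDist x.2 M} :=
          isClosed_le (by fun_prop) ((continuous_infDist_pt M).comp continuous_snd)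
        exact h1.inter h2
      have : A ∩ Icc 0 b = Prod.fst '' Q := by
        ext s
        constructor
        · rintro ⟨⟨w, hw, hws⟩, hs⟩
          exact ⟨(s, w), ⟨⟨hs, closedBall_subset_closedBall hs.2 hw⟩, hw, hws⟩, rfl⟩
        · rintro ⟨⟨s', w⟩, ⟨⟨hs, -⟩, hw, hws⟩, rfl⟩
          exact ⟨⟨w, hw, hws⟩, hs⟩
      rw [this]
      exact (hQc.image continuous_fst).isClosed
    have h0 : (0 : ℝ) ∈ A := ⟨z, by simp, by simp [hpt]⟩
    have hsub := hclosed.Icc_subset_of_forall_exists_gt h0 (by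
      rintro s ⟨⟨w, hw, hws⟩, hs⟩ s' hs'
      have hs0 : 0 ≤ s := hs.1
      have hsb : s < b := hs.2
      have hwle : infDist w M ≤ t + s := by
        have h1 := infDist_le_infDist_add_dist (s := M) (x := w) (y := z)
        rw [hpt] at h1
        linarith [mem_closedBall.1 hw]
      have hwτ : infDist w M < τ := by linarith
      have hwpos : 0 < infDist w M := by nlinarith
      obtain ⟨q, ⟨hq, hqd⟩, hquniq⟩ := existsUnique_nearest_of_reach hτ hwτ
      obtain ⟨ε₀, hε₀, hgrow⟩ := infDist_growth_local hM hq hqd hwpos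
        (fun q' hq' h => hquniq q' ⟨hq', h⟩) hη hη1
      have hs's : 0 < s' - s := sub_pos.2 hs'
      set ε := min (ε₀ / 2) (s' - s) with hε
      have hεpos : 0 < ε := by positivity
      have hεlt : ε < ε₀ := (min_le_left _ _).trans_lt (by linarith)
      refine ⟨s + ε, ⟨w + (ε / infDist w M) • (w - q), ?_, ?_⟩, ?_⟩
      · rw [mem_closedBall]
        have h1 : dist (w + (ε / infDist w M) • (w - q)) w = ε := by
          rw [dist_eq_norm, add_sub_cancel_left, norm_smul, ← dist_eq_norm, hqd,
            Real.norm_of_nonneg (by positivity)]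
          field_simp
        linarith [dist_triangle (w + (ε / infDist w M) • (w - q)) w z, mem_closedBall.1 hw]
      · linarith [hgrow ε hεpos hεlt]
      · exact ⟨by linarith, by linarith [min_le_right (ε₀ / 2) (s' - s)]⟩)
    exact hsub ⟨hb0, le_rfl⟩
  obtain ⟨w, hw, hmax⟩ := (isCompact_closedBall z b).exists_isMaxOn
    ⟨z, mem_closedBall_self hb0⟩ (continuous_infDist_pt M).continuousOn
  have hwτ : τ ≤ infDist w M := by
    by_contra hcon
    push Not at hcon
    have hbpos : 0 < b := by linarith
    set η := min ((τ - infDist w M) / (2 * b)) (1 / 2) with hη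
    have hηpos : 0 < η := by
      have : 0 < τ - infDist w M := by linarith
      positivity
    obtain ⟨w', hw', h⟩ := key η hηpos ((min_le_right _ _).trans_lt (by norm_num))
    have h1 : infDist w' M ≤ infDist w M := hmax hw'
    have h2 : η * b ≤ (τ - infDist w M) / 2 := by
      have := min_le_left ((τ - infDist w M) / (2 * b)) (1 / 2)
      calc η * b ≤ (τ - infDist w M) / (2 * b) * b := by gcongr
        _ = _ := by field_simp
    nlinarith
  -- equality in the triangle inequality places the maximiser on the ray
  have hw1 : ‖w - z‖ ≤ b := by rw [← dist_eq_norm]; exact hw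
  have hw2 : τ ≤ ‖(w - z) + t • u‖ := by
    have h1 : τ ≤ dist w p := hwτ.trans (infDist_le_dist_of_mem hp)
    rwa [dist_eq_norm, show w - p = (w - z) + t • u by rw [hz]; abel] at h1
  have hwz : w = p + τ • u := by
    have h1 : ‖(w - z) + t • u‖ ^ 2 = ‖w - z‖ ^ 2 + 2 * t * inner ℝ (w - z) u + t ^ 2 := by
      rw [norm_add_sq_real, real_inner_smul_right, norm_smul, hu, Real.norm_of_nonneg ht.le]
      ring
    have h2 : τ ^ 2 ≤ ‖(w - z) + t • u‖ ^ 2 := by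
      have : 0 ≤ τ := by linarith
      gcongr
    have h3 : ‖w - z‖ ^ 2 ≤ b ^ 2 := by gcongr
    have h4 : b ≤ inner ℝ (w - z) u := by
      have h5 : 2 * t * b ≤ 2 * t * inner ℝ (w - z) u := by
        have : τ = b + t := by rw [hb]; ring
        rw [this] at h2
        nlinarith
      nlinarith
    have h6 : ‖(w - z) - b • u‖ ^ 2 ≤ 0 := by
      rw [norm_sub_sq_real, real_inner_smul_right, norm_smul, hu, Real.norm_of_nonneg hb0]
      nlinarith
    have h7 : (w - z) - b • u = 0 := by
      rw [← norm_eq_zero]; nlinarith [norm_nonneg ((w - z) - b • u)]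
    have h8 : w = z + b • u := by rw [← sub_eq_zero, ← h7]; abel
    rw [h8, hz, hb]; module
  rw [← hwz]
  exact hwτ.trans (infDist_le_dist_of_mem hy)

/-- The condition that `y` lies outside the ball of radius `τ` that touches `M` at `p`, with the
square expanded. -/
theorem inner_le_of_nearest {D : ℕ} {M : Set (Euc D)} (hM : IsCompact M) {τ : ℝ}
    (hτ : reach M = ENNReal.ofReal τ) {p u : Euc D} (hp : p ∈ M) (hu : ‖u‖ = 1) {t : ℝ}
    (ht : 0 < t) (htτ : t < τ) (hpt : infDist (p + t • u) M = t) {y : Euc D} (hy : y ∈ M) :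
    inner ℝ (y - p) u ≤ ‖y - p‖ ^ 2 / (2 * τ) := by
  have h := le_dist_of_nearest hM hτ hp hu ht htτ hpt hy
  have hτ0 : 0 < τ := ht.trans htτ
  rw [dist_comm, dist_eq_norm, show y - (p + τ • u) = (y - p) - τ • u by abel] at h
  have h1 : τ ^ 2 ≤ ‖(y - p) - τ • u‖ ^ 2 := by gcongr
  rw [norm_sub_sq_real, real_inner_smul_right, norm_smul, hu, Real.norm_of_nonneg hτ0.le] at h1
  rw [le_div_iff₀ (by positivity)]
  nlinarith

/-- Federer's tangent inequality: `y - q` is tangent to `M` at `q` up to an error that is quadratic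
in its length. -/
theorem IsTangentSpace.norm_sub_starProjection_le {D d : ℕ} {M : Set (Euc D)} (hM : IsCompact M)
    {τ : ℝ} (hτ0 : 0 < τ) (hτ : reach M = ENNReal.ofReal τ) {ρ K : ℝ} (hρ : 0 < ρ) (hK : 0 < K)
    {q : Euc D} (hq : q ∈ M) {T : Submodule ℝ (Euc D)} (hT : IsTangentSpace M d ρ K q T)
    {y : Euc D} (hy : y ∈ M) :
    ‖(y - q) - T.starProjection (y - q)‖ ≤ ‖y - q‖ ^ 2 / (2 * τ) := by
  set n := (y - q) - T.starProjection (y - q) with hn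
  by_cases hn0 : n = 0
  · rw [hn0, norm_zero]; positivity
  have hnpos : 0 < ‖n‖ := norm_pos_iff.2 hn0
  set u := (1 / ‖n‖) • n with hu
  have hu1 : ‖u‖ = 1 := by
    rw [hu, norm_smul, Real.norm_of_nonneg (by positivity)]; field_simp
  have hnT : ∀ w ∈ T, inner ℝ n w = 0 := fun w hw => T.starProjection_inner_eq_zero _ w hw
  have huT : ∀ w ∈ T, inner ℝ w u = 0 := fun w hw => by
    rw [hu, real_inner_smul_right, real_inner_comm, hnT w hw, mul_zero]
  -- `t` is so small that the quadratic tangency makes `q` a nearest point of `q + t • u`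
  set t := min (min (ρ / 2) (τ / 2)) (1 / (2 * K)) with ht
  have htpos : 0 < t := by positivity
  have htρ : t ≤ ρ / 2 := (min_le_left _ _).trans (min_le_left _ _)
  have htτ : t ≤ τ / 2 := (min_le_left _ _).trans (min_le_right _ _)
  have htK : 2 * t * K ≤ 1 := by
    have h := min_le_right (min (ρ / 2) (τ / 2)) (1 / (2 * K))
    calc 2 * t * K ≤ 2 * (1 / (2 * K)) * K := by gcongr
      _ = 1 := by field_simp
  have hdist : infDist (q + t • u) M = t := by
    apply le_antisymm
    · refine (infDist_le_dist_of_mem hq).trans (le_of_eq ?_)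
      simp [dist_eq_norm, norm_smul, hu1, abs_of_pos htpos]
    · refine (le_infDist ⟨q, hq⟩).2 fun y' hy' => ?_
      rw [dist_comm, dist_eq_norm, show y' - (q + t • u) = (y' - q) - t • u by abel]
      by_cases hfar : dist y' q < ρ
      · obtain ⟨w, hw, hwb⟩ := hT.2.1 y' hy' hfar
        have h1 : inner ℝ (y' - q) u ≤ K * ‖y' - q‖ ^ 2 := by
          have h2 : inner ℝ (y' - q) u = inner ℝ (y' - q - w) u := by
            rw [inner_sub_left (y' - q) w u, huT w hw, sub_zero]
          rw [h2]
          refine (real_inner_le_norm _ _).trans ?_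
          rwa [hu1, mul_one]
        refine le_of_sq_le_sq ?_ (norm_nonneg _)
        rw [norm_sub_sq_real, real_inner_smul_right, norm_smul, hu1, Real.norm_of_nonneg htpos.le]
        nlinarith [mul_le_mul_of_nonneg_left h1 htpos.le, sq_nonneg ‖y' - q‖]
      · have h1 : ‖y' - q‖ - ‖t • u‖ ≤ ‖(y' - q) - t • u‖ := norm_sub_norm_le _ _
        rw [norm_smul, hu1, Real.norm_of_nonneg htpos.le] at h1
        rw [dist_eq_norm] at hfar
        linarith
  have h := inner_le_of_nearest hM hτ hq hu1 htpos (by linarith) hdist hy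
  have h2 : inner ℝ (y - q) u = ‖n‖ := by
    have h3 : y - q = n + T.starProjection (y - q) := by rw [hn]; abel
    rw [h3, inner_add_left, huT _ (T.starProjection_apply_mem _), hu, real_inner_smul_right,
      real_inner_self_eq_norm_sq]
    field_simp
    simp
  rwa [h2] at h

/-! ### Variation of the tangent spaces and graph charts of uniform size -/

theorem norm_sub_starProjection_le_norm {E : Type*} [NormedAddCommGroup E] [InnerProductSpace ℝ E]
    (U : Submodule ℝ E) [U.HasOrthogonalProjection] (x : E) : ‖x - U.starProjection x‖ ≤ ‖x‖ := by
  have := Uᗮ.norm_starProjection_apply_le x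
  rwa [Submodule.starProjection_orthogonal_val] at this

/-- The sine of the angle between two subspaces, measured by the distance to `U` of the unit vectors
of `V`, is at most `c`. -/
def AngleLE {D : ℕ} (c : ℝ) (U V : Submodule ℝ (Euc D)) : Prop :=
  ∀ w ∈ V, ‖w - U.starProjection w‖ ≤ c * ‖w‖

theorem AngleLE.mono {D : ℕ} {c c' : ℝ} {U V : Submodule ℝ (Euc D)} (h : AngleLE c U V)
    (hc : c ≤ c') : AngleLE c' U V := fun w hw => (h w hw).trans (by gcongr)

theorem AngleLE.norm_sub_le {D : ℕ} {c : ℝ} {U V : Submodule ℝ (Euc D)} (hc : 0 ≤ c)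
    (h : AngleLE c U V) (x : Euc D) :
    ‖x - U.starProjection x‖ ≤ c * ‖x‖ + ‖x - V.starProjection x‖ := by
  have h1 := h _ (V.starProjection_apply_mem x)
  have h2 := norm_sub_starProjection_le_norm U (x - V.starProjection x)
  have h3 := V.norm_starProjection_apply_le x
  have h4 : x - U.starProjection x = (V.starProjection x - U.starProjection (V.starProjection x)) +
      ((x - V.starProjection x) - U.starProjection (x - V.starProjection x)) := by
    rw [map_sub]; abel
  rw [h4]
  refine (norm_add_le _ _).trans (add_le_add (h1.trans (by gcongr)) h2)

theorem AngleLE.trans {D : ℕ} {c c' : ℝ} {U V W : Submodule ℝ (Euc D)} (hc : 0 ≤ c)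
    (h : AngleLE c U V) (h' : AngleLE c' V W) : AngleLE (c + c') U W := fun w hw => by
  have h1 := h.norm_sub_le hc w
  have h2 := h' w hw
  linarith

section GraphCharts

variable {D d : ℕ} {M : Set (Euc D)} {τ ρ K : ℝ} {T : Euc D → Submodule ℝ (Euc D)}

/-- At small scale the tangent spaces vary at a rate controlled by the reach alone. -/
theorem angleLE_of_dist_small (hM : IsCompact M) (hτ0 : 0 < τ) (hτ : reach M = ENNReal.ofReal τ)
    (hρ : 0 < ρ) (hK : 0 < K) (hT : ∀ q ∈ M, IsTangentSpace M d ρ K q (T q)) {q q' : Euc D}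
    (hq : q ∈ M) (hq' : q' ∈ M) (hdρ : dist q q' < ρ) (hdK : K * dist q q' ≤ 1 / 2) :
    AngleLE (10 * dist q q' / τ) (T q) (T q') := by
  set s := dist q q' with hs
  rcases (dist_nonneg (x := q) (y := q')).eq_or_lt with h0 | hspos
  · have : q = q' := dist_eq_zero.1 h0.symm
    subst this
    intro w hw
    rw [(T q).starProjection_eq_self_iff.2 hw]
    simp [hs]
  rw [← hs] at hspos
  have hF : ∀ {x y : Euc D}, x ∈ M → y ∈ M →
      ‖(y - x) - (T x).starProjection (y - x)‖ ≤ ‖y - x‖ ^ 2 / (2 * τ) := fun hx hy =>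
    (hT _ hx).norm_sub_starProjection_le hM hτ0 hτ hρ hK hx hy
  set A : Euc D →L[ℝ] Euc D :=
    (ContinuousLinearMap.id ℝ (Euc D) - (T q).starProjection) ∘L (T q').starProjection with hA
  have hAapp : ∀ x, A x = (T q').starProjection x - (T q).starProjection ((T q').starProjection x) :=
    fun x => by simp [hA]
  -- the bound for unit vectors of `T q'`, with the operator norm of `A` on the right
  have hunit : ∀ w ∈ T q', ‖w‖ = 1 → ‖w - (T q).starProjection w‖ ≤
      19 / 4 * s / τ + ‖A‖ / 2 := by
    intro w hw hw1
    obtain ⟨y, hy, hyw⟩ := (hT q' hq').2.2 (s • w) ((T q').smul_mem s hw)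
      (by rw [norm_smul, hw1, Real.norm_of_nonneg hspos.le]; linarith)
    rw [norm_smul, hw1, Real.norm_of_nonneg hspos.le, mul_one] at hyw
    set e := y - q' - s • w with he
    have heb : ‖e‖ ≤ s / 2 := by nlinarith
    have hyq' : ‖y - q'‖ ≤ 3 / 2 * s := by
      have : y - q' = e + s • w := by rw [he]; abel
      rw [this]
      refine (norm_add_le _ _).trans ?_
      rw [norm_smul, hw1, Real.norm_of_nonneg hspos.le]; linarith
    have hq'q : ‖q' - q‖ = s := by rw [hs, dist_comm, dist_eq_norm]
    have hyq : ‖y - q‖ ≤ 5 / 2 * s := by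
      have : y - q = (y - q') + (q' - q) := by abel
      rw [this]
      refine (norm_add_le _ _).trans ?_
      linarith
    -- the normal component at `q'` of the error
    have heN : e - (T q').starProjection e = (y - q') - (T q').starProjection (y - q') := by
      rw [he, map_sub (T q').starProjection (y - q') (s • w),
        (T q').starProjection_eq_self_iff.2 ((T q').smul_mem s hw)]
      abel
    have hsplit : s • (w - (T q).starProjection w) =
        ((y - q) - (T q).starProjection (y - q)) - ((q' - q) - (T q).starProjection (q' - q))
        - A e - ((e - (T q').starProjection e) - (T q).starProjection (e - (T q').starProjection e)) := by
      have h1 : s • w = (y - q) - (q' - q) - e := by rw [he]; abel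
      rw [smul_sub, ← map_smul, h1, hAapp]
      simp only [map_sub]
      abel
    have hnorm : ‖s • (w - (T q).starProjection w)‖ ≤
        (5 / 2 * s) ^ 2 / (2 * τ) + s ^ 2 / (2 * τ) + ‖A‖ * (s / 2) +
          (3 / 2 * s) ^ 2 / (2 * τ) := by
      rw [hsplit]
      have b1 := (hF hq hy).trans (by gcongr : _ ≤ (5 / 2 * s) ^ 2 / (2 * τ))
      have b2 := hF hq hq'
      rw [hq'q] at b2
      have b3 : ‖A e‖ ≤ ‖A‖ * (s / 2) := (A.le_opNorm e).trans (by gcongr)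
      have b4 := norm_sub_starProjection_le_norm (T q) (e - (T q').starProjection e)
      have b5 := (hF hq' hy).trans (by gcongr : _ ≤ (3 / 2 * s) ^ 2 / (2 * τ))
      rw [← heN] at b5
      refine (norm_sub_le _ _).trans (add_le_add ((norm_sub_le _ _).trans
        (add_le_add ((norm_sub_le _ _).trans (add_le_add b1 b2)) b3)) (b4.trans b5))
    rw [norm_smul, Real.norm_of_nonneg hspos.le] at hnorm
    have : s * ‖w - (T q).starProjection w‖ ≤ s * (19 / 4 * s / τ + ‖A‖ / 2) := by
      refine hnorm.trans (le_of_eq ?_)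
      field_simp
      ring
    exact le_of_mul_le_mul_left this hspos
  have hc0 : 0 ≤ 19 / 4 * s / τ + ‖A‖ / 2 := by positivity
  have hall : ∀ w ∈ T q', ‖w - (T q).starProjection w‖ ≤ (19 / 4 * s / τ + ‖A‖ / 2) * ‖w‖ := by
    intro w hw
    by_cases hw0 : w = 0
    · simp [hw0]
    have hwpos : 0 < ‖w‖ := norm_pos_iff.2 hw0
    have h := hunit ((1 / ‖w‖) • w) ((T q').smul_mem _ hw) (by
      rw [norm_smul, Real.norm_of_nonneg (by positivity)]; field_simp)
    rw [map_smul, ← smul_sub, norm_smul, Real.norm_of_nonneg (by positivity)] at h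
    rw [← div_le_iff₀ hwpos]
    refine le_trans (le_of_eq ?_) h
    field_simp
  -- taking the supremum over unit vectors absorbs the term `‖A‖ / 2` into the left-hand side
  have hAle : ‖A‖ ≤ 19 / 4 * s / τ + ‖A‖ / 2 := by
    refine A.opNorm_le_bound hc0 fun x => ?_
    rw [hAapp]
    refine (hall _ ((T q').starProjection_apply_mem x)).trans ?_
    gcongr
    exact (T q').norm_starProjection_apply_le x
  intro w hw
  refine (hall w hw).trans ?_
  gcongr
  have h1 : ‖A‖ ≤ 19 / 2 * s / τ := by
    have : 19 / 2 * s / τ = 2 * (19 / 4 * s / τ) := by ring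
    linarith
  have h2 : 19 / 4 * s / τ + 19 / 2 * s / τ / 2 ≤ 10 * s / τ := by
    rw [show 19 / 4 * s / τ + 19 / 2 * s / τ / 2 = (19 / 2 * s) / τ by ring]
    gcongr
    norm_num
  linarith

/-- The midpoint of two points of `M` is close to `M`, to second order in their distance. -/
theorem exists_near_midpoint (hM : IsCompact M) (hτ0 : 0 < τ) (hτ : reach M = ENNReal.ofReal τ)
    {q y : Euc D} (hq : q ∈ M) (hy : y ∈ M) (hd : dist q y ≤ τ) :
    ∃ m ∈ M, dist q m ≤ dist q y / 2 + dist q y ^ 2 / (4 * τ) ∧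
      dist m y ≤ dist q y / 2 + dist q y ^ 2 / (4 * τ) := by
  set s := dist q y with hs
  set c : Euc D := (1 / 2 : ℝ) • (q + y) with hc
  have hs0 : 0 ≤ s := dist_nonneg
  obtain ⟨m, hm, hcm⟩ := hM.exists_infDist_eq_dist ⟨q, hq⟩ c
  have hqc : dist q c = s / 2 := by
    rw [dist_eq_norm, show q - c = (1 / 2 : ℝ) • (q - y) by rw [hc]; module, norm_smul,
      ← dist_eq_norm, ← hs, Real.norm_of_nonneg (by norm_num)]
    ring
  have hcy : dist c y = s / 2 := by
    rw [dist_eq_norm, show c - y = (1 / 2 : ℝ) • (q - y) by rw [hc]; module, norm_smul,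
      ← dist_eq_norm, ← hs, Real.norm_of_nonneg (by norm_num)]
    ring
  set δ := infDist c M with hδ
  have hδs : δ ≤ s / 2 := by
    rw [← hqc, dist_comm]; exact infDist_le_dist_of_mem hq
  have hδ0 : 0 ≤ δ := infDist_nonneg
  have hkey : δ ≤ s ^ 2 / (4 * τ) := by
    rcases hδ0.eq_or_lt with h0 | hpos
    · rw [← h0]; positivity
    set u : Euc D := (1 / δ) • (c - m) with hu
    have hu1 : ‖u‖ = 1 := by
      rw [hu, norm_smul, ← dist_eq_norm, ← hcm, Real.norm_of_nonneg (by positivity)]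
      field_simp
    have hmc : m + δ • u = c := by
      rw [hu, smul_smul, mul_one_div_cancel hpos.ne', one_smul]; abel
    have hinf : infDist (m + δ • u) M = δ := by rw [hmc]
    have hδτ : δ < τ := by linarith
    have h1 := inner_le_of_nearest hM hτ hm hu1 hpos hδτ hinf hq
    have h2 := inner_le_of_nearest hM hτ hm hu1 hpos hδτ hinf hy
    have h3 : inner ℝ (q - m) u + inner ℝ (y - m) u = 2 * δ := by
      rw [← inner_add_left, show q - m + (y - m) = (2 : ℝ) • (c - m) by rw [hc]; module,
        show c - m = δ • u by rw [← hmc]; abel, real_inner_smul_left, real_inner_smul_left,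
        real_inner_self_eq_norm_sq, hu1]
      ring
    have h4 : ‖q - m‖ ^ 2 + ‖y - m‖ ^ 2 = 2 * δ ^ 2 + s ^ 2 / 2 := by
      have h5 : q - m = (c - m) + (1 / 2 : ℝ) • (q - y) := by rw [hc]; module
      have h6 : y - m = (c - m) - (1 / 2 : ℝ) • (q - y) := by rw [hc]; module
      rw [h5, h6, norm_add_sq_real, norm_sub_sq_real (c - m), norm_smul, ← dist_eq_norm c m, ← hcm,
        ← dist_eq_norm q y, ← hs, Real.norm_of_nonneg (by norm_num)]
      ring
    have h7 : 2 * δ * (2 * τ) ≤ 2 * δ ^ 2 + s ^ 2 / 2 := by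
      rw [← h3, ← h4]
      rw [le_div_iff₀ (by positivity)] at h1 h2
      linarith
    rw [le_div_iff₀ (by positivity)]
    nlinarith
  refine ⟨m, hm, ?_, ?_⟩
  · have := dist_triangle q c m
    linarith
  · have := dist_triangle m c y
    rw [dist_comm m c] at this
    linarith

/-- The tangent spaces of `M` vary in a Lipschitz way, at a rate controlled by the reach. The bound
at small scale is propagated to larger scales by repeatedly passing to near-midpoints. -/
theorem angleLE_of_dist_lt (hM : IsCompact M) (hτ0 : 0 < τ) (hτ : reach M = ENNReal.ofReal τ)
    (hρ : 0 < ρ) (hK : 0 < K) (hT : ∀ q ∈ M, IsTangentSpace M d ρ K q (T q)) {q q' : Euc D}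
    (hq : q ∈ M) (hq' : q' ∈ M) (hd : dist q q' ≤ τ / 2) :
    AngleLE (20 * dist q q' / τ) (T q) (T q') := by
  set ε := min (ρ / 2) (1 / (2 * K)) with hε
  have hεpos : 0 < ε := by positivity
  -- the denominator `τ - dist q q'` makes the bound stable when a step is halved
  have hind : ∀ n : ℕ, ∀ q ∈ M, ∀ q' ∈ M, dist q q' ≤ τ / 2 → dist q q' ≤ ε * (4 / 3) ^ n →
      AngleLE (10 * dist q q' / (τ - dist q q')) (T q) (T q') := by
    intro n
    induction n with
    | zero =>
      intro q hq q' hq' h1 h2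
      rw [pow_zero, mul_one] at h2
      have h3 : K * dist q q' ≤ 1 / 2 := by
        have := h2.trans (min_le_right _ _)
        rw [le_div_iff₀ (by positivity)] at this
        linarith
      have h4 : dist q q' < ρ := by
        have := h2.trans (min_le_left _ _)
        linarith
      refine (angleLE_of_dist_small hM hτ0 hτ hρ hK hT hq hq' h4 h3).mono ?_
      have : 0 ≤ dist q q' := dist_nonneg
      gcongr
      · linarith
      · linarith
    | succ n ih =>
      intro q hq q' hq' h1 h2
      obtain ⟨m, hm, hqm, hmq'⟩ := exists_near_midpoint hM hτ0 hτ hq hq' (by linarith)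
      set s := dist q q' with hs
      have hs0 : 0 ≤ s := dist_nonneg
      set s' := s / 2 + s ^ 2 / (4 * τ) with hs'
      have hsq : s ^ 2 / (4 * τ) ≤ s / 8 := by
        rw [div_le_iff₀ (by positivity)]; nlinarith
      have hs's : s' ≤ 3 / 4 * s := by linarith
      have hpow : 3 / 4 * s ≤ ε * (4 / 3) ^ n := by
        rw [pow_succ] at h2
        linarith
      have a1 := ih q hq m hm (by linarith) (by linarith)
      have a2 := ih m hm q' hq' (by linarith) (by linarith)
      have hmono : ∀ x, 0 ≤ x → x ≤ s' → 10 * x / (τ - x) ≤ 10 * s' / (τ - s') := by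
        intro x hx hxs
        have : 0 < τ - s' := by linarith
        gcongr
      have a1' := a1.mono (hmono _ dist_nonneg hqm)
      have a2' := a2.mono (hmono _ dist_nonneg hmq')
      have hs'0 : 0 ≤ s' := by positivity
      have hpos : 0 < τ - s' := by linarith
      refine (a1'.trans (by positivity) a2').mono ?_
      have hpos2 : 0 < τ - s := by linarith
      rw [← add_div, div_le_div_iff₀ hpos hpos2]
      have hs'e : 4 * τ * s' = 2 * τ * s + s ^ 2 := by rw [hs']; field_simp; ring
      have : (2 * s') * (τ - s) ≤ s * (τ - s') := by
        have h5 : (4 * τ) * ((2 * s') * (τ - s)) ≤ (4 * τ) * (s * (τ - s')) := by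
          have e1 : (4 * τ) * ((2 * s') * (τ - s)) = 2 * (4 * τ * s') * (τ - s) := by ring
          have e2 : (4 * τ) * (s * (τ - s')) = 4 * τ ^ 2 * s - (4 * τ * s') * s := by ring
          rw [e1, e2, hs'e]
          nlinarith [pow_nonneg hs0 3, mul_nonneg hτ0.le (pow_nonneg hs0 2)]
        exact le_of_mul_le_mul_left h5 (by positivity)
      nlinarith
  obtain ⟨n, hn⟩ := pow_unbounded_of_one_lt (dist q q' / ε) (by norm_num : (1 : ℝ) < 4 / 3)
  rw [div_lt_iff₀ hεpos] at hn
  refine (hind n q hq q' hq' hd (by linarith)).mono ?_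
  have h0 : 0 ≤ dist q q' := dist_nonneg
  rw [div_le_div_iff₀ (by linarith) hτ0]
  nlinarith

/-- Near `p`, the orthogonal projection to the tangent space at `p` is almost an isometry on `M`. -/
theorem norm_sub_le_two_mul_proj (hM : IsCompact M) (hτ0 : 0 < τ)
    (hτ : reach M = ENNReal.ofReal τ)
    (hρ : 0 < ρ) (hK : 0 < K) (hT : ∀ q ∈ M, IsTangentSpace M d ρ K q (T q)) {p y y' : Euc D}
    (hp : p ∈ M) (hy : y ∈ M) (hy' : y' ∈ M) (hyp : dist y p ≤ τ / 100)
    (hyp' : dist y' p ≤ τ / 100) :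
    ‖y' - y‖ ≤ 2 * ‖(T p).starProjection (y' - y)‖ := by
  have h1 := angleLE_of_dist_lt hM hτ0 hτ hρ hK hT hp hy (by rw [dist_comm]; linarith)
  have h2 := h1.norm_sub_le (by positivity) (y' - y)
  have h3 := (hT y hy).norm_sub_starProjection_le hM hτ0 hτ hρ hK hy hy'
  have h4 : ‖y' - y‖ ≤ τ / 50 := by
    rw [← dist_eq_norm]
    have := dist_triangle_right y' y p
    linarith
  have h5 : 20 * dist p y / τ ≤ 1 / 5 := by
    rw [div_le_iff₀ hτ0, dist_comm]; linarith
  have h6 : ‖y' - y‖ ^ 2 / (2 * τ) ≤ 1 / 100 * ‖y' - y‖ := by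
    rw [div_le_iff₀ (by positivity)]
    nlinarith [norm_nonneg (y' - y)]
  have h7 : ‖y' - y‖ ≤ ‖(y' - y) - (T p).starProjection (y' - y)‖ +
      ‖(T p).starProjection (y' - y)‖ := by
    have := norm_add_le ((y' - y) - (T p).starProjection (y' - y)) ((T p).starProjection (y' - y))
    rwa [sub_add_cancel] at this
  have h8 : 20 * dist p y / τ * ‖y' - y‖ ≤ 1 / 5 * ‖y' - y‖ := by gcongr
  linarith [norm_nonneg (y' - y)]

/-- The projection of `M` to its tangent space at `p` covers a ball: a point of `M` whose projection
is nearest to a given vector `v` has projection `v`, as the tangent space there is not orthogonal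
to any direction of the tangent space at `p`. -/
theorem exists_proj_eq (hM : IsCompact M) (hτ0 : 0 < τ) (hτ : reach M = ENNReal.ofReal τ)
    (hρ : 0 < ρ) (hK : 0 < K) (hT : ∀ q ∈ M, IsTangentSpace M d ρ K q (T q)) {p v : Euc D}
    (hp : p ∈ M) (hv : v ∈ T p) (hvn : ‖v‖ ≤ τ / 800) :
    ∃ y ∈ M, dist y p ≤ τ / 100 ∧ (T p).starProjection (y - p) = v := by
  set P := (T p).starProjection with hP
  obtain ⟨y, ⟨hy, hyp⟩, hmin⟩ := (hM.inter_right (isClosed_closedBall (x := p)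
    (ε := τ / 100))).exists_isMinOn ⟨p, hp, mem_closedBall_self (by positivity)⟩
    (f := fun y => ‖P (y - p) - v‖) (by fun_prop)
  refine ⟨y, hy, hyp, ?_⟩
  set e := P (y - p) - v with he
  have hyp : dist y p ≤ τ / 100 := hyp
  -- the minimiser is interior to the ball in which it is sought
  have hyp2 : dist y p ≤ τ / 200 := by
    have h1 : ‖P (y - p) - v‖ ≤ ‖P (p - p) - v‖ :=
      hmin ⟨hp, mem_closedBall_self (by positivity)⟩
    rw [sub_self, map_zero, zero_sub, norm_neg] at h1
    have h2 := norm_sub_le_two_mul_proj hM hτ0 hτ hρ hK hT hp hp hy (by simp; positivity) hyp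
    have h3 : ‖P (y - p)‖ ≤ ‖P (y - p) - v‖ + ‖v‖ := by
      have := norm_add_le (P (y - p) - v) v
      rwa [sub_add_cancel] at this
    rw [dist_eq_norm]
    linarith
  have heT : e ∈ T p := (T p).sub_mem ((T p).starProjection_apply_mem _) hv
  -- first-order condition: moving from `y` in the direction `w` does not decrease `‖P (y - p) - v‖`
  have hcrit : ∀ w ∈ T y, 0 ≤ inner ℝ e w := by
    intro w hw
    by_contra hneg
    push Not at hneg
    set c := ‖e‖ * (K * ‖w‖ ^ 2) + (‖w‖ + K * ‖w‖ ^ 2) ^ 2 with hc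
    have hc0 : 0 ≤ c := by positivity
    have hsm : ∀ᶠ t : ℝ in 𝓝[>] 0, t < 1 ∧ t * (‖w‖ + K * ‖w‖ ^ 2) < min (τ / 200) ρ ∧
        t * c < - inner ℝ e w := by
      have ht : ∀ a : ℝ, Tendsto (fun t : ℝ => t * a) (𝓝[>] 0) (𝓝 0) := fun a => by
        have : Tendsto (fun t : ℝ => t * a) (𝓝 0) (𝓝 (0 * a)) := tendsto_id.mul_const a
        rw [zero_mul] at this
        exact this.mono_left nhdsWithin_le_nhds
      refine ((ht 1).eventually_lt_const (by norm_num : (0 : ℝ) < 1)).mono (by simp) |>.and ?_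
      exact ((ht _).eventually_lt_const (by positivity)).and
        ((ht c).eventually_lt_const (by linarith))
    obtain ⟨t, ⟨ht1, htw, htc⟩, ht0⟩ := (hsm.and self_mem_nhdsWithin).exists
    have ht0 : 0 < t := ht0
    have hKw : 0 ≤ K * ‖w‖ ^ 2 := by positivity
    have htw' : ‖t • w‖ = t * ‖w‖ := by rw [norm_smul, Real.norm_of_nonneg ht0.le]
    obtain ⟨y', hy', hyb⟩ := (hT y hy).2.2 (t • w) ((T y).smul_mem t hw) (by
      rw [htw']
      have := htw.trans_le (min_le_right _ _)
      nlinarith)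
    rw [htw', mul_pow] at hyb
    have hyb2 : ‖y' - y - t • w‖ ≤ t ^ 2 * (K * ‖w‖ ^ 2) := by linarith
    have hyb3 : ‖y' - y‖ ≤ t * (‖w‖ + K * ‖w‖ ^ 2) := by
      have h1 := norm_add_le (y' - y - t • w) (t • w)
      rw [sub_add_cancel, htw'] at h1
      have ht2 : t ^ 2 ≤ t := by nlinarith
      have := mul_le_mul_of_nonneg_right ht2 hKw
      linarith
    have hmem : y' ∈ M ∩ closedBall p (τ / 100) := by
      refine ⟨hy', ?_⟩
      rw [mem_closedBall]
      have h1 := dist_triangle y' y p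
      rw [dist_eq_norm y' y] at h1
      have := htw.trans_le (min_le_left _ _)
      linarith
    have hm : ‖e‖ ≤ ‖P (y' - p) - v‖ := hmin hmem
    have he' : P (y' - p) - v = e + P (y' - y) := by
      rw [he, show y' - p = (y - p) + (y' - y) by abel, map_add]; abel
    rw [he'] at hm
    have hm2 : ‖e‖ ^ 2 ≤ ‖e + P (y' - y)‖ ^ 2 := by gcongr
    rw [norm_add_sq_real] at hm2
    have hPin : inner ℝ e (P (y' - y)) = inner ℝ e (y' - y) := by
      rw [hP, ← Submodule.inner_starProjection_left_eq_right, (T p).starProjection_eq_self_iff.2 heT]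
    have hPn : ‖P (y' - y)‖ ^ 2 ≤ t ^ 2 * (‖w‖ + K * ‖w‖ ^ 2) ^ 2 := by
      rw [← mul_pow]
      gcongr
      exact ((T p).norm_starProjection_apply_le _).trans hyb3
    have hin : inner ℝ e (y' - y) ≤ t * inner ℝ e w + ‖e‖ * (t ^ 2 * (K * ‖w‖ ^ 2)) := by
      have h1 : y' - y = t • w + (y' - y - t • w) := by abel
      have h2 : inner ℝ e (y' - y - t • w) ≤ ‖e‖ * (t ^ 2 * (K * ‖w‖ ^ 2)) :=
        (real_inner_le_norm _ _).trans (by gcongr)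
      rw [h1, inner_add_right, real_inner_smul_right]
      linarith
    rw [hPin] at hm2
    have hsum : 0 ≤ t * (2 * inner ℝ e w + t * (2 * (‖e‖ * (K * ‖w‖ ^ 2)) +
        (‖w‖ + K * ‖w‖ ^ 2) ^ 2)) := by nlinarith
    have hsum2 := nonneg_of_mul_nonneg_right hsum ht0
    have : t * (2 * (‖e‖ * (K * ‖w‖ ^ 2)) + (‖w‖ + K * ‖w‖ ^ 2) ^ 2) ≤ 2 * (t * c) := by
      rw [hc]
      nlinarith [mul_nonneg ht0.le (sq_nonneg (‖w‖ + K * ‖w‖ ^ 2))]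
    linarith
  -- `e` lies in `T p` and is orthogonal to `T y`, which the angle bound allows only for `e = 0`
  have hproj : (T y).starProjection e = 0 := by
    have h1 := hcrit (-(T y).starProjection e) ((T y).neg_mem ((T y).starProjection_apply_mem e))
    have h2 := (T y).starProjection_inner_eq_zero e _ ((T y).starProjection_apply_mem e)
    rw [inner_sub_left, real_inner_self_eq_norm_sq] at h2
    rw [inner_neg_right] at h1
    rw [← norm_eq_zero]
    nlinarith [norm_nonneg ((T y).starProjection e)]
  have hang := angleLE_of_dist_lt hM hτ0 hτ hρ hK hT hy hp (by linarith) e heT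
  rw [hproj, sub_zero] at hang
  have h5 : 20 * dist y p / τ ≤ 1 / 5 := by
    rw [div_le_iff₀ hτ0]; linarith
  have h6 : 20 * dist y p / τ * ‖e‖ ≤ 1 / 5 * ‖e‖ := by gcongr
  have he0 : ‖e‖ = 0 := by linarith [norm_nonneg e]
  exact sub_eq_zero.1 (norm_eq_zero.1 he0)

/-- A bi-Lipschitz chart whose size depends only on the reach: `M` is, near one of its points, the
graph of a map over a ball of radius `τ / 800` of the tangent space. -/
theorem exists_chart (hM : IsCompact M) (hsm : IsSmoothSubmanifold d D M) (hτ0 : 0 < τ)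
    (hτ : reach M = ENNReal.ofReal τ) :
    ∃ ψ : Euc d → Euc D, (∀ v, ‖v‖ ≤ τ / 800 → ψ v ∈ M) ∧
      (∀ v w, ‖v‖ ≤ τ / 800 → ‖w‖ ≤ τ / 800 →
        dist v w ≤ dist (ψ v) (ψ w) ∧ dist (ψ v) (ψ w) ≤ 2 * dist v w) ∧
      ∀ y ∈ M, dist y (ψ 0) ≤ τ / 800 → ∃ v, ‖v‖ ≤ τ / 800 ∧ ψ v = y := by
  -- the empty set does not have positive reach
  have hne : M.Nonempty := by
    by_contra hemp
    rw [not_nonempty_iff_eq_empty] at hemp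
    obtain ⟨p, ⟨hp, -⟩, -⟩ := existsUnique_nearest_of_reach hτ (z := 0) (by simpa [hemp])
    simp [hemp] at hp
  obtain ⟨p, hp⟩ := hne
  obtain ⟨ρ, hρ, K, hK, hex⟩ := hsm.exists_isTangentSpace hM
  choose! T hT using hex
  let b := (stdOrthonormalBasis ℝ (T p)).reindex (finCongr (hT p hp).1)
  let ι : Euc d →ₗᵢ[ℝ] Euc D := (T p).subtypeₗᵢ.comp b.repr.symm.toLinearIsometry
  have hιT : ∀ v, ι v ∈ T p := fun v => (b.repr.symm v).2
  have hιs : ∀ w ∈ T p, ∃ v, ι v = w := fun w hw => ⟨b.repr ⟨w, hw⟩, by simp [ι]⟩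
  have hex : ∀ v : Euc d, ‖v‖ ≤ τ / 800 → ∃ y, y ∈ M ∧ dist y p ≤ τ / 100 ∧
      (T p).starProjection (y - p) = ι v := fun v hv => by
    obtain ⟨y, h1, h2, h3⟩ := exists_proj_eq hM hτ0 hτ hρ hK hT hp (hιT v)
      (by rwa [ι.norm_map])
    exact ⟨y, h1, h2, h3⟩
  choose! ψ hψ using hex
  have huniq : ∀ v, ‖v‖ ≤ τ / 800 → ∀ y ∈ M, dist y p ≤ τ / 100 →
      (T p).starProjection (y - p) = ι v → ψ v = y := by
    intro v hv y hy hyp hyv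
    have h1 := norm_sub_le_two_mul_proj hM hτ0 hτ hρ hK hT hp hy (hψ v hv).1 hyp (hψ v hv).2.1
    rw [show ψ v - y = (ψ v - p) - (y - p) by abel, map_sub, (hψ v hv).2.2, hyv, sub_self,
      norm_zero, mul_zero] at h1
    have h2 : (ψ v - p) - (y - p) = 0 := norm_le_zero_iff.1 h1
    rw [sub_sub_sub_cancel_right] at h2
    exact sub_eq_zero.1 h2
  have hψ0 : ψ 0 = p := huniq 0 (by simp; positivity) p hp (by simp; positivity) (by simp)
  refine ⟨ψ, fun v hv => (hψ v hv).1, fun v w hv hw => ?_, fun y hy hyp => ?_⟩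
  · have h1 : (T p).starProjection (ψ v - ψ w) = ι (v - w) := by
      rw [show ψ v - ψ w = (ψ v - p) - (ψ w - p) by abel, map_sub, (hψ v hv).2.2, (hψ w hw).2.2,
        map_sub]
    have h2 : ‖(T p).starProjection (ψ v - ψ w)‖ = dist v w := by
      rw [h1, ι.norm_map, dist_eq_norm]
    constructor
    · rw [← h2, dist_eq_norm]
      exact (T p).norm_starProjection_apply_le _
    · rw [← h2, dist_eq_norm]
      exact norm_sub_le_two_mul_proj hM hτ0 hτ hρ hK hT hp (hψ w hw).1 (hψ v hv).1
        (hψ w hw).2.1 (hψ v hv).2.1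
  · rw [hψ0] at hyp
    obtain ⟨v, hv⟩ := hιs _ ((T p).starProjection_apply_mem (y - p))
    have hvn : ‖v‖ ≤ τ / 800 := by
      rw [← ι.norm_map, hv]
      refine ((T p).norm_starProjection_apply_le _).trans ?_
      rwa [← dist_eq_norm]
    exact ⟨v, hvn, huniq v hvn y hy (by linarith) hv.symm⟩

end GraphCharts

/-! ### A product of interrupted intervals -/

/-- The middle half of the `k`-th interval of length `h`. -/
def midInterval (h : ℝ) (k : ℕ) : Set ℝ := Icc (h * (k + 1 / 4)) (h * (k + 3 / 4))

/-- The union of the middle halves of the first `N` intervals of length `h`. -/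
def midIntervals (h : ℝ) (N : ℕ) : Set ℝ := {x | ∃ k < N, x ∈ midInterval h k}

theorem volume_midInterval (h : ℝ) (k : ℕ) : volume (midInterval h k) = ENNReal.ofReal (h / 2) := by
  rw [midInterval, Real.volume_Icc]; congr 1; ring

theorem dist_ge_of_mem_midInterval {h : ℝ} (hh : 0 < h) {j k : ℕ} (hjk : j ≠ k) {x y : ℝ}
    (hx : x ∈ midInterval h j) (hy : y ∈ midInterval h k) : h / 2 ≤ |x - y| := by
  rcases lt_or_gt_of_ne hjk with hlt | hlt
  · have h1 : (j : ℝ) + 1 ≤ k := by exact_mod_cast hlt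
    have h2 := hx.2
    have h3 := hy.1
    rw [abs_sub_comm]
    refine le_trans ?_ (le_abs_self _)
    nlinarith
  · have h1 : (k : ℝ) + 1 ≤ j := by exact_mod_cast hlt
    have h2 := hx.1
    have h3 := hy.2
    refine le_trans ?_ (le_abs_self _)
    nlinarith

/-- A set containing `m` consecutive middle halves meets their union in length at least `m h / 2`. -/
theorem le_volume_midIntervals_inter {h : ℝ} (hh : 0 < h) {N j m : ℕ} (hjm : j + m ≤ N) {s : Set ℝ}
    (hs : ∀ i < m, midInterval h (j + i) ⊆ s) :
    ENNReal.ofReal (m * (h / 2)) ≤ volume (midIntervals h N ∩ s) := by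
  have h1 : volume (⋃ i ∈ Finset.range m, midInterval h (j + i)) = ENNReal.ofReal (m * (h / 2)) := by
    rw [measure_biUnion_finset]
    · simp_rw [volume_midInterval]
      rw [Finset.sum_const, Finset.card_range, nsmul_eq_mul, ENNReal.ofReal_mul (by positivity),
        ENNReal.ofReal_natCast]
    · intro a _ b _ hab
      rw [Function.onFun, Set.disjoint_left]
      intro x hxa hxb
      have := dist_ge_of_mem_midInterval hh (by omega : j + a ≠ j + b) hxa hxb
      rw [sub_self, abs_zero] at this
      linarith
    · intro b _
      exact measurableSet_Icc
  rw [← h1]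
  refine measure_mono (iUnion₂_subset fun i hi => ?_)
  rw [Finset.mem_range] at hi
  exact fun x hx => ⟨⟨j + i, by omega, hx⟩, hs i hi hx⟩

/-- The union of the middle halves occupies a fixed proportion of every interval centred at one of
its points, at all scales up to its diameter. -/
theorem midIntervals_regular {h : ℝ} (hh : 0 < h) {N : ℕ} {x r : ℝ} (hx : x ∈ midIntervals h N)
    (hr : 0 < r) (hrN : r ≤ N * h) :
    ENNReal.ofReal (r / 8) ≤ volume (midIntervals h N ∩ Icc (x - r) (x + r)) := by
  obtain ⟨k, hkN, hk1, hk2⟩ := hx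
  rcases le_or_gt r (2 * h) with hsmall | hlarge
  · -- an interval on the roomier side of `x` lies in the same middle half
    rcases le_or_gt x (h * (k + 1 / 2)) with hl | hl
    · have : Icc x (x + r / 8) ⊆ midIntervals h N ∩ Icc (x - r) (x + r) := by
        rintro y ⟨hy1, hy2⟩
        refine ⟨⟨k, hkN, by linarith, by nlinarith⟩, by linarith, by linarith⟩
      refine le_trans (le_of_eq ?_) (measure_mono this)
      rw [Real.volume_Icc]; congr 1; ring
    · have : Icc (x - r / 8) x ⊆ midIntervals h N ∩ Icc (x - r) (x + r) := by
        rintro y ⟨hy1, hy2⟩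
        refine ⟨⟨k, hkN, by nlinarith, by linarith⟩, by linarith, by linarith⟩
      refine le_trans (le_of_eq ?_) (measure_mono this)
      rw [Real.volume_Icc]; congr 1; ring
  · -- many complete intervals lie on the roomier side of `x`
    set t := r / (2 * h) with ht
    have ht1 : 1 < t := by rw [ht, lt_div_iff₀ (by positivity)]; linarith
    have htr : t * (2 * h) = r := by rw [ht]; field_simp
    set m := ⌊t⌋₊ with hm
    have hmt : (m : ℝ) ≤ t := Nat.floor_le (by linarith)
    have hmt' : t < m + 1 := Nat.lt_floor_add_one t
    have hm1 : (1 : ℝ) ≤ m := by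
      exact_mod_cast (Nat.le_floor (by exact_mod_cast ht1.le) : 1 ≤ ⌊t⌋₊)
    have htN : 2 * t ≤ N := by nlinarith
    have hmeas : ENNReal.ofReal (r / 8) ≤ ENNReal.ofReal (m * (h / 2)) := by
      apply ENNReal.ofReal_le_ofReal
      rw [← htr]
      nlinarith
    refine hmeas.trans ?_
    have hmh : (m : ℝ) * (2 * h) ≤ r := by rw [← htr]; gcongr
    rcases le_or_gt x (N * h / 2) with hl | hl
    · have hkm : k + 1 + m ≤ N := by
        have h1 : (k : ℝ) + 1 / 4 ≤ N / 2 := by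
          have : h * (k + 1 / 4) ≤ h * (N / 2) := by linarith
          exact le_of_mul_le_mul_left this hh
        have h2 : ((k + m : ℕ) : ℝ) < N := by push_cast; linarith
        have h3 : k + m < N := by exact_mod_cast h2
        omega
      refine le_volume_midIntervals_inter hh hkm fun i hi y hy => ?_
      have hi' : (i : ℝ) + 1 ≤ m := by exact_mod_cast hi
      obtain ⟨hy1, hy2⟩ := hy
      push_cast at hy1 hy2
      constructor
      · nlinarith [(Nat.cast_nonneg i : (0 : ℝ) ≤ i)]
      · nlinarith
    · have hmk : m ≤ k := by
        have h1 : (N : ℝ) / 2 < k + 3 / 4 := by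
          have : h * (N / 2) < h * (k + 3 / 4) := by linarith
          exact lt_of_mul_lt_mul_left this hh.le
        have h2 : (m : ℝ) < (k + 1 : ℕ) := by push_cast; linarith
        have h3 : m < k + 1 := by exact_mod_cast h2
        omega
      refine le_volume_midIntervals_inter hh (j := k - m) (by omega) fun i hi y hy => ?_
      have hi' : (i : ℝ) + 1 ≤ m := by exact_mod_cast hi
      obtain ⟨hy1, hy2⟩ := hy
      push_cast [Nat.cast_sub hmk] at hy1 hy2
      constructor
      · nlinarith [(Nat.cast_nonneg i : (0 : ℝ) ≤ i)]
      · nlinarith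

/-- The cube with index `k` in the grid of mesh `h`, shrunk to half its side. -/
def gridCell {d N : ℕ} (h : ℝ) (k : Fin d → Fin N) : Set (Euc d) :=
  {v | ∀ i, v i ∈ midInterval h (k i)}

/-- The union of the shrunken cubes of a grid with `N ^ d` cubes of side `h`. -/
def gridCells (d N : ℕ) (h : ℝ) : Set (Euc d) := {v | ∀ i, v i ∈ midIntervals h N}

theorem gridCells_eq_iUnion (d N : ℕ) (h : ℝ) :
    gridCells d N h = ⋃ k : Fin d → Fin N, gridCell h k := by
  ext v
  simp only [gridCells, gridCell, mem_ofPred_eq, mem_iUnion, midIntervals]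
  constructor
  · intro hv
    choose k hk hvk using hv
    exact ⟨fun i => ⟨k i, hk i⟩, hvk⟩
  · rintro ⟨k, hk⟩ i
    exact ⟨k i, (k i).2, hk i⟩

theorem volume_box {d : ℕ} (s : Fin d → Set ℝ) :
    volume {v : Euc d | ∀ i, v i ∈ s i} = ∏ i, volume (s i) := by
  rw [← volume_pi_pi s, ← (PiLp.volume_preserving_toLp (Fin d)).measure_preimage_equiv
    (f := MeasurableEquiv.toLp 2 (Fin d → ℝ))]
  congr 1
  ext v
  simp

theorem norm_le_of_forall_abs_le {d : ℕ} {v : Euc d} {a : ℝ} (ha : 0 ≤ a) (h : ∀ i, |v i| ≤ a) :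
    ‖v‖ ≤ d * a := by
  refine le_of_sq_le_sq ?_ (by positivity)
  rw [EuclideanSpace.norm_sq_eq]
  have h1 : ∑ i, ‖v i‖ ^ 2 ≤ ∑ _i : Fin d, a ^ 2 := by
    gcongr with i
    exact h i
  refine h1.trans ?_
  rw [Finset.sum_const, Finset.card_univ, Fintype.card_fin, nsmul_eq_mul, mul_pow]
  gcongr
  exact_mod_cast Nat.le_self_pow (by norm_num) d

theorem midIntervals_subset {h : ℝ} (hh : 0 < h) (N : ℕ) : midIntervals h N ⊆ Icc 0 (N * h) := by
  rintro x ⟨k, hk, hx1, hx2⟩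
  have hk' : (k : ℝ) + 1 ≤ N := by exact_mod_cast hk
  constructor
  · exact le_trans (by positivity) hx1
  · nlinarith

theorem gridCells_norm_le {d N : ℕ} {h : ℝ} (hh : 0 < h) {v : Euc d} (hv : v ∈ gridCells d N h) :
    ‖v‖ ≤ d * (N * h) := by
  refine norm_le_of_forall_abs_le (by positivity) fun i => ?_
  have := midIntervals_subset hh N (hv i)
  rw [abs_of_nonneg this.1]
  exact this.2

theorem volume_gridCell {d N : ℕ} {h : ℝ} (k : Fin d → Fin N) :
    volume (gridCell h k) = ENNReal.ofReal (h / 2) ^ d := by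
  rw [gridCell, volume_box]
  simp [volume_midInterval]

theorem volume_gridCells_le {d N : ℕ} {h : ℝ} (hh : 0 < h) :
    volume (gridCells d N h) ≤ ENNReal.ofReal (N * h) ^ d := by
  rw [gridCells, volume_box]
  refine (Finset.prod_le_prod' fun i _ => (measure_mono (midIntervals_subset hh N))).trans ?_
  simp

theorem le_volume_gridCells {d N : ℕ} {h : ℝ} (hh : 0 < h) :
    ENNReal.ofReal (N * h / 2) ^ d ≤ volume (gridCells d N h) := by
  rw [gridCells, volume_box]
  have h1 : ENNReal.ofReal (N * h / 2) ≤ volume (midIntervals h N) := by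
    have := le_volume_midIntervals_inter hh (N := N) (j := 0) (m := N) (s := univ) (by omega)
      (by simp)
    rw [inter_univ] at this
    rwa [mul_div_assoc]
  calc ENNReal.ofReal (N * h / 2) ^ d = ∏ _i : Fin d, ENNReal.ofReal (N * h / 2) := by simp
    _ ≤ _ := Finset.prod_le_prod' fun i _ => h1

/-- Multiscale regularity of the union of the shrunken cubes, for cubes centred at its points. -/
theorem gridCells_regular {d N : ℕ} {h : ℝ} (hh : 0 < h) {v : Euc d} (hv : v ∈ gridCells d N h)
    {r : ℝ} (hr : 0 < r) (hrN : r ≤ N * h) :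
    ENNReal.ofReal (r / 8) ^ d ≤
      volume (gridCells d N h ∩ {w | ∀ i, w i ∈ Icc (v i - r) (v i + r)}) := by
  have h1 : gridCells d N h ∩ {w | ∀ i, w i ∈ Icc (v i - r) (v i + r)} =
      {w | ∀ i, w i ∈ midIntervals h N ∩ Icc (v i - r) (v i + r)} := by
    ext w
    simp only [gridCells, mem_inter_iff, mem_ofPred_eq]
    exact ⟨fun h i => ⟨h.1 i, h.2 i⟩, fun h => ⟨fun i => (h i).1, fun i => (h i).2⟩⟩
  rw [h1, volume_box]
  calc ENNReal.ofReal (r / 8) ^ d = ∏ _i : Fin d, ENNReal.ofReal (r / 8) := by simp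
    _ ≤ _ := Finset.prod_le_prod' fun i _ => midIntervals_regular hh (hv i) hr hrN

theorem dist_ge_of_mem_gridCell {d N : ℕ} {h : ℝ} (hh : 0 < h) {j k : Fin d → Fin N} (hjk : j ≠ k)
    {v w : Euc d} (hv : v ∈ gridCell h j) (hw : w ∈ gridCell h k) : h / 2 ≤ dist v w := by
  obtain ⟨i, hi⟩ := Function.ne_iff.1 hjk
  refine (dist_ge_of_mem_midInterval hh (fun h => hi (Fin.ext h)) (hv i) (hw i)).trans ?_
  rw [dist_eq_norm]
  simpa using PiLp.norm_apply_le (p := 2) (v - w) i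

theorem isClosed_gridCell {d N : ℕ} {h : ℝ} (k : Fin d → Fin N) :
    IsClosed (gridCell h k) := by
  have : gridCell h k = ⋂ i, (fun v : Euc d => v i) ⁻¹' midInterval h (k i) := by
    ext v; simp [gridCell]
  rw [this]
  exact isClosed_iInter fun i => isClosed_Icc.preimage (by fun_prop)

/-! ### Images under bi-Lipschitz charts -/

theorem euclideanHausdorffMeasure_image_le {X Y : Type*} [MetricSpace X] [MeasurableSpace X]
    [BorelSpace X] [MetricSpace Y] [MeasurableSpace Y] [BorelSpace Y] (d : ℕ) {f : X → Y}
    {s : Set X} {K : NNReal} (hf : LipschitzOnWith K f s) :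
    (Measure.euclideanHausdorffMeasure d : Measure Y) (f '' s) ≤
      (K : ℝ≥0∞) ^ d * (Measure.euclideanHausdorffMeasure d : Measure X) s := by
  rw [Measure.euclideanHausdorffMeasure_def, Measure.euclideanHausdorffMeasure_def,
    Measure.smul_apply, Measure.smul_apply, mul_smul_comm]
  have := hf.hausdorffMeasure_image_le (d := d) (by positivity)
  rw [ENNReal.rpow_natCast] at this
  gcongr

/-- A system of `N ^ d` cells of mesh `h` on `M`. All the facts about `M` that the statistical
argument uses are collected here: the cells are separated compact sets of comparable volumes, their
union has a volume of order `(N * h) ^ d`, and it is regular at all scales below `N * h`. -/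
structure IsCellSystem {d D N : ℕ} (M : Set (Euc D)) (h : ℝ)
    (C : (Fin d → Fin N) → Set (Euc D)) : Prop where
  isCompact : ∀ k, IsCompact (C k)
  sep : ∀ j k, j ≠ k → ∀ x ∈ C j, ∀ y ∈ C k, h / 2 ≤ dist x y
  cell_ge : ∀ k, ENNReal.ofReal (h / 2) ^ d ≤ manifoldVolume d M (C k)
  cell_le : ∀ k, manifoldVolume d M (C k) ≤ ENNReal.ofReal h ^ d
  total_ge : ENNReal.ofReal (N * h / 2) ^ d ≤ manifoldVolume d M (⋃ k, C k)
  total_le : manifoldVolume d M (⋃ k, C k) ≤ ENNReal.ofReal (2 * (N * h)) ^ d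
  regular : ∀ x ∈ ⋃ k, C k, ∀ r, 0 < r → r < N * h →
    ENNReal.ofReal (r / (32 * d)) ^ d ≤ manifoldVolume d M ((⋃ k, C k) ∩ ball x r)
  ball_le : ∀ x ∈ ⋃ k, C k, ∀ r, 0 < r → r < N * h →
    manifoldVolume d M (ball x r) ≤ 2 ^ d * (ENNReal.ofReal r ^ d * volume (ball (0 : Euc d) 1))

/-- Cells of any mesh exist on `M`, on a piece whose size depends only on the dimension and the
reach: they are the images of the shrunken cubes of a grid under a chart. The length `N * h` is the
side of the cube covered by the grid, chosen so that the cube lies well inside the domain of the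
chart. -/
theorem exists_isCellSystem {d D : ℕ} (hd : 0 < d) {M : Set (Euc D)} {τ : ℝ} (hM : IsCompact M)
    (hsm : IsSmoothSubmanifold d D M) (hτ0 : 0 < τ) (hτ : reach M = ENNReal.ofReal τ) {N : ℕ}
    (hN : 0 < N) {h : ℝ} (hNh : N * h = τ / 800 / (4 * d)) :
    ∃ C : (Fin d → Fin N) → Set (Euc D), IsCellSystem M h C := by
  obtain ⟨ψ, hψM, hψL, hψS⟩ := exists_chart hM hsm hτ0 hτ
  set R := τ / 800 with hR
  have hd' : (0 : ℝ) < d := by exact_mod_cast hd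
  have hN' : (0 : ℝ) < N := by exact_mod_cast hN
  have hR0 : 0 < R := by positivity
  have hdl : d * (N * h) = R / 4 := by rw [hNh]; field_simp
  have hlR : N * h ≤ R / 4 := by
    rw [← hdl]
    have : (1 : ℝ) ≤ d := by exact_mod_cast hd
    have : 0 ≤ N * h := by rw [hNh]; positivity
    nlinarith
  have hh : 0 < h := by
    have : 0 < N * h := by rw [hNh]; positivity
    exact pos_of_mul_pos_right this hN'.le
  have hlip : LipschitzOnWith 2 ψ (closedBall 0 R) :=
    LipschitzOnWith.of_dist_le_mul fun v hv w hw =>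
      (hψL v w (mem_closedBall_zero_iff.1 hv) (mem_closedBall_zero_iff.1 hw)).2
  have hV : ∀ E ⊆ closedBall (0 : Euc d) R, manifoldVolume d M (ψ '' E) =
      (Measure.euclideanHausdorffMeasure d : Measure (Euc D)) (ψ '' E) := fun E hE => by
    rw [manifoldVolume, Measure.restrict_eq_self]
    rintro _ ⟨v, hv, rfl⟩
    exact hψM v (mem_closedBall_zero_iff.1 (hE hv))
  have hup : ∀ E ⊆ closedBall (0 : Euc d) R, manifoldVolume d M (ψ '' E) ≤ 2 ^ d * volume E :=
    fun E hE => by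
      rw [hV E hE, ← EuclideanSpace.euclideanHausdorffMeasure_eq_volume]
      exact euclideanHausdorffMeasure_image_le d (hlip.mono hE)
  have hlow : ∀ E ⊆ closedBall (0 : Euc d) R, volume E ≤ manifoldVolume d M (ψ '' E) := by
    intro E hE
    rw [hV E hE, ← EuclideanSpace.euclideanHausdorffMeasure_eq_volume]
    have hinj : InjOn ψ E := fun v hv w hw hvw => by
      have := (hψL v w (mem_closedBall_zero_iff.1 (hE hv))
        (mem_closedBall_zero_iff.1 (hE hw))).1
      rw [hvw, dist_self] at this
      exact dist_le_zero.1 this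
    have hL : LipschitzOnWith 1 (Function.invFunOn ψ E) (ψ '' E) := by
      refine LipschitzOnWith.of_dist_le_mul ?_
      rintro _ ⟨v, hv, rfl⟩ _ ⟨w, hw, rfl⟩
      rw [hinj.leftInvOn_invFunOn hv, hinj.leftInvOn_invFunOn hw, NNReal.coe_one, one_mul]
      exact (hψL v w (mem_closedBall_zero_iff.1 (hE hv)) (mem_closedBall_zero_iff.1 (hE hw))).1
    have := euclideanHausdorffMeasure_image_le d hL
    rwa [hinj.leftInvOn_invFunOn.image_image, ENNReal.coe_one, one_pow, one_mul] at this
  have hsub : gridCells d N h ⊆ closedBall 0 (R / 4) := fun v hv => by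
    rw [mem_closedBall_zero_iff, ← hdl]; exact gridCells_norm_le hh hv
  have hsubR : gridCells d N h ⊆ closedBall 0 R :=
    hsub.trans (closedBall_subset_closedBall (by linarith))
  have hcell : ∀ k : Fin d → Fin N, gridCell h k ⊆ gridCells d N h := fun k => by
    rw [gridCells_eq_iUnion]; exact subset_iUnion _ k
  have hUn : (⋃ k : Fin d → Fin N, ψ '' gridCell h k) = ψ '' gridCells d N h := by
    rw [gridCells_eq_iUnion, image_iUnion]
  have h2 : (2 : ℝ≥0∞) = ENNReal.ofReal 2 := by simp
  refine ⟨fun k => ψ '' gridCell h k, ?_, ?_, ?_, ?_, ?_, ?_, ?_, ?_⟩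
  · intro k
    refine ((isCompact_closedBall _ _).of_isClosed_subset (isClosed_gridCell k)
      ((hcell k).trans hsubR)).image_of_continuousOn
      (hlip.continuousOn.mono ((hcell k).trans hsubR))
  · rintro j k hjk _ ⟨v, hv, rfl⟩ _ ⟨w, hw, rfl⟩
    exact (dist_ge_of_mem_gridCell hh hjk hv hw).trans
      (hψL v w (mem_closedBall_zero_iff.1 (hsubR (hcell _ hv)))
        (mem_closedBall_zero_iff.1 (hsubR (hcell _ hw)))).1
  · intro k
    rw [← volume_gridCell k]
    exact hlow _ ((hcell k).trans hsubR)
  · intro k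
    refine (hup _ ((hcell k).trans hsubR)).trans (le_of_eq ?_)
    rw [volume_gridCell k, h2, ← mul_pow, ← ENNReal.ofReal_mul (by norm_num)]
    congr 2; ring
  · rw [hUn]
    exact (le_volume_gridCells hh).trans (hlow _ hsubR)
  · rw [hUn]
    refine (hup _ hsubR).trans ?_
    rw [ENNReal.ofReal_mul (by norm_num), mul_pow, ← h2]
    gcongr
    exact volume_gridCells_le hh
  · rw [hUn]
    rintro _ ⟨v, hv, rfl⟩ r hr hrl
    -- half the side of a cube whose image under the chart has radius less than `r`
    set s := r / (4 * d) with hs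
    have hspos : 0 < s := by positivity
    have hsr : d * s = r / 4 := by rw [hs]; field_simp
    have hsl : s ≤ N * h := by
      have : (1 : ℝ) ≤ d := by exact_mod_cast hd
      nlinarith
    set E := gridCells d N h ∩ {w | ∀ i, w i ∈ Icc (v i - s) (v i + s)} with hE
    have hEs : E ⊆ gridCells d N h := inter_subset_left
    have hsubE : ψ '' E ⊆ ψ '' gridCells d N h ∩ ball (ψ v) r := by
      rintro _ ⟨w, hw, rfl⟩
      refine ⟨⟨w, hEs hw, rfl⟩, ?_⟩
      rw [mem_ball]
      have h1 := (hψL w v (mem_closedBall_zero_iff.1 (hsubR (hEs hw)))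
        (mem_closedBall_zero_iff.1 (hsubR hv))).2
      have h3 : dist w v ≤ d * s := by
        rw [dist_eq_norm]
        refine norm_le_of_forall_abs_le hspos.le fun i => ?_
        have := hw.2 i
        rw [abs_le]
        simp only [PiLp.sub_apply]
        constructor <;> linarith [this.1, this.2]
      linarith
    have h4 : ENNReal.ofReal (r / (32 * d)) = ENNReal.ofReal (s / 8) := by
      congr 1; rw [hs]; field_simp; norm_num
    rw [h4]
    exact (gridCells_regular hh hv hspos hsl).trans
      ((hlow E (hEs.trans hsubR)).trans (measure_mono hsubE))
  · rw [hUn]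
    rintro _ ⟨v, hv, rfl⟩ r hr hrl
    have : Nonempty (Fin d) := ⟨⟨0, hd⟩⟩
    have : Nontrivial (Euc d) := inferInstance
    set E := closedBall (0 : Euc d) R ∩ ball v r with hE
    have hvR : ‖v‖ ≤ R / 4 := mem_closedBall_zero_iff.1 (hsub hv)
    have hincl : M ∩ ball (ψ v) r ⊆ ψ '' E := by
      rintro y ⟨hyM, hy⟩
      rw [mem_ball] at hy
      have h1 := (hψL v 0 (by linarith) (by simpa using hR0.le)).2
      rw [dist_zero_right] at h1
      obtain ⟨w, hw, rfl⟩ := hψS y hyM (by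
        have := dist_triangle y (ψ v) (ψ 0)
        linarith)
      refine ⟨w, ⟨mem_closedBall_zero_iff.2 hw, ?_⟩, rfl⟩
      exact mem_ball.2 ((hψL w v hw (by linarith)).1.trans_lt hy)
    have h5 : manifoldVolume d M (ball (ψ v) r) ≤ manifoldVolume d M (ψ '' E) := by
      have h6 : manifoldVolume d M (ball (ψ v) r) = manifoldVolume d M (M ∩ ball (ψ v) r) := by
        rw [manifoldVolume, Measure.restrict_apply' hM.measurableSet,
          Measure.restrict_apply' hM.measurableSet]
        congr 1
        ext y; simp [and_comm]
      rw [h6]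
      exact measure_mono hincl
    refine h5.trans ((hup E inter_subset_left).trans ?_)
    gcongr
    refine (measure_mono inter_subset_right).trans (le_of_eq ?_)
    rw [Measure.addHaar_ball _ _ hr.le, finrank_euclideanSpace_fin, ENNReal.ofReal_pow hr.le]

/-! ### Two-point testing for product measures -/

theorem lintegral_pi_prod {ι : Type*} [Fintype ι] {Ω : Type*} [MeasurableSpace Ω] (Q : Measure Ω)
    [IsProbabilityMeasure Q] {f : ι → Ω → ℝ≥0∞} (hf : ∀ i, Measurable (f i)) :
    ∫⁻ x, ∏ i, f i (x i) ∂(Measure.pi fun _ : ι => Q) = ∏ i, ∫⁻ x, f i x ∂Q := by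
  have h := ProbabilityTheory.lintegral_prod_eq_prod_lintegral_of_indepFun Finset.univ
    (fun i (x : ι → Ω) => f i (x i))
    (ProbabilityTheory.iIndepFun_pi (μ := fun _ : ι => Q) (X := f) fun i => (hf i).aemeasurable)
    (fun i => (hf i).comp (measurable_pi_apply i))
  rw [h]
  refine Finset.prod_congr rfl fun i _ => ?_
  exact (measurePreserving_eval (fun _ : ι => Q) i).lintegral_comp (hf i)

/-- The product of measures with density `p` has as density the product of the values of `p`. -/
theorem pi_withDensity {ι : Type*} [Fintype ι] {Ω : Type*} [MeasurableSpace Ω] (Q : Measure Ω)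
    [IsProbabilityMeasure Q] {p : Ω → ℝ≥0∞} (hp : Measurable p)
    [SigmaFinite (Q.withDensity p)] :
    (Measure.pi fun _ : ι => Q.withDensity p) =
      (Measure.pi fun _ : ι => Q).withDensity fun x => ∏ i, p (x i) := by
  refine (Measure.pi_eq (μ := fun _ : ι => Q.withDensity p) fun s hs => ?_)
  rw [withDensity_apply _ (MeasurableSet.univ_pi hs),
    ← lintegral_indicator (MeasurableSet.univ_pi hs)]
  have h1 : ∀ x : ι → Ω, (univ.pi s).indicator (fun x => ∏ i, p (x i)) x =
      ∏ i, (s i).indicator p (x i) := by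
    intro x
    by_cases hx : x ∈ univ.pi s
    · rw [indicator_of_mem hx]
      exact Finset.prod_congr rfl fun i _ => (indicator_of_mem (hx i (mem_univ i)) _).symm
    · rw [indicator_of_notMem hx]
      obtain ⟨i, hi⟩ : ∃ i, x i ∉ s i := by simpa using hx
      exact (Finset.prod_eq_zero (Finset.mem_univ i) (indicator_of_notMem hi _)).symm
  simp_rw [h1]
  rw [lintegral_pi_prod Q fun i => hp.indicator (hs i)]
  refine Finset.prod_congr rfl fun i _ => ?_
  rw [lintegral_indicator (hs i), withDensity_apply _ (hs i)]

/-- A lower bound for `a`, symmetric in `a` and `b`, by a quantity that can be integrated when `a`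
and `b` are product densities. -/
theorem mul_sub_le_of_mul_le_one {a b : ℝ} (ha : 0 ≤ a) (hb : 0 ≤ b) (hab : a * b ≤ 1) :
    a * b - (a + b) / 4 ≤ a := by
  -- `a b ≤ √(a b) ≤ a + b / 4`
  by_contra hcon
  push Not at hcon
  have h1 : a + b / 4 < a * b := by linarith
  have h2 : (a + b / 4) ^ 2 < a * b := by
    have h0 : 0 ≤ a + b / 4 := by positivity
    have h3 : 0 ≤ a * b := by positivity
    nlinarith
  nlinarith [sq_nonneg (a - b / 4)]

section TwoPoint

variable {Ω : Type*} [MeasurableSpace Ω] (Q : Measure Ω) [IsProbabilityMeasure Q]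

theorem isProbabilityMeasure_withDensity_one_add {q : Ω → ℝ} (hq : Measurable q)
    (hb : ∀ x, |q x| ≤ 1) (h0 : ∫ x, q x ∂Q = 0) :
    IsProbabilityMeasure (Q.withDensity fun x => ENNReal.ofReal (1 + q x)) := by
  have hint : Integrable q Q := Integrable.of_bound hq.aestronglyMeasurable 1
    (Filter.Eventually.of_forall hb)
  have h1 : Integrable (fun x => 1 + q x) Q := (integrable_const _).add hint
  constructor
  rw [withDensity_apply _ MeasurableSet.univ, Measure.restrict_univ,
    ← ofReal_integral_eq_lintegral_ofReal h1
      (Filter.Eventually.of_forall fun x => by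
        have := (abs_le.1 (hb x)).1
        simp only [Pi.zero_apply]; linarith),
    integral_add (integrable_const _) hint, h0]
  simp

/-- Two product measures whose one-sample densities with respect to `Q` are `1 + q` and `1 - q`
cannot be told apart with small error as long as `n ∫ q ^ 2` is small: the product of the two
densities is `∏ i, (1 - q (z i) ^ 2)`, which is at most `1` and has integral `(1 - ∫ q ^ 2) ^ n`. -/
theorem two_point {q : Ω → ℝ} (hq : Measurable q) (hb : ∀ x, |q x| ≤ 1)
    (h0 : ∫ x, q x ∂Q = 0) (n : ℕ) {A : Set (Fin n → Ω)} (hA : MeasurableSet A) :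
    1 / 2 - n * ∫ x, q x ^ 2 ∂Q ≤
      (Measure.pi fun _ : Fin n => Q.withDensity fun x => ENNReal.ofReal (1 + q x)).real A +
      (Measure.pi fun _ : Fin n => Q.withDensity fun x => ENNReal.ofReal (1 - q x)).real Aᶜ := by
  have hprob : ∀ q : Ω → ℝ, Measurable q → (∀ x, |q x| ≤ 1) → ∫ x, q x ∂Q = 0 →
      ∀ B : Set (Fin n → Ω), MeasurableSet B →
      Integrable (fun z : Fin n → Ω => ∏ i, (1 + q (z i))) (Measure.pi fun _ : Fin n => Q) ∧
      ∫ z, ∏ i, (1 + q (z i)) ∂(Measure.pi fun _ : Fin n => Q) = 1 ∧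
      (Measure.pi fun _ : Fin n => Q.withDensity fun x => ENNReal.ofReal (1 + q x)).real B =
        ∫ z in B, ∏ i, (1 + q (z i)) ∂(Measure.pi fun _ : Fin n => Q) := by
    intro q hq hb h0 B hB
    have hint : Integrable q Q := Integrable.of_bound hq.aestronglyMeasurable 1
      (Filter.Eventually.of_forall hb)
    have h1 : Integrable (fun x => 1 + q x) Q := (integrable_const _).add hint
    have h2 : Integrable (fun z : Fin n → Ω => ∏ i, (1 + q (z i)))
        (Measure.pi fun _ : Fin n => Q) := Integrable.fintype_prod fun _ => h1
    have hpos : ∀ x, 0 ≤ 1 + q x := fun x => by linarith [(abs_le.1 (hb x)).1]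
    refine ⟨h2, ?_, ?_⟩
    · rw [integral_fintype_prod_eq_prod (f := fun _ x => 1 + q x)]
      rw [integral_add (integrable_const _) hint, h0]
      simp
    · have := isProbabilityMeasure_withDensity_one_add Q hq hb h0
      rw [pi_withDensity Q (p := fun x => ENNReal.ofReal (1 + q x)) (by fun_prop),
        measureReal_def, withDensity_apply _ hB]
      simp_rw [← ENNReal.ofReal_prod_of_nonneg fun i _ => hpos _]
      rw [← ofReal_integral_eq_lintegral_ofReal h2.integrableOn
        (Filter.Eventually.of_forall fun z => Finset.prod_nonneg fun i _ => hpos _),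
        ENNReal.toReal_ofReal]
      exact integral_nonneg fun z => Finset.prod_nonneg fun i _ => hpos _
  obtain ⟨hi1, he1, hA1⟩ := hprob q hq hb h0 A hA
  obtain ⟨hi2, he2, hA2⟩ := hprob (fun x => -q x) hq.neg (fun x => by rw [abs_neg]; exact hb x)
    (by rw [integral_neg, h0, neg_zero]) Aᶜ hA.compl
  simp only [← sub_eq_add_neg] at hi2 he2 hA2
  rw [hA1, hA2]
  set L₁ : (Fin n → Ω) → ℝ := fun z => ∏ i, (1 + q (z i)) with hL1
  set L₂ : (Fin n → Ω) → ℝ := fun z => ∏ i, (1 - q (z i)) with hL2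
  set Qn : Measure (Fin n → Ω) := Measure.pi fun _ : Fin n => Q with hQn
  have hp1 : ∀ z, 0 ≤ L₁ z := fun z => Finset.prod_nonneg fun i _ => by
    linarith [(abs_le.1 (hb (z i))).1]
  have hp2 : ∀ z, 0 ≤ L₂ z := fun z => Finset.prod_nonneg fun i _ => by
    linarith [(abs_le.1 (hb (z i))).2]
  have hsq : ∀ x, q x ^ 2 ≤ 1 := fun x => by
    rw [← sq_abs]; exact pow_le_one₀ (abs_nonneg _) (hb x)
  have h12 : ∀ z, L₁ z * L₂ z = ∏ i, (1 - q (z i) ^ 2) := fun z => by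
    rw [hL1, hL2, ← Finset.prod_mul_distrib]
    exact Finset.prod_congr rfl fun i _ => by ring
  have h12le : ∀ z, L₁ z * L₂ z ≤ 1 := fun z => by
    rw [h12]
    exact Finset.prod_le_one (fun i _ => by linarith [hsq (z i)])
      (fun i _ => by linarith [sq_nonneg (q (z i))])
  have hisq : Integrable (fun x => q x ^ 2) Q := Integrable.of_bound
    (by fun_prop) 1 (Filter.Eventually.of_forall fun x => by
      rw [Real.norm_of_nonneg (sq_nonneg _)]; exact hsq x)
  have hi12 : Integrable (fun z => L₁ z * L₂ z) Qn := by
    simp_rw [h12]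
    exact Integrable.fintype_prod (f := fun _ x => 1 - q x ^ 2) fun _ =>
      (integrable_const _).sub hisq
  have he12 : ∫ z, L₁ z * L₂ z ∂Qn = (1 - ∫ x, q x ^ 2 ∂Q) ^ n := by
    simp_rw [h12]
    rw [hQn, integral_fintype_prod_eq_prod (f := fun _ x => 1 - q x ^ 2),
      integral_sub (integrable_const _) hisq]
    simp
  set G : (Fin n → Ω) → ℝ := fun z => L₁ z * L₂ z - (L₁ z + L₂ z) / 4 with hG
  have hiG : Integrable G Qn := hi12.sub ((hi1.add hi2).div_const 4)
  have hG1 : ∫ z in A, G z ∂Qn ≤ ∫ z in A, L₁ z ∂Qn :=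
    setIntegral_mono hiG.integrableOn hi1.integrableOn fun z =>
      mul_sub_le_of_mul_le_one (hp1 z) (hp2 z) (h12le z)
  have hG2 : ∫ z in Aᶜ, G z ∂Qn ≤ ∫ z in Aᶜ, L₂ z ∂Qn :=
    setIntegral_mono hiG.integrableOn hi2.integrableOn fun z => by
      have := mul_sub_le_of_mul_le_one (hp2 z) (hp1 z) (by rw [mul_comm]; exact h12le z)
      rw [hG]; linarith
  have hGt : ∫ z, G z ∂Qn = (1 - ∫ x, q x ^ 2 ∂Q) ^ n - 1 / 2 := by
    have h2 : ∫ z, (L₁ z + L₂ z) / 4 ∂Qn = 1 / 2 := by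
      rw [integral_div, integral_add hi1 hi2, he1, he2]; norm_num
    have h3 : Integrable (fun z => (L₁ z + L₂ z) / 4) Qn := (hi1.add hi2).div_const 4
    rw [integral_sub hi12 h3, he12, h2]
  have hbern : 1 - n * ∫ x, q x ^ 2 ∂Q ≤ (1 - ∫ x, q x ^ 2 ∂Q) ^ n := by
    have hle : ∫ x, q x ^ 2 ∂Q ≤ 1 := by
      have := integral_mono hisq (integrable_const (μ := Q) (1 : ℝ)) hsq
      simpa using this
    have := one_add_mul_le_pow (a := -∫ x, q x ^ 2 ∂Q) (by linarith) n
    rw [← sub_eq_add_neg] at this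
    linarith
  have := integral_add_compl hA hiG
  linarith

end TwoPoint

/-! ### The law of a sample with one informative arm -/

/-- The sign `±1` of a binary reward. -/
noncomputable def rewardSign (i : Fin 2) : ℝ := 2 * ((i : ℕ) : ℝ) - 1

/-- The uniform distribution on the vectors of binary rewards. -/
noncomputable def uniformRewards (A : ℕ) : Measure (Fin A → Fin 2) :=
  (Fintype.card (Fin A → Fin 2) : ℝ≥0∞)⁻¹ • Measure.count

instance (A : ℕ) : IsProbabilityMeasure (uniformRewards A) := by
  constructor
  rw [uniformRewards, Measure.smul_apply, Measure.count_univ, smul_eq_mul, ENat.card_eq_coe_fintype_card]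
  exact ENNReal.inv_mul_cancel (by simp) (by simp)

theorem integral_uniformRewards {A : ℕ} (F : (Fin A → Fin 2) → ℝ) :
    ∫ y, F y ∂(uniformRewards A) = (Fintype.card (Fin A → Fin 2) : ℝ)⁻¹ * ∑ y, F y := by
  rw [uniformRewards, integral_smul_measure, integral_count]
  simp

theorem rewardSign_rev (i : Fin 2) : rewardSign (Fin.rev i) = -rewardSign i := by
  fin_cases i <;> norm_num [rewardSign]

theorem rewardSign_sq (i : Fin 2) : rewardSign i ^ 2 = 1 := by
  fin_cases i <;> norm_num [rewardSign]

theorem abs_rewardSign (i : Fin 2) : |rewardSign i| = 1 := by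
  fin_cases i <;> norm_num [rewardSign]

/-- A function of the rewards that changes sign when the reward of one arm is switched has
mean zero. -/
theorem integral_uniformRewards_eq_zero {A : ℕ} {F : (Fin A → Fin 2) → ℝ} (a : Fin A)
    (hF : ∀ y, F (Function.update y a (Fin.rev (y a))) = -F y) :
    ∫ y, F y ∂(uniformRewards A) = 0 := by
  have hinv : Function.Involutive
      (fun y : Fin A → Fin 2 => Function.update y a (Fin.rev (y a))) := fun y => by simp
  have h : ∑ y, F y = -∑ y, F y := by
    conv_lhs => rw [← Equiv.sum_comp hinv.toPerm F]
    rw [← Finset.sum_neg_distrib]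
    exact Finset.sum_congr rfl fun y _ => hF y
  rw [integral_uniformRewards, show ∑ y, F y = 0 by linarith, mul_zero]

theorem integrable_uniformRewards {A : ℕ} (F : (Fin A → Fin 2) → ℝ) :
    Integrable F (uniformRewards A) := Integrable.of_finite

theorem integral_rewardSign {A : ℕ} (a : Fin A) :
    ∫ y, rewardSign (y a) ∂(uniformRewards A) = 0 :=
  integral_uniformRewards_eq_zero a fun y => by simp [rewardSign_rev]

theorem integral_rewardSign_mul {A : ℕ} (a b : Fin A) :
    ∫ y, rewardSign (y a) * rewardSign (y b) ∂(uniformRewards A) = if b = a then 1 else 0 := by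
  split_ifs with h
  · subst h
    simp_rw [← sq, rewardSign_sq]
    simp
  · refine integral_uniformRewards_eq_zero a fun y => ?_
    simp [rewardSign_rev, h]

section Law

variable {D A : ℕ} (μ : Measure (Euc D)) (a₀ : Fin A) (g : Euc D → ℝ)

/-- The law of a sample with covariate distribution `μ` in which, given `X = x`, the rewards are
independent, the arm `a₀` has mean reward `1 / 2 + g x` and all other arms have mean reward
`1 / 2`. -/
noncomputable def sampleLaw : Measure (Sample D A) :=
  (μ.prod (uniformRewards A)).withDensity
    fun z => ENNReal.ofReal (1 + 2 * g z.1 * rewardSign (z.2 a₀))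

/-- The mean reward of the arm `b` under `sampleLaw μ a₀ g`. -/
noncomputable def meanReward (b : Fin A) (x : Euc D) : ℝ := 1 / 2 + if b = a₀ then g x else 0

variable {g}

theorem measurable_rewardSign : Measurable rewardSign := measurable_of_countable _

theorem measurable_rewardSign_apply (a : Fin A) :
    Measurable fun z : Sample D A => rewardSign (z.2 a) :=
  measurable_rewardSign.comp ((measurable_pi_apply a).comp measurable_snd)

theorem measurable_reward (a : Fin A) : Measurable fun z : Sample D A => reward z a :=
  (measurable_of_countable fun i : Fin 2 => ((i : ℕ) : ℝ)).comp
    ((measurable_pi_apply a).comp measurable_snd)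

theorem reward_eq (z : Sample D A) (a : Fin A) : reward z a = (1 + rewardSign (z.2 a)) / 2 := by
  rw [reward, rewardSign]; ring

theorem reward_mem (z : Sample D A) (a : Fin A) : 0 ≤ reward z a ∧ reward z a ≤ 1 := by
  rw [reward]
  have : ((z.2 a : ℕ)) ≤ 1 := by omega
  exact ⟨by positivity, by exact_mod_cast this⟩

theorem measurable_density (hg : Measurable g) :
    Measurable fun z : Sample D A => 1 + 2 * g z.1 * rewardSign (z.2 a₀) := by
  have h1 := measurable_rewardSign_apply (D := D) a₀
  have h2 : Measurable fun z : Sample D A => g z.1 := hg.comp measurable_fst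
  fun_prop

theorem density_bounds (hb : ∀ x, |g x| ≤ 1 / 2) (x : Euc D) (i : Fin 2) :
    0 ≤ 1 + 2 * g x * rewardSign i ∧ 1 + 2 * g x * rewardSign i ≤ 2 := by
  have h : |2 * g x * rewardSign i| ≤ 1 := by
    rw [abs_mul, abs_rewardSign, mul_one, abs_mul, abs_two]; linarith [hb x]
  constructor <;> linarith [(abs_le.1 h).1, (abs_le.1 h).2]

theorem marginal_sampleLaw (hg : Measurable g) (hb : ∀ x, |g x| ≤ 1 / 2) :
    marginal (sampleLaw μ a₀ g) = μ := by
  ext B hB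
  rw [marginal, Measure.map_apply measurable_fst hB, sampleLaw,
    withDensity_apply _ (measurable_fst hB), ← lintegral_indicator (measurable_fst hB),
    lintegral_prod _ (((measurable_density a₀ hg).ennreal_ofReal.indicator
      (measurable_fst hB)).aemeasurable)]
  have h1 : ∀ x, ∫⁻ y, (Prod.fst ⁻¹' B : Set (Sample D A)).indicator
      (fun z => ENNReal.ofReal (1 + 2 * g z.1 * rewardSign (z.2 a₀))) (x, y) ∂(uniformRewards A) =
      B.indicator 1 x := by
    intro x
    by_cases hx : x ∈ B
    · have h2 : ∀ y : Fin A → Fin 2, (Prod.fst ⁻¹' B : Set (Sample D A)).indicator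
          (fun z => ENNReal.ofReal (1 + 2 * g z.1 * rewardSign (z.2 a₀))) (x, y) =
          ENNReal.ofReal (1 + 2 * g x * rewardSign (y a₀)) := fun y =>
        indicator_of_mem (show (x, y) ∈ Prod.fst ⁻¹' B from hx) _
      simp_rw [h2]
      rw [indicator_of_mem hx, ← ofReal_integral_eq_lintegral_ofReal (integrable_uniformRewards _)
        (Filter.Eventually.of_forall fun y => (density_bounds hb x _).1),
        integral_add (integrable_uniformRewards _) (integrable_uniformRewards _),
        integral_const_mul, integral_rewardSign]
      simp
    · have h2 : ∀ y : Fin A → Fin 2, (Prod.fst ⁻¹' B : Set (Sample D A)).indicator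
          (fun z => ENNReal.ofReal (1 + 2 * g z.1 * rewardSign (z.2 a₀))) (x, y) = 0 := fun y =>
        indicator_of_notMem (show (x, y) ∉ Prod.fst ⁻¹' B from hx) _
      simp [hx]
  simp_rw [h1]
  rw [lintegral_indicator_one hB]

/-- Adding to `g` a function of disjoint support multiplies the law of a sample by a density. -/
theorem sampleLaw_add (hg : Measurable g) (hb : ∀ x, |g x| ≤ 1 / 2) {g' : Euc D → ℝ}
    (hg' : Measurable g') (hgg' : ∀ x, g x = 0 ∨ g' x = 0) :
    sampleLaw μ a₀ (fun x => g x + g' x) = (sampleLaw μ a₀ g).withDensity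
      fun z => ENNReal.ofReal (1 + 2 * g' z.1 * rewardSign (z.2 a₀)) := by
  rw [sampleLaw, sampleLaw, ← withDensity_mul _ (measurable_density a₀ hg).ennreal_ofReal
    (measurable_density a₀ hg').ennreal_ofReal]
  congr 1
  ext z
  rw [Pi.mul_apply, ← ENNReal.ofReal_mul (density_bounds hb _ _).1]
  congr 1
  rcases hgg' z.1 with h | h <;> rw [h] <;> ring

variable [IsProbabilityMeasure μ]

theorem isProbabilityMeasure_sampleLaw (hg : Measurable g) (hb : ∀ x, |g x| ≤ 1 / 2) :
    IsProbabilityMeasure (sampleLaw μ a₀ g) := by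
  constructor
  have h := congrArg (fun ν : Measure (Euc D) => ν univ) (marginal_sampleLaw μ a₀ hg hb)
  simpa [marginal, Measure.map_apply measurable_fst MeasurableSet.univ] using h

/-- Integration of a reward against a function of the covariate. -/
theorem integral_mul_reward (hg : Measurable g) (hb : ∀ x, |g x| ≤ 1 / 2) {φ : Euc D → ℝ}
    (hφ : Measurable φ) {c : ℝ} (hφb : ∀ x, |φ x| ≤ c) (b : Fin A) :
    ∫ z, φ z.1 * reward z b ∂(sampleLaw μ a₀ g) = ∫ x, φ x * meanReward a₀ g b x ∂μ := by
  rw [sampleLaw, integral_withDensity_eq_integral_toReal_smul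
    ((measurable_density a₀ hg).ennreal_ofReal) (Filter.Eventually.of_forall fun z => by simp)]
  have hc : 0 ≤ c := (abs_nonneg _).trans (hφb 0)
  have h1 : ∀ z : Sample D A, (ENNReal.ofReal (1 + 2 * g z.1 * rewardSign (z.2 a₀))).toReal •
      (φ z.1 * reward z b) = (1 + 2 * g z.1 * rewardSign (z.2 a₀)) * (φ z.1 * reward z b) :=
    fun z => by rw [ENNReal.toReal_ofReal (density_bounds hb _ _).1, smul_eq_mul]
  simp_rw [h1]
  rw [integral_prod]
  · refine integral_congr_ae (Filter.Eventually.of_forall fun x => ?_)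
    have h2 : ∀ y : Fin A → Fin 2,
        (1 + 2 * g x * rewardSign (y a₀)) * (φ x * reward ((x, y) : Sample D A) b) =
        φ x * (1 / 2 + 1 / 2 * rewardSign (y b) + g x * rewardSign (y a₀) +
          g x * (rewardSign (y a₀) * rewardSign (y b))) := fun y => by
      rw [reward_eq]; ring
    simp only [h2]
    rw [integral_const_mul, integral_add (integrable_uniformRewards _) (integrable_uniformRewards _),
      integral_add (integrable_uniformRewards _) (integrable_uniformRewards _),
      integral_add (integrable_uniformRewards _) (integrable_uniformRewards _),
      integral_const_mul, integral_const_mul, integral_const_mul, integral_rewardSign,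
      integral_rewardSign, integral_rewardSign_mul, meanReward]
    simp
  · refine Integrable.of_bound (C := 2 * c) ?_ (Filter.Eventually.of_forall fun z => ?_)
    · exact ((measurable_density a₀ hg).mul
        ((hφ.comp measurable_fst).mul (measurable_reward b))).aestronglyMeasurable
    · rw [norm_mul, norm_mul, Real.norm_of_nonneg (density_bounds hb _ _).1,
        Real.norm_of_nonneg (reward_mem z b).1, Real.norm_eq_abs]
      have h3 := (density_bounds hb z.1 (z.2 a₀)).2
      have h4 : |φ z.1| * reward z b ≤ c * 1 :=
        mul_le_mul (hφb _) (reward_mem z b).2 (reward_mem z b).1 hc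
      have h5 : 0 ≤ |φ z.1| * reward z b := mul_nonneg (abs_nonneg _) (reward_mem z b).1
      nlinarith [(density_bounds hb z.1 (z.2 a₀)).1]

theorem measurable_meanReward (hg : Measurable g) (b : Fin A) :
    Measurable (meanReward a₀ g b) := by
  unfold meanReward
  split_ifs <;> fun_prop

theorem abs_meanReward_le (hb : ∀ x, |g x| ≤ 1 / 2) (b : Fin A) (x : Euc D) :
    |meanReward a₀ g b x| ≤ 1 := by
  unfold meanReward
  have := abs_le.1 (hb x)
  split_ifs <;> rw [abs_le] <;> constructor <;> linarith [this.1, this.2]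

theorem isRewardFunction_sampleLaw (hg : Measurable g) (hb : ∀ x, |g x| ≤ 1 / 2)
    {f : Fin A → Euc D → ℝ} (hf : ∀ b, Measurable (f b))
    (hfe : ∀ b, f b =ᵐ[μ] meanReward a₀ g b) :
    IsRewardFunction (sampleLaw μ a₀ g) f := by
  intro b
  have := isProbabilityMeasure_sampleLaw μ a₀ hg hb
  have hmarg : (sampleLaw μ a₀ g).map Prod.fst = μ := marginal_sampleLaw μ a₀ hg hb
  have hfe' : (fun z : Sample D A => f b z.1) =ᵐ[sampleLaw μ a₀ g]
      fun z => meanReward a₀ g b z.1 := by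
    have h := hfe b
    rw [← hmarg] at h
    exact ae_of_ae_map measurable_fst.aemeasurable h
  have hint : Integrable (fun z : Sample D A => meanReward a₀ g b z.1) (sampleLaw μ a₀ g) :=
    Integrable.of_bound ((measurable_meanReward a₀ hg b).comp measurable_fst).aestronglyMeasurable 1
      (Filter.Eventually.of_forall fun z => abs_meanReward_le a₀ hb b z.1)
  have hle : MeasurableSpace.comap Prod.fst inferInstance ≤
      (inferInstance : MeasurableSpace (Sample D A)) := measurable_fst.comap_le
  refine (ae_eq_condExp_of_forall_setIntegral_eq hle ?_ ?_ ?_ ?_).symm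
  · exact Integrable.of_bound (measurable_reward b).aestronglyMeasurable 1
      (Filter.Eventually.of_forall fun z => by
        rw [Real.norm_of_nonneg (reward_mem z b).1]; exact (reward_mem z b).2)
  · intro s _ _
    exact (hint.congr hfe'.symm).integrableOn
  · rintro _ ⟨B, hB, rfl⟩ -
    have h1 : ∀ (F : Sample D A → ℝ), ∫ z in Prod.fst ⁻¹' B, F z ∂(sampleLaw μ a₀ g) =
        ∫ z, B.indicator 1 z.1 * F z ∂(sampleLaw μ a₀ g) := fun F => by
      rw [← integral_indicator (measurable_fst hB)]
      refine integral_congr_ae (Filter.Eventually.of_forall fun z => ?_)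
      by_cases hz : z.1 ∈ B
      · simp [indicator, hz]
      · simp [indicator, hz]
    rw [h1, h1, integral_mul_reward μ a₀ hg hb (measurable_one.indicator hB) (c := 1)
      (fun x => by by_cases hx : x ∈ B <;> simp [hx])]
    have h2 : ∫ z, B.indicator 1 z.1 * f b z.1 ∂(sampleLaw μ a₀ g) =
        ∫ z, B.indicator 1 z.1 * meanReward a₀ g b z.1 ∂(sampleLaw μ a₀ g) := by
      refine integral_congr_ae ?_
      filter_upwards [hfe'] with z hz
      rw [hz]
    rw [h2]
    have h3 : Measurable fun x => B.indicator 1 x * meanReward a₀ g b x :=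
      (measurable_one.indicator hB).mul (measurable_meanReward a₀ hg b)
    rw [← integral_map (f := fun x => B.indicator 1 x * meanReward a₀ g b x)
      measurable_fst.aemeasurable h3.aestronglyMeasurable, hmarg]
  · exact ((hf b).comp (comap_measurable Prod.fst)).stronglyMeasurable.aestronglyMeasurable

/-- The expected reward of an arm chosen as a function of the covariate. -/
theorem integral_reward_comp (hg : Measurable g) (hb : ∀ x, |g x| ≤ 1 / 2) {c : Euc D → Fin A}
    (hc : Measurable c) :
    ∫ z, reward z (c z.1) ∂(sampleLaw μ a₀ g) = ∫ x, meanReward a₀ g (c x) x ∂μ := by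
  have := isProbabilityMeasure_sampleLaw μ a₀ hg hb
  have hφ : ∀ b : Fin A, Measurable ((c ⁻¹' {b}).indicator (1 : Euc D → ℝ)) := fun b =>
    measurable_one.indicator (hc (measurableSet_singleton b))
  have hφb : ∀ (b : Fin A) x, |(c ⁻¹' {b}).indicator (1 : Euc D → ℝ) x| ≤ 1 := fun b x => by
    by_cases hx : x ∈ c ⁻¹' {b}
    · simp [indicator_of_mem hx]
    · simp [indicator_of_notMem hx]
  have h1 : ∀ z : Sample D A, reward z (c z.1) =
      ∑ b, (c ⁻¹' {b}).indicator 1 z.1 * reward z b := fun z => by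
    rw [Finset.sum_eq_single (c z.1)]
    · simp
    · intro b _ hb
      rw [indicator_of_notMem (by simpa using hb.symm), zero_mul]
    · simp
  have h2 : ∀ x, meanReward a₀ g (c x) x =
      ∑ b, (c ⁻¹' {b}).indicator 1 x * meanReward a₀ g b x := fun x => by
    rw [Finset.sum_eq_single (c x)]
    · simp
    · intro b _ hb
      rw [indicator_of_notMem (by simpa using hb.symm), zero_mul]
    · simp
  simp_rw [h1, h2]
  rw [integral_finsetSum, integral_finsetSum]
  · exact Finset.sum_congr rfl fun b _ => integral_mul_reward μ a₀ hg hb (hφ b) (hφb b) b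
  · intro b _
    refine Integrable.of_bound ((hφ b).mul (measurable_meanReward a₀ hg b)).aestronglyMeasurable 1
      (Filter.Eventually.of_forall fun x => ?_)
    rw [norm_mul]
    exact mul_le_one₀ (hφb b x) (norm_nonneg _) (abs_meanReward_le a₀ hb b x)
  · intro b _
    refine Integrable.of_bound (((hφ b).comp measurable_fst).mul
      (measurable_reward b)).aestronglyMeasurable 1 (Filter.Eventually.of_forall fun z => ?_)
    rw [norm_mul]
    refine mul_le_one₀ (hφb b _) (norm_nonneg _) ?_
    rw [Real.norm_of_nonneg (reward_mem z b).1]; exact (reward_mem z b).2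

end Law

/-! ### Histories and the regret of one round -/

namespace Policy

variable {S : Type} [MeasurableSpace S] {D A : ℕ} (π : Policy S D A)

theorem history_congr (s : S) {z z' : ℕ → Sample D A} {t : ℕ} (h : ∀ i < t, z i = z' i) :
    π.history s z t = π.history s z' t := by
  induction t with
  | zero => rfl
  | succ t ih =>
    have h1 := ih fun i hi => h i (by omega)
    simp only [history, h1, h t (by omega)]

theorem measurable_history (t : ℕ) :
    Measurable fun q : S × (ℕ → Sample D A) => π.history q.1 q.2 t := by
  induction t with
  | zero => exact measurable_const
  | succ t ih =>
    have hz : Measurable fun q : S × (ℕ → Sample D A) => q.2 t :=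
      (measurable_pi_apply t).comp measurable_snd
    have ha : Measurable fun q : S × (ℕ → Sample D A) =>
        π.act t q.1 (π.history q.1 q.2 t) (q.2 t).1 :=
      (π.measurable_act t).comp (measurable_fst.prodMk (ih.prodMk (measurable_fst.comp hz)))
    have happ : Measurable fun p : (Fin A → Fin 2) × Fin A => p.1 p.2 := Measurable.of_discrete
    refine measurable_pi_iff.2 fun i => ?_
    refine Fin.lastCases ?_ (fun j => ?_) i
    · simp only [history, Fin.snoc_last]
      exact (measurable_fst.comp hz).prodMk
        (ha.prodMk (happ.comp ((measurable_snd.comp hz).prodMk ha)))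
    · simp only [history, Fin.snoc_castSucc]
      exact (measurable_pi_apply j).comp ih

theorem measurable_arm (t : ℕ) : Measurable fun q : S × (ℕ → Sample D A) => π.arm q.1 q.2 t :=
  (π.measurable_act t).comp (measurable_fst.prodMk ((π.measurable_history t).prodMk
    (measurable_fst.comp ((measurable_pi_apply t).comp measurable_snd))))

/-- A finite sequence of samples, continued arbitrarily. -/
def extendSamples {t : ℕ} (y : Fin t → Sample D A) : ℕ → Sample D A :=
  fun i => if h : i < t then y ⟨i, h⟩ else 0

theorem measurable_extendSamples (t : ℕ) :
    Measurable (extendSamples : (Fin t → Sample D A) → ℕ → Sample D A) := by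
  refine measurable_pi_iff.2 fun i => ?_
  unfold extendSamples
  split_ifs with h
  · exact measurable_pi_apply _
  · exact measurable_const

/-- The arm played in round `t` at the covariate `x` when the earlier samples are `y`. -/
def nextArm (s : S) {t : ℕ} (y : Fin t → Sample D A) (x : Euc D) : Fin A :=
  π.act t s (π.history s (extendSamples y) t) x

theorem measurable_nextArm (s : S) (t : ℕ) :
    Measurable fun q : (Fin t → Sample D A) × Euc D => π.nextArm s q.1 q.2 :=
  (π.measurable_act t).comp (measurable_const.prodMk (((π.measurable_history t).comp
    (measurable_const.prodMk ((measurable_extendSamples t).comp measurable_fst))).prodMk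
    measurable_snd))

theorem arm_eq_nextArm (s : S) (z : ℕ → Sample D A) (t : ℕ) :
    π.arm s z t = π.nextArm s (fun i : Fin t => z i) (z t).1 := by
  unfold arm nextArm
  rw [π.history_congr s (z := z) (z' := extendSamples fun i : Fin t => z i)]
  intro i hi
  simp [extendSamples, hi]

end Policy

/-- In an i.i.d. sequence, the term of index `t` is independent of the earlier ones. -/
theorem map_infinitePi_split {Ω : Type*} [MeasurableSpace Ω] (P : Measure Ω)
    [IsProbabilityMeasure P] (t : ℕ) :
    (Measure.infinitePi fun _ : ℕ => P).map (fun z => (z t, fun i : Fin t => z i)) =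
      P.prod (Measure.pi fun _ : Fin t => P) := by
  have h1 : (Measure.infinitePi fun _ : ℕ => P).map (fun z (i : Fin (t + 1)) => z i) =
      Measure.pi fun _ : Fin (t + 1) => P := by
    rw [Measure.map_infinitePi_infinitePi_of_inj (P := fun _ : ℕ => P) Fin.val_injective,
      Measure.infinitePi_eq_pi]
  have h2 := (measurePreserving_piFinSuccAbove (fun _ : Fin (t + 1) => P) (Fin.last t)).map_eq
  rw [← h1, Measure.map_map (MeasurableEquiv.measurable _) (by fun_prop)] at h2
  rw [← h2]
  congr 1
  ext z i
  · simp [MeasurableEquiv.piFinSuccAbove, Fin.insertNthEquiv]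
  · simp [MeasurableEquiv.piFinSuccAbove, Fin.insertNthEquiv, Fin.init]

section Round

variable {S : Type} [MeasurableSpace S] {D A : ℕ} (π : Policy S D A) {μ : Measure (Euc D)}
  [IsProbabilityMeasure μ] {a₀ : Fin A} {g : Euc D → ℝ}

theorem measurable_reward_comp {Ω : Type*} [MeasurableSpace Ω] {z : Ω → Sample D A} {a : Ω → Fin A}
    (hz : Measurable z) (ha : Measurable a) : Measurable fun w => reward (z w) (a w) := by
  have happ : Measurable fun p : (Fin A → Fin 2) × Fin A => ((p.1 p.2 : ℕ) : ℝ) :=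
    Measurable.of_discrete
  exact happ.comp ((measurable_snd.comp hz).prodMk ha)

theorem abs_reward_sub_le (z z' : Sample D A) (a a' : Fin A) : |reward z a - reward z' a'| ≤ 1 := by
  have h1 := reward_mem z a
  have h2 := reward_mem z' a'
  rw [abs_le]; constructor <;> linarith [h1.1, h1.2, h2.1, h2.2]

theorem measurable_meanReward_comp {Ω : Type*} [MeasurableSpace Ω] (hg : Measurable g)
    {x : Ω → Euc D} {a : Ω → Fin A} (hx : Measurable x) (ha : Measurable a) :
    Measurable fun w => meanReward a₀ g (a w) (x w) := by
  unfold meanReward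
  exact measurable_const.add (Measurable.ite (ha (measurableSet_singleton a₀)) (hg.comp hx)
    measurable_const)

theorem abs_meanReward_sub_le (hb : ∀ x, |g x| ≤ 1 / 2) (a a' : Fin A) (x : Euc D) :
    |meanReward a₀ g a x - meanReward a₀ g a' x| ≤ 2 :=
  (abs_sub _ _).trans (by linarith [abs_meanReward_le a₀ hb a x, abs_meanReward_le a₀ hb a' x])

theorem integrable_gap (s : S) (t : ℕ) (hg : Measurable g) (hb : ∀ x, |g x| ≤ 1 / 2)
    {o : Euc D → Fin A} (ho : Measurable o) {ν : Measure (Fin t → Sample D A)}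
    [IsProbabilityMeasure ν] :
    Integrable (fun q : Euc D × (Fin t → Sample D A) =>
      meanReward a₀ g (o q.1) q.1 - meanReward a₀ g (π.nextArm s q.2 q.1) q.1) (μ.prod ν) := by
  refine Integrable.of_bound (C := 2) (Measurable.aestronglyMeasurable ?_)
    (Filter.Eventually.of_forall fun q => abs_meanReward_sub_le hb _ _ _)
  exact (measurable_meanReward_comp (Ω := Euc D × (Fin t → Sample D A)) hg measurable_fst
    (ho.comp measurable_fst)).sub
    (measurable_meanReward_comp (Ω := Euc D × (Fin t → Sample D A)) hg measurable_fst ((π.measurable_nextArm s t).comp measurable_swap))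

/-- The expected regret of a round is the mean gap between the best arm and the arm played, at a
fresh covariate and an independent history. -/
theorem integral_round (s : S) (t : ℕ) (hg : Measurable g) (hb : ∀ x, |g x| ≤ 1 / 2)
    {o : Euc D → Fin A} (ho : Measurable o) :
    ∫ z, (reward (z t) (o (z t).1) - reward (z t) (π.arm s z t))
        ∂(Measure.infinitePi fun _ : ℕ => sampleLaw μ a₀ g) =
      ∫ x, ∫ y, (meanReward a₀ g (o x) x - meanReward a₀ g (π.nextArm s y x) x)
        ∂(Measure.pi fun _ : Fin t => sampleLaw μ a₀ g) ∂μ := by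
  have := isProbabilityMeasure_sampleLaw μ a₀ hg hb
  set P := sampleLaw μ a₀ g with hP
  set Pt := Measure.pi fun _ : Fin t => P with hPt
  let G : Sample D A × (Fin t → Sample D A) → ℝ := fun q =>
    reward q.1 (o q.1.1) - reward q.1 (π.nextArm s q.2 q.1.1)
  have hGm : Measurable G := by
    refine (measurable_reward_comp (Ω := Sample D A × (Fin t → Sample D A)) measurable_fst
      (ho.comp (measurable_fst.comp measurable_fst))).sub
      (measurable_reward_comp (Ω := Sample D A × (Fin t → Sample D A)) measurable_fst ?_)
    exact (π.measurable_nextArm s t).comp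
      (measurable_snd.prodMk (measurable_fst.comp measurable_fst))
  have hGi : Integrable G (P.prod Pt) := Integrable.of_bound hGm.aestronglyMeasurable 1
    (Filter.Eventually.of_forall fun q => abs_reward_sub_le _ _ _ _)
  have h1 : ∫ z, (reward (z t) (o (z t).1) - reward (z t) (π.arm s z t))
      ∂(Measure.infinitePi fun _ : ℕ => P) = ∫ q, G q ∂(P.prod Pt) := by
    rw [← map_infinitePi_split P t, integral_map (by fun_prop) hGm.aestronglyMeasurable]
    refine integral_congr_ae (Filter.Eventually.of_forall fun z => ?_)
    simp only [G]
    rw [π.arm_eq_nextArm]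
  rw [h1, integral_prod_symm _ hGi]
  have h2 : ∀ y, ∫ w, G (w, y) ∂P =
      ∫ x, (meanReward a₀ g (o x) x - meanReward a₀ g (π.nextArm s y x) x) ∂μ := by
    intro y
    have hm : Measurable fun x => π.nextArm s y x :=
      (π.measurable_nextArm s t).comp (measurable_const.prodMk measurable_id)
    have hr : ∀ c : Euc D → Fin A, Measurable c →
        Integrable (fun w : Sample D A => reward w (c w.1)) P := fun c hc =>
      Integrable.of_bound (C := 1) (measurable_reward_comp measurable_id
        (hc.comp measurable_fst)).aestronglyMeasurable
        (Filter.Eventually.of_forall fun z => by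
          rw [Real.norm_of_nonneg (reward_mem z _).1]; exact (reward_mem z _).2)
    have hmr : ∀ c : Euc D → Fin A, Measurable c →
        Integrable (fun x => meanReward a₀ g (c x) x) μ := fun c hc =>
      Integrable.of_bound (C := 1) (measurable_meanReward_comp hg measurable_id
        hc).aestronglyMeasurable (Filter.Eventually.of_forall fun x => abs_meanReward_le a₀ hb _ x)
    have e1 := integral_reward_comp μ a₀ hg hb ho
    have e2 := integral_reward_comp μ a₀ hg hb hm
    calc ∫ w, G (w, y) ∂P
        = ∫ w, reward w (o w.1) ∂P - ∫ w, reward w (π.nextArm s y w.1) ∂P :=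
          integral_sub (hr o ho) (hr (fun x => π.nextArm s y x) hm)
      _ = ∫ x, meanReward a₀ g (o x) x ∂μ - ∫ x, meanReward a₀ g (π.nextArm s y x) x ∂μ := by
          rw [hP, e1, e2]
      _ = _ := (integral_sub (hmr o ho) (hmr (fun x => π.nextArm s y x) hm)).symm
  simp_rw [h2]
  exact (integral_integral_swap (integrable_gap π s t hg hb ho)).symm

end Round

/-! ### The family of perturbations -/

section Family

variable {D A : ℕ} {ι : Type} [Fintype ι]

/-- The perturbation of the mean reward that takes the value `ε * σ k` on the cell `C k`. -/
noncomputable def perturbation (ε : ℝ) (C : ι → Set (Euc D)) (σ : ι → ℝ) (x : Euc D) : ℝ :=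
  ε * ∑ k, σ k * (C k).indicator 1 x

/-- The sign encoded by a Boolean. -/
def boolSign (b : Bool) : ℝ := if b then 1 else -1

variable {ε : ℝ} {C : ι → Set (Euc D)}

theorem measurable_perturbation (hC : ∀ k, MeasurableSet (C k)) (σ : ι → ℝ) :
    Measurable (perturbation ε C σ) :=
  (Finset.measurable_sum _ fun k _ =>
    (measurable_one.indicator (hC k)).const_mul (σ k)).const_mul ε

theorem perturbation_of_mem (hdisj : ∀ j k, j ≠ k → Disjoint (C j) (C k)) (σ : ι → ℝ) {k : ι}
    {x : Euc D} (hx : x ∈ C k) : perturbation ε C σ x = ε * σ k := by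
  rw [perturbation, Finset.sum_eq_single k]
  · simp [hx]
  · intro j _ hj
    rw [indicator_of_notMem (fun h => (Set.disjoint_left.1 (hdisj j k hj)) h hx), mul_zero]
  · simp

theorem perturbation_of_notMem (σ : ι → ℝ) {x : Euc D} (hx : ∀ k, x ∉ C k) :
    perturbation ε C σ x = 0 := by
  rw [perturbation, Finset.sum_eq_zero, mul_zero]
  intro k _
  rw [indicator_of_notMem (hx k), mul_zero]

theorem abs_perturbation_le (hdisj : ∀ j k, j ≠ k → Disjoint (C j) (C k)) (hε : 0 ≤ ε)
    {σ : ι → ℝ} (hσ : ∀ k, |σ k| ≤ 1) (x : Euc D) : |perturbation ε C σ x| ≤ ε := by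
  by_cases hx : ∃ k, x ∈ C k
  · obtain ⟨k, hk⟩ := hx
    rw [perturbation_of_mem hdisj σ hk, abs_mul, abs_of_nonneg hε]
    exact mul_le_of_le_one_right hε (hσ k)
  · push Not at hx
    rw [perturbation_of_notMem σ hx, abs_zero]; exact hε

theorem abs_boolSign (b : Bool) : |boolSign b| = 1 := by cases b <;> simp [boolSign]

variable [DecidableEq ι] (μ : Measure (Euc D)) [IsProbabilityMeasure μ] (a₀ : Fin A)

/-- From `t` samples one cannot tell the sign of the perturbation on the cell `k`: the two laws have
densities `1 ± q` with respect to the law without perturbation on that cell, and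
`∫ q ^ 2 = 4 * ε ^ 2 * μ (C k)`. -/
theorem two_point_cell (hC : ∀ k, MeasurableSet (C k))
    (hdisj : ∀ j k, j ≠ k → Disjoint (C j) (C k)) (hε : 0 ≤ ε) (hε2 : ε ≤ 1 / 2) (σ : ι → Bool)
    (k : ι) (t : ℕ) (hinfo : t * (4 * ε ^ 2 * μ.real (C k)) ≤ 1 / 4)
    {B : Set (Fin t → Sample D A)} (hB : MeasurableSet B) :
    1 / 4 ≤ (Measure.pi fun _ : Fin t => sampleLaw μ a₀
        (perturbation ε C fun j => boolSign (Function.update σ k true j))).real B +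
      (Measure.pi fun _ : Fin t => sampleLaw μ a₀
        (perturbation ε C fun j => boolSign (Function.update σ k false j))).real Bᶜ := by
  -- the reference law has no perturbation on the cell `k`
  set g : Euc D → ℝ := perturbation ε C (Function.update (fun j => boolSign (σ j)) k 0) with hg
  have hgm : Measurable g := measurable_perturbation hC _
  have hgb : ∀ x, |g x| ≤ 1 / 2 := fun x => (abs_perturbation_le hdisj hε (fun j => by
    by_cases hj : j = k
    · subst hj; simp
    · simp [hj, abs_boolSign]) x).trans hε2
  have hgC : ∀ x, x ∈ C k → g x = 0 := fun x hx => by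
    rw [hg, perturbation_of_mem hdisj _ hx]; simp
  have hprob := isProbabilityMeasure_sampleLaw μ a₀ hgm hgb
  have hφ : ∀ c : ℝ, Measurable ((C k).indicator fun _ : Euc D => c) := fun c =>
    measurable_const.indicator (hC k)
  have hsplit : ∀ b : Bool, perturbation ε C (fun j => boolSign (Function.update σ k b j)) =
      fun x => g x + (C k).indicator (fun _ => ε * boolSign b) x := by
    intro b
    ext x
    by_cases hx : ∃ j, x ∈ C j
    · obtain ⟨j, hj⟩ := hx
      rw [hg, perturbation_of_mem hdisj _ hj, perturbation_of_mem hdisj _ hj]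
      by_cases hjk : j = k
      · subst hjk; simp [hj]
      · have hxk : x ∉ C k := fun h => Set.disjoint_left.1 (hdisj j k hjk) hj h
        simp [hjk, hxk]
    · push Not at hx
      rw [hg, perturbation_of_notMem _ hx, perturbation_of_notMem _ hx]
      simp [hx k]
  have hlaw : ∀ b : Bool, sampleLaw μ a₀
      (perturbation ε C fun j => boolSign (Function.update σ k b j)) =
      (sampleLaw μ a₀ g).withDensity fun z => ENNReal.ofReal
        (1 + 2 * (C k).indicator (fun _ => ε * boolSign b) z.1 * rewardSign (z.2 a₀)) := by
    intro b
    rw [hsplit b, sampleLaw_add μ a₀ hgm hgb (hφ _)]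
    intro x
    by_cases hx : x ∈ C k
    · exact Or.inl (hgC x hx)
    · exact Or.inr (indicator_of_notMem hx _)
  set q : Sample D A → ℝ := fun z =>
    2 * (C k).indicator (fun _ => ε) z.1 * rewardSign (z.2 a₀) with hq
  have hqm : Measurable q :=
    (((hφ ε).comp measurable_fst).const_mul 2).mul (measurable_rewardSign_apply a₀)
  have hqb : ∀ z, |q z| ≤ 1 := fun z => by
    rw [hq]
    simp only [abs_mul, abs_rewardSign, abs_two, mul_one]
    by_cases hz : z.1 ∈ C k
    · rw [indicator_of_mem hz, abs_of_nonneg hε]; linarith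
    · rw [indicator_of_notMem hz]; simp
  have hind : ∀ x, |(C k).indicator (fun _ => ε) x| ≤ ε := fun x => by
    by_cases hx : x ∈ C k
    · rw [indicator_of_mem hx, abs_of_nonneg hε]
    · rw [indicator_of_notMem hx]; simpa using hε
  have hmarg : (sampleLaw μ a₀ g).map Prod.fst = μ := marginal_sampleLaw μ a₀ hgm hgb
  have hfst : ∀ φ : Euc D → ℝ, Measurable φ →
      ∫ z, φ z.1 ∂(sampleLaw μ a₀ g) = ∫ x, φ x ∂μ := fun φ hφ' => by
    rw [← integral_map (f := φ) measurable_fst.aemeasurable hφ'.aestronglyMeasurable, hmarg]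
  have hq0 : ∫ z, q z ∂(sampleLaw μ a₀ g) = 0 := by
    have h1 : ∀ z, q z = 4 * ((C k).indicator (fun _ => ε) z.1 * reward z a₀) -
        2 * (C k).indicator (fun _ => ε) z.1 := fun z => by
      rw [hq, reward_eq]; ring
    have hi1 : Integrable (fun z : Sample D A => (C k).indicator (fun _ => ε) z.1 * reward z a₀)
        (sampleLaw μ a₀ g) := Integrable.of_bound (C := ε * 1)
      (((hφ ε).comp measurable_fst).mul (measurable_reward a₀)).aestronglyMeasurable
      (Filter.Eventually.of_forall fun z => by
        rw [norm_mul, Real.norm_of_nonneg (reward_mem z a₀).1]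
        exact mul_le_mul (hind _) (reward_mem z a₀).2 (reward_mem z a₀).1 hε)
    have hi2 : Integrable (fun z : Sample D A => (C k).indicator (fun _ => ε) z.1)
        (sampleLaw μ a₀ g) := Integrable.of_bound (C := ε)
      ((hφ ε).comp measurable_fst).aestronglyMeasurable
      (Filter.Eventually.of_forall fun z => hind _)
    simp_rw [h1]
    rw [integral_sub (hi1.const_mul 4) (hi2.const_mul 2), integral_const_mul, integral_const_mul,
      integral_mul_reward μ a₀ hgm hgb (hφ ε) hind, hfst _ (hφ ε)]
    have h2 : ∀ x, (C k).indicator (fun _ => ε) x * meanReward a₀ g a₀ x =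
        1 / 2 * (C k).indicator (fun _ => ε) x := fun x => by
      rw [meanReward, if_pos rfl]
      by_cases hx : x ∈ C k
      · rw [hgC x hx]; ring
      · rw [indicator_of_notMem hx]; ring
    simp_rw [h2]
    rw [integral_const_mul]
    ring
  have hq2 : ∫ z, q z ^ 2 ∂(sampleLaw μ a₀ g) = 4 * ε ^ 2 * μ.real (C k) := by
    have h1 : ∀ z, q z ^ 2 = (C k).indicator (fun _ => 4 * ε ^ 2) z.1 := fun z => by
      rw [hq]
      simp only [mul_pow, rewardSign_sq, mul_one]
      by_cases hz : z.1 ∈ C k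
      · rw [indicator_of_mem hz, indicator_of_mem hz]; ring
      · rw [indicator_of_notMem hz, indicator_of_notMem hz]; ring
    simp_rw [h1]
    rw [hfst _ (hφ _), integral_indicator_const _ (hC k), smul_eq_mul, mul_comm]
  have key := two_point (sampleLaw μ a₀ g) hqm hqb hq0 t hB
  rw [hq2] at key
  have hT : (sampleLaw μ a₀ g).withDensity (fun z => ENNReal.ofReal (1 + q z)) = sampleLaw μ a₀
      (perturbation ε C fun j => boolSign (Function.update σ k true j)) := by
    rw [hlaw true]; simp [hq, boolSign]
  have hF : (sampleLaw μ a₀ g).withDensity (fun z => ENNReal.ofReal (1 - q z)) = sampleLaw μ a₀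
      (perturbation ε C fun j => boolSign (Function.update σ k false j)) := by
    rw [hlaw false]
    congr 1
    ext z
    congr 1
    rw [hq]
    by_cases hz : z.1 ∈ C k
    · simp [boolSign, hz]
      ring
    · simp [hz]
  rw [hT, hF] at key
  linarith

/-- Averaged over the signs `σ`, any test for the sign on the cell `k` errs with probability at least
`1 / 8`: each `σ` is paired with the choice of signs that differs from it at `k` only. In the
application `B` is the event that the arm `a₀` is played, which is an error when `σ k` is `false`. -/
theorem sum_error_ge (hC : ∀ k, MeasurableSet (C k))
    (hdisj : ∀ j k, j ≠ k → Disjoint (C j) (C k)) (hε : 0 ≤ ε) (hε2 : ε ≤ 1 / 2)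
    (k : ι) (t : ℕ) (hinfo : t * (4 * ε ^ 2 * μ.real (C k)) ≤ 1 / 4)
    {B : Set (Fin t → Sample D A)} (hB : MeasurableSet B) :
    Fintype.card (ι → Bool) * (1 / 8 : ℝ) ≤ ∑ σ : ι → Bool,
      (Measure.pi fun _ : Fin t => sampleLaw μ a₀
        (perturbation ε C fun j => boolSign (σ j))).real (if σ k then Bᶜ else B) := by
  set F : (ι → Bool) → ℝ := fun σ => (Measure.pi fun _ : Fin t => sampleLaw μ a₀
    (perturbation ε C fun j => boolSign (σ j))).real (if σ k then Bᶜ else B) with hF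
  have hinv : Function.Involutive (fun σ : ι → Bool => Function.update σ k (!(σ k))) :=
    fun σ => by simp
  have hflip : ∑ σ, F (Function.update σ k (!(σ k))) = ∑ σ, F σ :=
    Equiv.sum_comp hinv.toPerm F
  have hpair : ∀ σ, 1 / 4 ≤ F σ + F (Function.update σ k (!(σ k))) := by
    intro σ
    have h := two_point_cell μ a₀ hC hdisj hε hε2 σ k t hinfo hB.compl
    rw [compl_compl] at h
    have hT : F (Function.update σ k true) = (Measure.pi fun _ : Fin t => sampleLaw μ a₀
        (perturbation ε C fun j => boolSign (Function.update σ k true j))).real Bᶜ := by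
      simp [hF]
    have hFa : F (Function.update σ k false) = (Measure.pi fun _ : Fin t => sampleLaw μ a₀
        (perturbation ε C fun j => boolSign (Function.update σ k false j))).real B := by
      simp [hF]
    rw [← hT, ← hFa] at h
    cases hk : σ k with
    | true =>
      have : Function.update σ k true = σ := by rw [← hk]; simp
      rw [this] at h
      simpa using h
    | false =>
      have : Function.update σ k false = σ := by rw [← hk]; simp
      rw [this] at h
      rw [add_comm] at h
      simpa using h
  have hsum : ∑ _σ : ι → Bool, (1 / 4 : ℝ) ≤
      ∑ σ, (F σ + F (Function.update σ k (!(σ k)))) := Finset.sum_le_sum fun σ _ => hpair σ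
  rw [Finset.sum_add_distrib, hflip, Finset.sum_const, Finset.card_univ, nsmul_eq_mul] at hsum
  linarith

variable {S : Type} [MeasurableSpace S] (π : Policy S D A)

/-- The regret of one round, summed over all signs. At a covariate in the cell `k` the regret is `ε`
if the wrong arm is played and `0` otherwise. -/
theorem sum_round_ge (hC : ∀ k, MeasurableSet (C k))
    (hdisj : ∀ j k, j ≠ k → Disjoint (C j) (C k)) (hε : 0 ≤ ε) (hε2 : ε ≤ 1 / 2) (t : ℕ)
    (hinfo : ∀ k, t * (4 * ε ^ 2 * μ.real (C k)) ≤ 1 / 4)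
    {o : (ι → Bool) → Euc D → Fin A} (ho : ∀ σ, Measurable (o σ))
    (hoC : ∀ σ k, ∀ x ∈ C k, (o σ x = a₀ ↔ σ k = true)) (s : S) :
    Fintype.card (ι → Bool) * (ε / 8 * ∑ k, μ.real (C k)) ≤ ∑ σ : ι → Bool,
      ∫ z, (reward (z t) (o σ (z t).1) - reward (z t) (π.arm s z t))
        ∂(Measure.infinitePi fun _ : ℕ => sampleLaw μ a₀
          (perturbation ε C fun j => boolSign (σ j))) := by
  have hgm : ∀ σ : ι → Bool, Measurable (perturbation ε C fun j => boolSign (σ j)) :=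
    fun σ => measurable_perturbation hC _
  have hgb : ∀ (σ : ι → Bool) x, |perturbation ε C (fun j => boolSign (σ j)) x| ≤ 1 / 2 :=
    fun σ x => (abs_perturbation_le hdisj hε (fun j => (abs_boolSign _).le) x).trans hε2
  have hprob := fun σ => isProbabilityMeasure_sampleLaw μ a₀ (hgm σ) (hgb σ)
  simp_rw [fun σ => integral_round π s t (hgm σ) (hgb σ) (ho σ) (μ := μ) (a₀ := a₀)]
  have hint := fun σ => (integrable_gap π s t (hgm σ) (hgb σ) (ho σ) (μ := μ) (a₀ := a₀)
    (ν := Measure.pi fun _ : Fin t => sampleLaw μ a₀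
          (perturbation ε C fun j => boolSign (σ j)))).integral_prod_left
  rw [← integral_finsetSum _ fun σ _ => hint σ]
  have hleft : Fintype.card (ι → Bool) * (ε / 8 * ∑ k, μ.real (C k)) =
      ∫ x, ∑ k, (C k).indicator (fun _ => Fintype.card (ι → Bool) * (ε / 8)) x ∂μ := by
    rw [integral_finsetSum _ fun k _ => (integrable_const _).indicator (hC k)]
    simp_rw [fun k => integral_indicator_const (μ := μ)
      ((Fintype.card (ι → Bool) : ℝ) * (ε / 8)) (hC k), smul_eq_mul]
    rw [← Finset.sum_mul]
    ring
  rw [hleft]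
  refine integral_mono (integrable_finsetSum _ fun k _ => (integrable_const _).indicator (hC k))
    (integrable_finsetSum _ fun σ _ => hint σ) fun x => ?_
  by_cases hx : ∃ k, x ∈ C k
  · obtain ⟨k, hk⟩ := hx
    have h1 : ∑ j, (C j).indicator (fun _ => (Fintype.card (ι → Bool) : ℝ) * (ε / 8)) x =
        Fintype.card (ι → Bool) * (ε / 8) := by
      rw [Finset.sum_eq_single k]
      · rw [indicator_of_mem hk]
      · intro j _ hj
        exact indicator_of_notMem (fun h => Set.disjoint_left.1 (hdisj j k hj) h hk) _
      · simp
    simp only [h1]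
    set B : Set (Fin t → Sample D A) := {y | π.nextArm s y x = a₀} with hB
    have hBm : MeasurableSet B :=
      ((π.measurable_nextArm s t).comp (measurable_id.prodMk measurable_const))
        (measurableSet_singleton a₀)
    have h2 : ∀ σ : ι → Bool, ∫ y, (meanReward a₀ (perturbation ε C fun j => boolSign (σ j))
          (o σ x) x - meanReward a₀ (perturbation ε C fun j => boolSign (σ j))
          (π.nextArm s y x) x) ∂(Measure.pi fun _ : Fin t => sampleLaw μ a₀
          (perturbation ε C fun j => boolSign (σ j))) =
        ε * (Measure.pi fun _ : Fin t => sampleLaw μ a₀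
          (perturbation ε C fun j => boolSign (σ j))).real (if σ k then Bᶜ else B) := by
      intro σ
      have h3 : ∀ y, meanReward a₀ (perturbation ε C fun j => boolSign (σ j))
          (o σ x) x - meanReward a₀ (perturbation ε C fun j => boolSign (σ j))
          (π.nextArm s y x) x = (if σ k then Bᶜ else B).indicator (fun _ => ε) y := by
        intro y
        unfold meanReward
        rw [perturbation_of_mem hdisj _ hk]
        have ho' := hoC σ k x hk
        by_cases hy : y ∈ B
        · have hy' : π.nextArm s y x = a₀ := hy
          cases hσ : σ k with
          | true => simp [hy, hy', ho'.2 hσ]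
          | false =>
            have : o σ x ≠ a₀ := fun h => by simp [ho'.1 h] at hσ
            simp [hy, hy', this, boolSign]
        · have hy' : π.nextArm s y x ≠ a₀ := hy
          cases hσ : σ k with
          | true => simp [hy, hy', ho'.2 hσ, boolSign]
          | false =>
            have : o σ x ≠ a₀ := fun h => by simp [ho'.1 h] at hσ
            simp [hy, hy', this]
      simp_rw [h3]
      rw [integral_indicator_const, smul_eq_mul, mul_comm]
      split_ifs
      · exact hBm.compl
      · exact hBm
    simp_rw [h2]
    rw [← Finset.mul_sum]
    have := sum_error_ge μ a₀ hC hdisj hε hε2 k t (hinfo k) hBm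
    nlinarith
  · push Not at hx
    have h1 : ∑ j, (C j).indicator (fun _ => (Fintype.card (ι → Bool) : ℝ) * (ε / 8)) x = 0 :=
      Finset.sum_eq_zero fun j _ => indicator_of_notMem (hx j) _
    simp only [h1]
    refine Finset.sum_nonneg fun σ _ => le_of_eq ?_
    unfold meanReward
    rw [perturbation_of_notMem _ hx]
    simp

/-- Some choice of signs forces a large regret on the given policy. -/
theorem exists_expectedRegret_ge (ρ : Measure S) [IsProbabilityMeasure ρ]
    (hC : ∀ k, MeasurableSet (C k))
    (hdisj : ∀ j k, j ≠ k → Disjoint (C j) (C k)) (hε : 0 ≤ ε) (hε2 : ε ≤ 1 / 2) (n : ℕ)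
    (hinfo : ∀ k, n * (4 * ε ^ 2 * μ.real (C k)) ≤ 1 / 4)
    {o : (ι → Bool) → Euc D → Fin A} (ho : ∀ σ, Measurable (o σ))
    (hoC : ∀ σ k, ∀ x ∈ C k, (o σ x = a₀ ↔ σ k = true)) :
    ∃ σ : ι → Bool, n * (ε / 8 * ∑ k, μ.real (C k)) ≤
      π.expectedRegret ρ (sampleLaw μ a₀ (perturbation ε C fun j => boolSign (σ j))) (o σ) n := by
  have hprob := fun σ : ι → Bool => isProbabilityMeasure_sampleLaw μ a₀
    (measurable_perturbation (ε := ε) hC fun j => boolSign (σ j))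
    (fun x => (abs_perturbation_le hdisj hε (fun j => (abs_boolSign _).le) x).trans hε2)
  set P := fun σ : ι → Bool => sampleLaw μ a₀ (perturbation ε C fun j => boolSign (σ j)) with hP
  set R : (ι → Bool) → ℕ → S → ℝ := fun σ t s =>
    ∫ z, (reward (z t) (o σ (z t).1) - reward (z t) (π.arm s z t))
      ∂(Measure.infinitePi fun _ : ℕ => P σ) with hR
  have hint : ∀ σ t, Integrable (fun q : S × (ℕ → Sample D A) =>
      reward (q.2 t) (o σ (q.2 t).1) - reward (q.2 t) (π.arm q.1 q.2 t))
      (ρ.prod (Measure.infinitePi fun _ : ℕ => P σ)) := by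
    intro σ t
    have hz : Measurable fun q : S × (ℕ → Sample D A) => q.2 t :=
      (measurable_pi_apply t).comp measurable_snd
    exact Integrable.of_bound (C := 1) ((measurable_reward_comp hz
      ((ho σ).comp (measurable_fst.comp hz))).sub
      (measurable_reward_comp hz (π.measurable_arm t))).aestronglyMeasurable
      (Filter.Eventually.of_forall fun q => abs_reward_sub_le _ _ _ _)
  have hRi : ∀ σ t, Integrable (R σ t) ρ := fun σ t => (hint σ t).integral_prod_left
  have hreg : ∀ σ, π.expectedRegret ρ (P σ) (o σ) n = ∑ t ∈ Finset.range n, ∫ s, R σ t s ∂ρ := by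
    intro σ
    unfold Policy.expectedRegret Policy.regret
    rw [integral_finsetSum _ fun t _ => hint σ t]
    exact Finset.sum_congr rfl fun t _ => integral_prod _ (hint σ t)
  have hsum : ∑ _σ : ι → Bool, n * (ε / 8 * ∑ k, μ.real (C k)) ≤
      ∑ σ, π.expectedRegret ρ (P σ) (o σ) n := by
    simp_rw [hreg]
    rw [Finset.sum_comm]
    have hround : ∀ t ∈ Finset.range n, Fintype.card (ι → Bool) * (ε / 8 * ∑ k, μ.real (C k)) ≤
        ∑ σ, ∫ s, R σ t s ∂ρ := by
      intro t ht
      rw [Finset.mem_range] at ht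
      rw [← integral_finsetSum _ fun σ _ => hRi σ t]
      have hc : ∀ c : ℝ, c = ∫ _s : S, c ∂ρ := fun c => by simp
      rw [hc (Fintype.card (ι → Bool) * (ε / 8 * ∑ k, μ.real (C k)))]
      refine integral_mono (integrable_const _) (integrable_finsetSum _ fun σ _ => hRi σ t)
        fun s => ?_
      refine sum_round_ge μ a₀ π hC hdisj hε hε2 t (fun k => le_trans ?_ (hinfo k)) ho hoC s
      gcongr
    refine le_trans (le_of_eq ?_) (Finset.sum_le_sum hround)
    rw [Finset.sum_const, Finset.sum_const, Finset.card_univ, Finset.card_range, nsmul_eq_mul,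
      nsmul_eq_mul]
    ring
  obtain ⟨σ, -, hσ⟩ := Finset.exists_le_of_sum_le Finset.univ_nonempty hsum
  exact ⟨σ, hσ⟩

end Family

/-! ### The covariate distribution -/

section Covariates

variable {d D N : ℕ} {M : Set (Euc D)} {h : ℝ} {C : (Fin d → Fin N) → Set (Euc D)}

/-- The uniform distribution on the union of the cells, as a measure with a density with respect
to the volume of `M`. -/
noncomputable def cellUniform (M : Set (Euc D)) (C : (Fin d → Fin N) → Set (Euc D)) :
    Measure (Euc D) :=
  (manifoldVolume d M).withDensity
    ((⋃ k, C k).indicator fun _ => (manifoldVolume d M (⋃ k, C k))⁻¹)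

theorem IsCellSystem.isCompact_union (hC : IsCellSystem M h C) : IsCompact (⋃ k, C k) :=
  isCompact_iUnion hC.isCompact

theorem cellUniform_apply (hC : IsCellSystem M h C) (B : Set (Euc D)) :
    cellUniform M C B =
      (manifoldVolume d M (⋃ k, C k))⁻¹ * manifoldVolume d M ((⋃ k, C k) ∩ B) := by
  have hS := hC.isCompact_union.measurableSet
  rw [cellUniform, withDensity_indicator hS, withDensity_const, Measure.smul_apply,
    Measure.restrict_apply' hS, smul_eq_mul, inter_comm]

theorem IsCellSystem.inv_total_le (hC : IsCellSystem M h C) (hN : 0 < N) (hh : 0 < h) :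
    (manifoldVolume d M (⋃ k, C k))⁻¹ ≤ ENNReal.ofReal (((N * h / 2) ^ d)⁻¹) := by
  have hN' : (0 : ℝ) < N := by exact_mod_cast hN
  rw [ENNReal.ofReal_inv_of_pos (by positivity), ENNReal.ofReal_pow (by positivity)]
  exact ENNReal.inv_le_inv' hC.total_ge

theorem IsCellSystem.le_inv_total (hC : IsCellSystem M h C) (hN : 0 < N) (hh : 0 < h) :
    ENNReal.ofReal (((2 * (N * h)) ^ d)⁻¹) ≤ (manifoldVolume d M (⋃ k, C k))⁻¹ := by
  have hN' : (0 : ℝ) < N := by exact_mod_cast hN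
  rw [ENNReal.ofReal_inv_of_pos (by positivity), ENNReal.ofReal_pow (by positivity)]
  exact ENNReal.inv_le_inv' hC.total_le

theorem IsCellSystem.total_ne_top (hC : IsCellSystem M h C) :
    manifoldVolume d M (⋃ k, C k) ≠ ⊤ :=
  ne_top_of_le_ne_top (ENNReal.pow_ne_top ENNReal.ofReal_ne_top) hC.total_le

theorem IsCellSystem.total_ne_zero (hC : IsCellSystem M h C) (hN : 0 < N) (hh : 0 < h) :
    manifoldVolume d M (⋃ k, C k) ≠ 0 := by
  rw [← ENNReal.inv_ne_top]
  exact ne_top_of_le_ne_top ENNReal.ofReal_ne_top (hC.inv_total_le hN hh)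

theorem isProbabilityMeasure_cellUniform (hC : IsCellSystem M h C) (hN : 0 < N) (hh : 0 < h) :
    IsProbabilityMeasure (cellUniform M C) := by
  constructor
  rw [cellUniform_apply hC, inter_univ]
  exact ENNReal.inv_mul_cancel (hC.total_ne_zero hN hh) hC.total_ne_top

theorem cellUniform_compl (hC : IsCellSystem M h C) : cellUniform M C (⋃ k, C k)ᶜ = 0 := by
  rw [cellUniform_apply hC, inter_compl_self, measure_empty, mul_zero]

theorem support_cellUniform_subset (hC : IsCellSystem M h C) :
    (cellUniform M C).support ⊆ ⋃ k, C k :=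
  Measure.support_subset_of_isClosed hC.isCompact_union.isClosed (cellUniform_compl hC)

theorem cellUniform_cell_le (hC : IsCellSystem M h C) (hN : 0 < N) (hh : 0 < h)
    (k : Fin d → Fin N) : cellUniform M C (C k) ≤ ENNReal.ofReal ((2 / N) ^ d) := by
  have hN' : (0 : ℝ) < N := by exact_mod_cast hN
  rw [cellUniform_apply hC, inter_eq_self_of_subset_right (subset_iUnion C k)]
  refine (mul_le_mul' (hC.inv_total_le hN hh) (hC.cell_le k)).trans (le_of_eq ?_)
  rw [← ENNReal.ofReal_pow hh.le, ← ENNReal.ofReal_mul (by positivity), ← inv_pow, ← mul_pow]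
  congr 2
  field_simp

theorem le_cellUniform_cell (hC : IsCellSystem M h C) (hN : 0 < N) (hh : 0 < h)
    (k : Fin d → Fin N) : ENNReal.ofReal ((1 / (4 * N)) ^ d) ≤ cellUniform M C (C k) := by
  have hN' : (0 : ℝ) < N := by exact_mod_cast hN
  rw [cellUniform_apply hC, inter_eq_self_of_subset_right (subset_iUnion C k)]
  refine le_trans (le_of_eq ?_) (mul_le_mul' (hC.le_inv_total hN hh) (hC.cell_ge k))
  rw [← ENNReal.ofReal_pow (by positivity), ← ENNReal.ofReal_mul (by positivity), ← inv_pow,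
    ← mul_pow]
  congr 2
  field_simp
  norm_num

theorem isRegularMeasure_cellUniform (hC : IsCellSystem M h C) (hN : 0 < N) (hh : 0 < h)
    {c₀ r₀ νmin νmax : ℝ} (hc₀ : 0 < c₀)
    (hc₀' : c₀ * (2 ^ d * volume.real (ball (0 : Euc d) 1)) ≤ (1 / (32 * d)) ^ d)
    (hr₀ : r₀ ≤ N * h) (hmin : νmin ≤ ((2 * (N * h)) ^ d)⁻¹)
    (hmax : ((N * h / 2) ^ d)⁻¹ ≤ νmax) :
    IsRegularMeasure (manifoldVolume d M) c₀ r₀ νmin νmax (cellUniform M C) := by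
  have hS := hC.isCompact_union.measurableSet
  have hsub := support_cellUniform_subset hC
  refine ⟨fun x hx r hr hrr => ?_, _, measurable_const.indicator hS, rfl, fun x hx => ?_⟩
  · have hxS := hsub hx
    -- the support exhausts the union of the cells up to a null set
    have hnull : manifoldVolume d M ((⋃ k, C k) ∩ (cellUniform M C).supportᶜ) = 0 := by
      have h1 : cellUniform M C (cellUniform M C).supportᶜ = 0 := Measure.measure_compl_support
      rw [cellUniform_apply hC, mul_eq_zero] at h1
      exact h1.resolve_left (ENNReal.inv_ne_zero.2 hC.total_ne_top)
    have h2 : manifoldVolume d M ((⋃ k, C k) ∩ ball x r) ≤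
        manifoldVolume d M ((cellUniform M C).support ∩ ball x r) := by
      have h3 : (⋃ k, C k) ∩ ball x r ⊆ ((cellUniform M C).support ∩ ball x r) ∪
          ((⋃ k, C k) ∩ (cellUniform M C).supportᶜ) := fun y hy => by
        by_cases hys : y ∈ (cellUniform M C).support
        · exact Or.inl ⟨hys, hy.2⟩
        · exact Or.inr ⟨hy.1, hys⟩
      refine (measure_mono h3).trans ((measure_union_le _ _).trans ?_)
      rw [hnull, add_zero]
    refine le_trans ?_ ((hC.regular x hxS r hr (hrr.trans_le hr₀)).trans h2)
    refine (mul_le_mul_right (hC.ball_le x hxS r hr (hrr.trans_le hr₀)) _).trans ?_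
    have hv : volume (ball (0 : Euc d) 1) = ENNReal.ofReal (volume.real (ball (0 : Euc d) 1)) :=
      (ofReal_measureReal measure_ball_lt_top.ne).symm
    have h2 : (2 : ℝ≥0∞) ^ d = ENNReal.ofReal (2 ^ d) := by
      rw [ENNReal.ofReal_pow (by norm_num)]; simp
    rw [hv, h2, ← ENNReal.ofReal_pow hr.le, ← ENNReal.ofReal_pow (by positivity),
      ← ENNReal.ofReal_mul (by positivity), ← ENNReal.ofReal_mul (by positivity),
      ← ENNReal.ofReal_mul hc₀.le]
    apply ENNReal.ofReal_le_ofReal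
    calc c₀ * (2 ^ d * (r ^ d * volume.real (ball (0 : Euc d) 1)))
        = (c₀ * (2 ^ d * volume.real (ball (0 : Euc d) 1))) * r ^ d := by ring
      _ ≤ (1 / (32 * d)) ^ d * r ^ d := by gcongr
      _ = (r / (32 * d)) ^ d := by rw [← mul_pow]; congr 1; ring
  · rw [indicator_of_mem (hsub hx)]
    exact ⟨(ENNReal.ofReal_le_ofReal hmin).trans (hC.le_inv_total hN hh),
      (hC.inv_total_le hN hh).trans (ENNReal.ofReal_le_ofReal hmax)⟩

theorem dimensionAssumption_cellUniform (hC : IsCellSystem M h C) (hN : 0 < N) (hh : 0 < h)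
    {c₀ νmin R : ℝ} (hc₀ : 0 < c₀)
    (hc₀' : c₀ * (2 ^ d * volume.real (ball (0 : Euc d) 1)) ≤ (1 / (32 * d)) ^ d)
    (hR : R ≤ N * h) (hmin0 : 0 < νmin) (hmin : νmin ≤ ((2 * (N * h)) ^ d)⁻¹) :
    DimensionAssumption (cellUniform M C) R d
      (ENNReal.ofReal (νmin * c₀ * ((2 : ℝ) ^ d)⁻¹) * volume (ball (0 : Euc d) 1)) := by
  intro x hx r hr hrr
  have hxS := support_cellUniform_subset hC hx
  rw [cellUniform_apply hC]
  refine le_trans ?_ (mul_le_mul' ((ENNReal.ofReal_le_ofReal hmin).trans (hC.le_inv_total hN hh))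
    (hC.regular x hxS r hr (hrr.trans_le hR)))
  have hv : volume (ball (0 : Euc d) 1) = ENNReal.ofReal (volume.real (ball (0 : Euc d) 1)) :=
    (ofReal_measureReal measure_ball_lt_top.ne).symm
  have hv0 : 0 ≤ volume.real (ball (0 : Euc d) 1) := measureReal_nonneg
  rw [hv, ← ENNReal.ofReal_pow (by positivity), ← ENNReal.ofReal_mul (by positivity),
    ← ENNReal.ofReal_mul (by positivity), ← ENNReal.ofReal_mul hmin0.le]
  apply ENNReal.ofReal_le_ofReal
  have h2 : ((2 : ℝ) ^ d)⁻¹ ≤ 2 ^ d := by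
    have h3 : (1 : ℝ) ≤ 2 ^ d := one_le_pow₀ (by norm_num)
    exact (inv_le_one_of_one_le₀ h3).trans h3
  calc νmin * c₀ * ((2 : ℝ) ^ d)⁻¹ * volume.real (ball (0 : Euc d) 1) * r ^ d
      ≤ νmin * c₀ * 2 ^ d * volume.real (ball (0 : Euc d) 1) * r ^ d := by gcongr
    _ = νmin * ((c₀ * (2 ^ d * volume.real (ball (0 : Euc d) 1))) * r ^ d) := by ring
    _ ≤ νmin * ((1 / (32 * d)) ^ d * r ^ d) := by gcongr
    _ = νmin * (r / (32 * d)) ^ d := by rw [← mul_pow]; congr 2; ring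

end Covariates

/-! ### Two-level reward functions -/

section TwoLevel

variable {D A : ℕ} (a₀ : Fin A) (F : Euc D → ℝ)

/-- The reward functions in which the arm `a₀` has mean `F` and all other arms have mean `1 / 2`. -/
noncomputable def twoLevel (b : Fin A) (x : Euc D) : ℝ := if b = a₀ then F x else 1 / 2

/-- The oracle for `twoLevel`, which falls back on the arm `a₁`. -/
noncomputable def twoLevelOracle (a₁ : Fin A) (x : Euc D) : Fin A := if 1 / 2 ≤ F x then a₀ else a₁

variable {a₀ F} {a₁ : Fin A}

theorem isOracle_twoLevelOracle (hF : Measurable F) (ha : a₁ ≠ a₀) :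
    IsOracle (twoLevel a₀ F) (twoLevelOracle a₀ F a₁) := by
  refine ⟨Measurable.ite (measurableSet_le measurable_const hF) measurable_const measurable_const,
    fun x b => ?_⟩
  unfold twoLevel twoLevelOracle
  by_cases hx : 1 / 2 ≤ F x
  · rw [if_pos hx, if_pos rfl]
    split_ifs <;> linarith
  · rw [if_neg hx, if_neg ha]
    split_ifs <;> linarith

theorem lipschitzAssumption_twoLevel {lam : ℝ} (hlam : 0 ≤ lam)
    (hF : ∀ x y, |F x - F y| ≤ lam * dist x y) : LipschitzAssumption (twoLevel a₀ F) lam := by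
  intro b x y
  unfold twoLevel
  split_ifs
  · exact hF x y
  · rw [sub_self, abs_zero]; positivity

/-- The arms other than `a₀` all have the same mean, so that the only positive sub-optimality, if any,
is the distance of `F x` to `1 / 2`. -/
theorem margin_twoLevel (hF : Measurable F) (ha : a₁ ≠ a₀) (x : Euc D) :
    margin (twoLevel a₀ F) x = |F x - 1 / 2| := by
  obtain ⟨-, ho⟩ := isOracle_twoLevelOracle hF ha
  have hsup : ⨆ b, twoLevel a₀ F b x = twoLevel a₀ F (twoLevelOracle a₀ F a₁ x) x := by
    have : Nonempty (Fin A) := ⟨a₀⟩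
    exact le_antisymm (ciSup_le fun b => ho x b)
      (le_ciSup (f := fun b => twoLevel a₀ F b x) (Set.finite_range _).bddAbove _)
  have hset : {t : ℝ | 0 < t ∧ ∃ a, subopt (twoLevel a₀ F) a x = t} =
      if F x = 1 / 2 then ∅ else {|F x - 1 / 2|} := by
    ext t
    simp only [subopt, hsup]
    unfold twoLevel twoLevelOracle
    by_cases hx : 1 / 2 ≤ F x
    · rw [if_pos hx, if_pos rfl]
      constructor
      · rintro ⟨ht, a, rfl⟩
        by_cases haa : a = a₀
        · simp [haa] at ht
        · rw [if_neg haa] at ht ⊢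
          rw [if_neg (by intro h; linarith), mem_singleton_iff, abs_of_pos ht]
      · split_ifs with h
        · simp
        · intro ht
          rw [mem_singleton_iff, abs_of_nonneg (by linarith)] at ht
          refine ⟨?_, a₁, by rw [if_neg ha, ht]⟩
          rw [ht]
          exact sub_pos.2 (lt_of_le_of_ne hx (Ne.symm h))
    · have hx' := not_le.1 hx
      rw [if_neg hx, if_neg ha, if_neg hx'.ne, abs_of_neg (by linarith), mem_singleton_iff]
      constructor
      · rintro ⟨ht, a, rfl⟩
        by_cases haa : a = a₀
        · simp [haa]
        · simp [haa] at ht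
      · rintro rfl
        exact ⟨by linarith, a₀, by simp⟩
  rw [margin, hset]
  split_ifs with h
  · simp [h]
  · simp

end TwoLevel

/-! ### A hard instance -/

/-- On a system of cells of mesh `h`, with `lam h / 4` as the size of the perturbation and the
perturbation active on the cells in `K`, some choice of signs satisfies all the assumptions and
forces a regret of the order of the size of the perturbation times the mass of the active cells. -/
theorem exists_hard_instance {d D N A : ℕ} {M : Set (Euc D)} {h : ℝ}
    {C : (Fin d → Fin N) → Set (Euc D)} (hC : IsCellSystem M h C) (hN : 0 < N) (hh : 0 < h)
    (hA : 2 ≤ A) {S : Type} [MeasurableSpace S] (ρ : Measure S) [IsProbabilityMeasure ρ]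
    (π : Policy S D A) (n : ℕ) {lam : ℝ} (hlam : 0 < lam) (hε : lam * h / 4 ≤ 1 / 2)
    (hinfo : n * (4 * (lam * h / 4) ^ 2 * (2 / N) ^ d) ≤ 1 / 4)
    (K : Finset (Fin d → Fin N)) {δα Cα α : ℝ} (hα : 0 < α) (hCα : 0 < Cα)
    (hK : K.card * (2 / N : ℝ) ^ d ≤ Cα * (lam * h / 4) ^ α) :
    ∃ (P : Measure (Sample D A)) (f : Fin A → Euc D → ℝ) (o : Euc D → Fin A),
      IsProbabilityMeasure P ∧ marginal P = cellUniform M C ∧ IsRewardFunction P f ∧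
      LipschitzAssumption f lam ∧ MarginAssumption (marginal P) f δα Cα α ∧ IsOracle f o ∧
      n * (lam * h / 4 / 8 * (K.card * (1 / (4 * N)) ^ d)) ≤ π.expectedRegret ρ P o n := by
  set ε := lam * h / 4 with hεdef
  have hε0 : 0 < ε := by positivity
  have hN' : (0 : ℝ) < N := by exact_mod_cast hN
  set μ := cellUniform M C with hμ
  have hμprob : IsProbabilityMeasure μ := isProbabilityMeasure_cellUniform hC hN hh
  let a₀ : Fin A := ⟨0, by omega⟩
  let a₁ : Fin A := ⟨1, by omega⟩
  have ha : a₁ ≠ a₀ := by simp [a₀, a₁]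
  -- the active cells
  let C' : K → Set (Euc D) := fun k => C k
  have hdisjC : ∀ j k, j ≠ k → Disjoint (C j) (C k) := fun j k hjk => by
    rw [Set.disjoint_left]
    intro x hxj hxk
    have := hC.sep j k hjk x hxj x hxk
    rw [dist_self] at this
    linarith
  have hC'm : ∀ k, MeasurableSet (C' k) := fun k => (hC.isCompact k).measurableSet
  have hC'd : ∀ j k, j ≠ k → Disjoint (C' j) (C' k) := fun j k hjk =>
    hdisjC j k fun h => hjk (Subtype.ext h)
  set g : (K → Bool) → Euc D → ℝ := fun σ => perturbation ε C' fun j => boolSign (σ j) with hg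
  have hgm : ∀ σ, Measurable (g σ) := fun σ => measurable_perturbation hC'm _
  have hgε : ∀ σ x, |g σ x| ≤ ε := fun σ x =>
    abs_perturbation_le hC'd hε0.le (fun j => (abs_boolSign _).le) x
  have hgb : ∀ σ x, |g σ x| ≤ 1 / 2 := fun σ x => (hgε σ x).trans hε
  -- the perturbation is Lipschitz on the union of the cells, as the cells are separated
  have hgL : ∀ σ, LipschitzOnWith (Real.toNNReal lam) (fun x => 1 / 2 + g σ x) (⋃ k, C k) := by
    intro σ
    refine LipschitzOnWith.of_dist_le_mul fun x hx y hy => ?_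
    rw [Real.coe_toNNReal _ hlam.le, Real.dist_eq]
    obtain ⟨j, hj⟩ := mem_iUnion.1 hx
    obtain ⟨k, hk⟩ := mem_iUnion.1 hy
    rw [add_sub_add_left_eq_sub]
    by_cases hjk : j = k
    · subst hjk
      have : g σ x = g σ y := by
        by_cases hjK : j ∈ K
        · rw [hg]
          simp only
          rw [perturbation_of_mem hC'd _ (show x ∈ C' ⟨j, hjK⟩ from hj),
            perturbation_of_mem hC'd _ (show y ∈ C' ⟨j, hjK⟩ from hk)]
        · have hout : ∀ z ∈ C j, ∀ i : K, z ∉ C' i := fun z hz i hzi =>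
            Set.disjoint_left.1 (hdisjC i j fun h => hjK (h ▸ i.2)) hzi hz
          rw [hg]
          simp only
          rw [perturbation_of_notMem _ (hout x hj), perturbation_of_notMem _ (hout y hk)]
      rw [this, sub_self, abs_zero]; positivity
    · have h1 := hC.sep j k hjk x hj y hk
      have h2 : |g σ x - g σ y| ≤ 2 * ε :=
        (abs_sub _ _).trans (by linarith [hgε σ x, hgε σ y])
      have h3 : 2 * ε = lam * (h / 2) := by rw [hεdef]; ring
      rw [h3] at h2
      exact h2.trans (by gcongr)
  -- the reward function has to be Lipschitz on the whole space, not only on the support of `μ`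
  choose F hFL hFeq using fun σ => (hgL σ).extend_real
  have hFm : ∀ σ, Measurable (F σ) := fun σ => (hFL σ).continuous.measurable
  have hFl : ∀ σ x y, |F σ x - F σ y| ≤ lam * dist x y := fun σ x y => by
    have := (hFL σ).dist_le_mul x y
    rwa [Real.coe_toNNReal _ hlam.le, Real.dist_eq] at this
  have hFS : ∀ σ, ∀ x ∈ ⋃ k, C k, F σ x = 1 / 2 + g σ x := fun σ x hx => (hFeq σ hx).symm
  have hSae : ∀ᵐ x ∂μ, x ∈ ⋃ k, C k := by
    rw [ae_iff]
    exact cellUniform_compl hC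
  have hC'S : ∀ (k : K) x, x ∈ C' k → x ∈ ⋃ k, C k := fun k x hx => mem_iUnion.2 ⟨k, hx⟩
  have hcell : ∀ k, μ.real (C k) ≤ (2 / N) ^ d := fun k =>
    ENNReal.toReal_le_of_le_ofReal (by positivity) (cellUniform_cell_le hC hN hh k)
  have hcell' : ∀ k, (1 / (4 * N)) ^ d ≤ μ.real (C k) := fun k =>
    (ENNReal.ofReal_le_iff_le_toReal (measure_ne_top _ _)).1 (le_cellUniform_cell hC hN hh k)
  obtain ⟨σ, hσ⟩ := exists_expectedRegret_ge (ε := ε) (C := C') μ a₀ π ρ hC'm hC'd hε0.le hε n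
    (fun k => by
      refine le_trans ?_ hinfo
      gcongr
      exact hcell k)
    (o := fun σ => twoLevelOracle a₀ (F σ) a₁)
    (fun σ => (isOracle_twoLevelOracle (hFm σ) ha).1)
    (fun σ k x hx => by
      have h1 : F σ x = 1 / 2 + ε * boolSign (σ k) := by
        rw [hFS σ x (hC'S k x hx), hg]
        simp only
        rw [perturbation_of_mem hC'd _ hx]
      unfold twoLevelOracle
      rw [h1]
      cases hk : σ k with
      | true => simp [boolSign, hε0.le]
      | false => simp [boolSign, hε0, ha])
  have hmarg : marginal (sampleLaw μ a₀ (g σ)) = μ := marginal_sampleLaw μ a₀ (hgm σ) (hgb σ)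
  refine ⟨sampleLaw μ a₀ (g σ), twoLevel a₀ (F σ), twoLevelOracle a₀ (F σ) a₁,
    isProbabilityMeasure_sampleLaw μ a₀ (hgm σ) (hgb σ), hmarg, ?_,
    lipschitzAssumption_twoLevel hlam.le (hFl σ), ?_, isOracle_twoLevelOracle (hFm σ) ha, ?_⟩
  · refine isRewardFunction_sampleLaw μ a₀ (hgm σ) (hgb σ) (fun b => ?_) (fun b => ?_)
    · unfold twoLevel
      split_ifs
      · exact hFm σ
      · exact measurable_const
    · filter_upwards [hSae] with x hx
      unfold twoLevel meanReward
      split_ifs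
      · exact hFS σ x hx
      · simp
  · rw [hmarg]
    intro δ hδ _
    simp_rw [margin_twoLevel (hFm σ) ha]
    -- up to a null set, the margin is `ε` on the active cells and `0` elsewhere
    have hsub : {x | 0 < |F σ x - 1 / 2| ∧ |F σ x - 1 / 2| < δ} ⊆
        (⋃ k, C k)ᶜ ∪ if ε < δ then ⋃ k ∈ K, C k else ∅ := by
      rintro x ⟨hx1, hx2⟩
      by_cases hxS : x ∈ ⋃ k, C k
      · right
        rw [hFS σ x hxS, add_sub_cancel_left] at hx1 hx2
        by_cases hxK : ∃ k : K, x ∈ C' k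
        · obtain ⟨k, hk⟩ := hxK
          have h1 : |g σ x| = ε := by
            rw [hg]
            simp only
            rw [perturbation_of_mem hC'd _ hk, abs_mul, abs_boolSign, mul_one, abs_of_pos hε0]
          rw [h1] at hx2
          rw [if_pos hx2]
          exact mem_iUnion₂.2 ⟨k, k.2, hk⟩
        · push Not at hxK
          have h1 : g σ x = 0 := perturbation_of_notMem _ hxK
          simp [h1] at hx1
      · exact Or.inl hxS
    refine (measure_mono hsub).trans ((measure_union_le _ _).trans ?_)
    rw [cellUniform_compl hC, zero_add]
    split_ifs with hδε
    · refine (measure_biUnion_finset_le _ _).trans ?_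
      refine (Finset.sum_le_sum fun k _ => cellUniform_cell_le hC hN hh k).trans ?_
      rw [Finset.sum_const, nsmul_eq_mul, ← ENNReal.ofReal_natCast,
        ← ENNReal.ofReal_mul (by positivity)]
      apply ENNReal.ofReal_le_ofReal
      refine hK.trans ?_
      gcongr
    · simp
  · refine le_trans ?_ hσ
    gcongr
    have h1 : ∑ _k : K, (1 / (4 * N : ℝ)) ^ d ≤ ∑ k : K, μ.real (C' k) :=
      Finset.sum_le_sum fun k _ => hcell' k
    rw [Finset.sum_const, Finset.card_univ, Fintype.card_coe, nsmul_eq_mul] at h1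
    exact h1

/-! ### Choice of the mesh -/

set_option maxHeartbeats 800000 in
/-- The choice of the number `N` of cells per side: of the order `n ^ (1 / (d + 2))`, with a
constant that makes all the requirements of the construction hold. -/
theorem exists_mesh (d : ℕ) {ℓ α Cα lam : ℝ} (hℓ : 0 < ℓ) (hα : 0 < α) (hαd : α < d)
    (hCα : 0 < Cα) (hlam : 0 < lam) :
    ∃ c > 0, ∀ n : ℕ, ∃ N m : ℕ, 0 < N ∧ m ≤ N ^ d ∧ lam * (ℓ / N) / 4 ≤ 1 / 2 ∧
      n * (4 * (lam * (ℓ / N) / 4) ^ 2 * (2 / N) ^ d) ≤ 1 / 4 ∧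
      m * (2 / N : ℝ) ^ d ≤ Cα * (lam * (ℓ / N) / 4) ^ α ∧
      c * (n : ℝ) ^ (1 - (α + 1) / ((d : ℝ) + 2)) ≤
        n * (lam * (ℓ / N) / 4 / 8 * (m * (1 / (4 * N)) ^ d)) := by
  -- truncating `Cα` keeps the number of active cells below the total number of cells
  set c₁ := min Cα 1 with hc₁
  have hc₁0 : 0 < c₁ := by positivity
  have hdα : 0 < (d : ℝ) - α := by linarith
  set κ := c₁ * (lam * ℓ / 4) ^ α * (1 / 2) ^ d with hκ
  have hκ0 : 0 < κ := by positivity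
  -- the four terms make `B` at least `1`, `ε` at most `1 / 2`, the information per cell at most
  -- `1 / 4`, and the number of active cells allowed by the margin condition at least `1`
  set B := 1 + lam * ℓ + lam ^ 2 * ℓ ^ 2 * 2 ^ d + (κ⁻¹) ^ (((d : ℝ) - α)⁻¹) with hB
  have hB3 : 0 < (κ⁻¹) ^ (((d : ℝ) - α)⁻¹) := by positivity
  have hB1 : 1 ≤ B := by
    have : 0 < lam * ℓ := by positivity
    have : 0 < lam ^ 2 * ℓ ^ 2 * 2 ^ d := by positivity
    linarith
  have hBl : lam * ℓ ≤ B := by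
    have : 0 < lam ^ 2 * ℓ ^ 2 * 2 ^ d := by positivity
    linarith
  have hBi : lam ^ 2 * ℓ ^ 2 * 2 ^ d ≤ B := by
    have : 0 < lam * ℓ := by positivity
    linarith
  have hBκ : (κ⁻¹) ^ (((d : ℝ) - α)⁻¹) ≤ B := by
    have : 0 < lam * ℓ := by positivity
    have : 0 < lam ^ 2 * ℓ ^ 2 * 2 ^ d := by positivity
    linarith
  have hB0 : 0 < B := by linarith
  have hd2 : (0 : ℝ) < d + 2 := by positivity
  refine ⟨c₁ / 16 * (1 / 8) ^ d * (lam * ℓ / (16 * B)) ^ (1 + α), by positivity, fun n => ?_⟩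
  set s : ℝ := ((n : ℝ) + 1) ^ (((d : ℝ) + 2)⁻¹) with hs
  have hs1 : 1 ≤ s := Real.one_le_rpow (by linarith [(Nat.cast_nonneg n : (0 : ℝ) ≤ n)])
    (by positivity)
  have hspow : s ^ (d + 2) = n + 1 := by
    rw [hs, ← Real.rpow_natCast, ← Real.rpow_mul (by positivity)]
    push_cast
    rw [inv_mul_cancel₀ hd2.ne', Real.rpow_one]
  set N := ⌈B * s⌉₊ with hN
  have hBs : 1 ≤ B * s := by nlinarith
  have hNge : B * s ≤ N := Nat.le_ceil _
  have hNB : B ≤ N := le_trans (by nlinarith) hNge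
  have hNle : (N : ℝ) ≤ 2 * (B * s) := by
    have := (Nat.ceil_lt_add_one (by positivity : 0 ≤ B * s)).le
    linarith
  have hN0 : (0 : ℝ) < N := by linarith
  set ε := lam * (ℓ / N) / 4 with hε
  have hεN : ε = lam * ℓ / 4 / N := by rw [hε]; ring
  have hε0 : 0 < ε := by positivity
  have hε2 : ε ≤ 1 / 2 := by
    rw [hεN, div_le_iff₀ hN0]; linarith
  -- the number of active cells that the margin condition allows, before rounding
  set X := c₁ * ε ^ α * (N / 2 : ℝ) ^ d with hX
  have hX1 : 1 ≤ X := by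
    have h1 : X = κ * (N : ℝ) ^ ((d : ℝ) - α) := by
      rw [hX, hκ, hεN, Real.div_rpow (by positivity) hN0.le, Real.rpow_sub hN0, Real.rpow_natCast,
        div_pow, div_pow]
      ring
    have h2 : κ⁻¹ ≤ (N : ℝ) ^ ((d : ℝ) - α) := by
      calc κ⁻¹ = ((κ⁻¹) ^ (((d : ℝ) - α)⁻¹)) ^ ((d : ℝ) - α) := by
            rw [← Real.rpow_mul (by positivity), inv_mul_cancel₀ hdα.ne', Real.rpow_one]
        _ ≤ (N : ℝ) ^ ((d : ℝ) - α) := by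
            gcongr
            exact hBκ.trans hNB
    rw [h1]
    calc 1 = κ * κ⁻¹ := (mul_inv_cancel₀ hκ0.ne').symm
      _ ≤ _ := by gcongr
  set m := ⌊X⌋₊ with hm
  have hmX : (m : ℝ) ≤ X := Nat.floor_le (by linarith)
  have hm2 : X / 2 ≤ m := by
    have h1 : X < m + 1 := Nat.lt_floor_add_one X
    have h2 : (1 : ℝ) ≤ m := by
      exact_mod_cast (Nat.le_floor (by exact_mod_cast hX1) : 1 ≤ ⌊X⌋₊)
    linarith
  have hεα : ε ^ α ≤ 1 := Real.rpow_le_one hε0.le (by linarith) hα.le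
  refine ⟨N, m, by exact_mod_cast hN0, ?_, hε2, ?_, ?_, ?_⟩
  · have h1 : X ≤ (N : ℝ) ^ d := by
      calc X ≤ 1 * 1 * (N : ℝ) ^ d := by
            rw [hX]
            gcongr
            · exact min_le_right _ _
            · linarith
        _ = _ := by ring
    exact_mod_cast hmX.trans h1
  · have h1 : (n : ℝ) * (4 * ε ^ 2 * (2 / N) ^ d) =
        1 / 4 * ((lam ^ 2 * ℓ ^ 2 * 2 ^ d) * n / (N : ℝ) ^ (d + 2)) := by
      have h2N : (2 / N : ℝ) ^ d = 2 ^ d / (N : ℝ) ^ d := div_pow _ _ _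
      rw [hεN, h2N, pow_add]
      field_simp
    rw [h1]
    have h2 : (lam ^ 2 * ℓ ^ 2 * 2 ^ d) * n ≤ (N : ℝ) ^ (d + 2) := by
      calc (lam ^ 2 * ℓ ^ 2 * 2 ^ d) * n ≤ B * (n + 1) := by gcongr; linarith
        _ ≤ B ^ (d + 2) * s ^ (d + 2) := by
            rw [hspow]
            gcongr
            exact le_self_pow₀ hB1 (by omega)
        _ = (B * s) ^ (d + 2) := (mul_pow _ _ _).symm
        _ ≤ _ := by gcongr
    have h3 : (lam ^ 2 * ℓ ^ 2 * 2 ^ d) * n / (N : ℝ) ^ (d + 2) ≤ 1 :=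
      div_le_one_of_le₀ h2 (by positivity)
    linarith
  · calc (m : ℝ) * (2 / N) ^ d ≤ X * (2 / N) ^ d := by gcongr
      _ = c₁ * ε ^ α := by
          rw [hX, mul_assoc, ← mul_pow, show (N / 2 : ℝ) * (2 / N) = 1 by field_simp, one_pow,
            mul_one]
      _ ≤ Cα * ε ^ α := by
          gcongr
          exact min_le_left _ _
  · rcases Nat.eq_zero_or_pos n with hn | hn
    · subst hn
      have hexp : 1 - (α + 1) / ((d : ℝ) + 2) ≠ 0 := by
        have : (α + 1) / ((d : ℝ) + 2) < 1 := by rw [div_lt_one hd2]; linarith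
        linarith
      simp [Real.zero_rpow hexp]
    · have hn1 : (1 : ℝ) ≤ n := by exact_mod_cast hn
      have hn0 : (0 : ℝ) < n := by linarith
      set u : ℝ := (n : ℝ) ^ (((d : ℝ) + 2)⁻¹) with hu
      have hu0 : 0 < u := by positivity
      have hsu : s ≤ 2 * u := by
        calc s ≤ (2 * n : ℝ) ^ (((d : ℝ) + 2)⁻¹) := by
              rw [hs]; gcongr; linarith
          _ = 2 ^ (((d : ℝ) + 2)⁻¹) * u := Real.mul_rpow (by norm_num) hn0.le
          _ ≤ 2 ^ (1 : ℝ) * u := by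
              gcongr
              · norm_num
              · exact inv_le_one_of_one_le₀ (by linarith [(Nat.cast_nonneg d : (0 : ℝ) ≤ d)])
          _ = 2 * u := by rw [Real.rpow_one]
      have hNu : (N : ℝ) ≤ 4 * B * u := hNle.trans (by nlinarith)
      have hεu : lam * ℓ / (16 * B) * u⁻¹ ≤ ε := by
        rw [hεN, ← div_eq_mul_inv, div_div, div_div]
        exact div_le_div_of_nonneg_left (by positivity) (by positivity) (by linarith)
      have hpow : (lam * ℓ / (16 * B)) ^ (1 + α) * (u⁻¹) ^ (1 + α) ≤ ε ^ (1 + α) := by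
        rw [← Real.mul_rpow (by positivity) (by positivity)]
        gcongr
      have hun : (n : ℝ) ^ (1 - (α + 1) / ((d : ℝ) + 2)) = n * (u⁻¹) ^ (1 + α) := by
        rw [Real.rpow_sub hn0, Real.rpow_one, hu, ← Real.rpow_neg hn0.le, ← Real.rpow_mul hn0.le,
          div_eq_mul_inv (n : ℝ), ← Real.rpow_neg hn0.le]
        congr 2
        field_simp
        ring
      have hX2 : ε / 8 * (X / 2 * (1 / (4 * N)) ^ d) = c₁ / 16 * (1 / 8) ^ d * ε ^ (1 + α) := by
        have h8 : (1 / 8 : ℝ) ^ d = (N / 2 : ℝ) ^ d * (1 / (4 * N)) ^ d := by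
          rw [← mul_pow]; congr 1; field_simp; norm_num
        rw [hX, h8, Real.rpow_add hε0, Real.rpow_one]
        ring
      have hm3 : X / 2 * (1 / (4 * N : ℝ)) ^ d ≤ m * (1 / (4 * N)) ^ d :=
        mul_le_mul_of_nonneg_right hm2 (by positivity)
      have hm4 := mul_le_mul_of_nonneg_left hm3 (by positivity : 0 ≤ ε / 8)
      have hp2 := mul_le_mul_of_nonneg_left hpow
        (by positivity : 0 ≤ c₁ / 16 * (1 / 8) ^ d)
      have hm5 := mul_le_mul_of_nonneg_left ((hp2.trans hX2.ge).trans hm4) hn0.le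
      rw [hun]
      refine le_trans (le_of_eq ?_) hm5
      generalize (lam * ℓ / (16 * B)) ^ (1 + α) = p
      generalize (u⁻¹) ^ (1 + α) = q
      ring

end ManifoldBandit

open MeasureTheory Metric ManifoldBandit in
theorem mainTheorem1 :
    ∃ Z : ℝ, 0 < Z ∧
    ∀ (d : ℕ) (τ : ℝ), 0 < τ →
    ∃ C₀ R₀ Vlo Vhi : ℝ, 0 < C₀ ∧ 0 < R₀ ∧ 0 < Vlo ∧ 0 < Vhi ∧
    ∀ c₀ r₀ νmin νmax δα α Cα lam : ℝ,
      0 < c₀ → c₀ < C₀ → 0 < r₀ → r₀ < R₀ → 0 < νmin → νmin < Vlo → Vhi < νmax →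
      0 < δα → δα < Z → 0 < α → α < d → 0 < Cα → 0 < lam →
    ∃ C : ℝ, 0 < C ∧
    ∀ (D : ℕ) (M : Set (Euc D)),
      IsCompact M → IsSmoothSubmanifold d D M → reach M = ENNReal.ofReal τ →
    ∀ A : ℕ, 2 ≤ A →
    ∀ (S : Type) [MeasurableSpace S] (ρ : Measure S) [IsProbabilityMeasure ρ]
      (π : Policy S D A) (n : ℕ),
    ∃ (P : Measure (Sample D A)) (f : Fin A → Euc D → ℝ) (o : Euc D → Fin A),
      IsProbabilityMeasure P ∧
      IsRegularMeasure (manifoldVolume d M) c₀ r₀ νmin νmax (marginal P) ∧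
      DimensionAssumption (marginal P) (min (τ / 4) r₀) d
        (ENNReal.ofReal (νmin * c₀ * ((2 : ℝ) ^ d)⁻¹) * volume (ball (0 : Euc d) 1)) ∧
      IsRewardFunction P f ∧
      LipschitzAssumption f lam ∧
      MarginAssumption (marginal P) f δα Cα α ∧
      IsOracle f o ∧
      C * (n : ℝ) ^ (1 - (α + 1) / ((d : ℝ) + 2)) ≤ π.expectedRegret ρ P o n := by
  refine ⟨1, one_pos, fun d τ hτ0 => ?_⟩
  rcases Nat.eq_zero_or_pos d with hd | hd
  · -- in dimension `0` there is no `α ∈ (0, d)`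
    subst hd
    refine ⟨1, 1, 1, 1, one_pos, one_pos, one_pos, one_pos, ?_⟩
    intro c₀ r₀ νmin νmax δα α Cα lam _ _ _ _ _ _ _ _ _ hα hαd
    exact absurd (hα.trans hαd) (by simp)
  have hd' : (0 : ℝ) < d := by exact_mod_cast hd
  -- `ℓ` is the side of the cube that parametrizes the piece of `M` carrying the cells
  obtain ⟨ℓ, hℓ⟩ : ∃ ℓ : ℝ, ℓ = τ / 800 / (4 * d) := ⟨_, rfl⟩
  have hℓ0 : 0 < ℓ := by rw [hℓ]; positivity
  have hv : 0 < volume.real (ball (0 : Euc d) 1) :=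
    ENNReal.toReal_pos (measure_ball_pos _ _ one_pos).ne' measure_ball_lt_top.ne
  refine ⟨(1 / (32 * d)) ^ d / (2 ^ d * volume.real (ball (0 : Euc d) 1)), ℓ, ((2 * ℓ) ^ d)⁻¹,
    ((ℓ / 2) ^ d)⁻¹, by positivity, hℓ0, by positivity, by positivity, ?_⟩
  intro c₀ r₀ νmin νmax δα α Cα lam hc₀ hc₀' hr₀ hr₀' hmin0 hmin hmax _ _ hα hαd hCα hlam
  obtain ⟨c, hc, H⟩ := exists_mesh d hℓ0 hα hαd hCα hlam
  refine ⟨c, hc, fun D M hM hsm hreach A hA S _ ρ _ π n => ?_⟩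
  obtain ⟨N, m, hN, hmN, hε, hinfo, hmass, hrate⟩ := H n
  have hN' : (0 : ℝ) < N := by exact_mod_cast hN
  have hNh : N * (ℓ / N) = ℓ := by field_simp
  obtain ⟨C, hC⟩ := exists_isCellSystem hd hM hsm hτ0 hreach hN (hNh.trans hℓ)
  have hh : 0 < ℓ / N := by positivity
  obtain ⟨K, -, hK⟩ := Finset.exists_subset_card_eq
    (s := (Finset.univ : Finset (Fin d → Fin N))) (n := m) (by simpa using hmN)
  have hc : c₀ * (2 ^ d * volume.real (ball (0 : Euc d) 1)) ≤ (1 / (32 * d)) ^ d :=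
    ((lt_div_iff₀ (by positivity)).1 hc₀').le
  obtain ⟨P, f, o, hP, hPm, hf, hfl, hfm, ho, hreg⟩ := exists_hard_instance (δα := δα) hC hN hh hA
    ρ π n hlam hε hinfo K hα hCα (by rw [hK]; exact hmass)
  refine ⟨P, f, o, hP, ?_, ?_, hf, hfl, hfm, ho, hrate.trans (by rw [← hK]; exact hreg)⟩
  · rw [hPm]
    exact isRegularMeasure_cellUniform hC hN hh hc₀ hc (hNh.symm ▸ hr₀'.le) (hNh.symm ▸ hmin.le)
      (hNh.symm ▸ hmax.le)
  · rw [hPm]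
    exact dimensionAssumption_cellUniform hC hN hh hc₀ hc
      (hNh.symm ▸ (min_le_right _ _).trans hr₀'.le) hmin0 (hNh.symm ▸ hmin.le)
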